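/- Let $0\le k\le n$ be integers and let $G(n,k)$ be the Grassmannian of $k$-dimensional linear subspaces of Euclidean space $\mathbb R^n$. Equip $O_m(\mathbb R)$, for each $m\ge 0$, with the Riemannian metric induced by its embedding in the space of real $m\times m$ matrices with inner product $\langle X,Y\rangle=\operatorname{tr}(X^{T}Y)$, and equip $G(n,k)$ with the Riemannian metric induced from $O_n(\mathbb R)$ as the homogeneous space $O_n(\mathbb R)/(O_k(\mathbb R)\times O_{n-k}(\mathbb R))$; write $dO_n(\mathbb R)$ and $dG(n,k)$ for the corresponding Riemannian volume measures and $\mathrm{vol}\,O_m(\mathbb R)$ for the total volume of $O_m(\mathbb R)$ (so $\mathrm{vol}\,O_0(\mathbb R)=1$ and $\mathrm{vol}\,O_1(\mathbb R)=2$). For $M\in GL_n(\mathbb R)$ and $g\in G(n,k)$ let $M_\#g\in G(n,k)$ be the image of $g$ under $M$, and let $|\det M|_g|$ be the absolute value of the determinant of the restriction $M|_g\colon g\to M_\#g$ with respect to orthonormal bases of $g$ and $M_\#g$. Let $\log^+x=\max\{\log x,0\}$, and put $$c_{n,k}=\frac{\mathrm{vol}\,O_k(\mathbb R)\cdot\mathrm{vol}\,O_{n-k}(\mathbb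 R)}{\binom nk}.$$ Then for every $A\in GL_n(\mathbb R)$ both integrands below are integrable, and $$\int_{U\in O_n(\mathbb R)}\Bigl[\sup_{g\in G(n,k):\,(UA)_\#g=g}\log^+\bigl|\det (UA)|_g\bigr|\Bigr]\,dO_n(\mathbb R)\ \ge\ c_{n,k}\int_{g\in G(n,k)}\log^+\bigl|\det A|_g\bigr|\,dG(n,k),$$ where the supremum is taken to be $0$ if no $g\in G(n,k)$ satisfies $(UA)_\#g=g$. -/

import Mathlib

open MeasureTheory

noncomputable section

section Frobenius

/- Real matrices carry the inner product `⟨X, Y⟩ = tr (Xᵀ Y)`, whose norm is the Frobenius norm. -/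
attribute [local instance] Matrix.frobeniusNormedAddCommGroup

/-- The metric on `O_n(ℝ)` inherited from its embedding in the Euclidean space of `n × n` real
matrices with the inner product `tr (Xᵀ Y)`. -/
instance orthogonalMetric (n : ℕ) : MetricSpace (Matrix.orthogonalGroup (Fin n) ℝ) :=
  Subtype.metricSpace

instance orthogonalMeasurableSpace (n : ℕ) :
    MeasurableSpace (Matrix.orthogonalGroup (Fin n) ℝ) := borel _

instance orthogonalBorelSpace (n : ℕ) : BorelSpace (Matrix.orthogonalGroup (Fin n) ℝ) := ⟨rfl⟩

/-- The same fact, for the topology of `orthogonalMetric` (definitionally the usual topology). -/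
instance orthogonalBorelSpaceMetric (n : ℕ) :
    @BorelSpace (Matrix.orthogonalGroup (Fin n) ℝ)
      (orthogonalMetric n).toPseudoMetricSpace.toUniformSpace.toTopologicalSpace _ := ⟨rfl⟩

/-- The Grassmannian of `k`-dimensional linear subspaces of Euclidean `n`-space. -/
@[ext]
structure Grass (n k : ℕ) where
  /-- the underlying linear subspace -/
  space : Submodule ℝ (EuclideanSpace ℝ (Fin n))
  finrank_eq : Module.finrank ℝ space = k

/-- The matrix (in the standard basis) of the orthogonal projection onto `g`. -/
def projMatrix {n k : ℕ} (g : Grass n k) : Matrix (Fin n) (Fin n) ℝ :=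
  Matrix.toEuclideanLin.symm (g.space.starProjection : _ →ₗ[ℝ] _)

theorem projMatrix_injective (n k : ℕ) :
    Function.Injective (projMatrix : Grass n k → Matrix (Fin n) (Fin n) ℝ) := by
  intro g h hgh
  have h1 := Matrix.toEuclideanLin.symm.injective hgh
  exact Grass.ext (Submodule.starProjection_inj.1 (ContinuousLinearMap.coe_injective h1))

/-- The metric on the Grassmannian inherited from its embedding `g ↦ P_g` (orthogonal projection)
in the Euclidean space of matrices with inner product `tr (Xᵀ Y)`.

The Riemannian structure it induces is the one of the homogeneous space `O_n / (O_k × O_{n-k})`: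
the orbit map `U ↦ P_{U g} = U P_g Uᵀ` has differential `X ↦ X P_g - P_g X` at the identity, which
vanishes on the block-diagonal skew matrices (the Lie algebra of the stabilizer of `g`), and sends
the orthogonal complement of these, the skew matrices with blocks `0, -Bᵀ, B, 0`, isometrically to
the symmetric matrices with blocks `0, Bᵀ, B, 0`.  So the orbit map is a Riemannian submersion. -/
instance grassMetric (n k : ℕ) : MetricSpace (Grass n k) :=
  MetricSpace.induced projMatrix (projMatrix_injective n k) inferInstance

instance grassMeasurableSpace (n k : ℕ) : MeasurableSpace (Grass n k) := borel _

instance grassBorelSpace (n k : ℕ) : BorelSpace (Grass n k) := ⟨rfl⟩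

end Frobenius

/-- The Riemannian volume measure of `O_n(ℝ)`, as the Hausdorff measure of dimension
`dim O_n = n (n - 1) / 2`, normalized so as to agree with Lebesgue measure on Euclidean space. -/
def orthogonalVolume (n : ℕ) : Measure (Matrix.orthogonalGroup (Fin n) ℝ) :=
  μHE[n * (n - 1) / 2]

/-- The Riemannian volume measure of the Grassmannian, as the Hausdorff measure of dimension
`dim G(n, k) = k (n - k)`, normalized so as to agree with Lebesgue measure on Euclidean space. -/
def grassVolume (n k : ℕ) : Measure (Grass n k) :=
  μHE[k * (n - k)]

/-- The constant `c_{n,k} = vol O_k · vol O_{n-k} / (n choose k)`. -/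
def cConst (n k : ℕ) : ℝ :=
  (orthogonalVolume k).real Set.univ * (orthogonalVolume (n - k)).real Set.univ / (n.choose k : ℝ)

/-- `|det M|_g|`: the absolute value of the determinant of `M : g → M g` in orthonormal bases
of `g` and of its image. -/
def absDetOn {n k : ℕ} (M : Matrix (Fin n) (Fin n) ℝ) (g : Grass n k) : ℝ :=
  ((Matrix.toEuclideanLin M).comp g.space.subtype).normDet

/-- The `k`-planes `g` with `M_# g = g`. -/
def fixedPlanes {n : ℕ} (k : ℕ) (M : Matrix (Fin n) (Fin n) ℝ) : Set (Grass n k) :=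
  {g | g.space.map (Matrix.toEuclideanLin M) = g.space}

/-- `sup {log⁺ |det M|_g| : g a k-plane with M_# g = g}`, which is `0` if there is no such `g`. -/
def supFixed {n : ℕ} (k : ℕ) (M : Matrix (Fin n) (Fin n) ℝ) : ℝ :=
  ⨆ g : fixedPlanes k M, Real.posLog (absDetOn M g.1)

end

noncomputable section

/-
Write `m = n - k` and let `O_n → G(n, k)` send `W` to the span of its first `k` columns; this is a
fibration with fibre `O_k × O_m`, and `O_n` is locally, to first order, the product of base and
fibre.

Given a plane `g`, replace `A` by a rotation `V A` of it that maps `g` into itself, with diagonal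
blocks `a` on `g` and `d` on its complement. If the rotation `U` is a small displacement of
`(h₁, h₂)` in `O_k × O_m` by `y` in the direction of `G(n, k)`, then the fixed planes of `U A` near
`g` have coordinates `x` with `x - h₂ d x (h₁ a)⁻¹ = y` to first order. So the volume of the
rotations `U` for which `U A` has a fixed plane in the `δ`-ball around `g` is, relative to that of
the ball and as `δ → 0`, at least the integral over `O_k × O_m` of `|det (1 - (h₁ a)⁻ᵀ ⊗ h₂ d)|`.
After a polar decomposition and a translation, this determinant at `v⁻¹ w` is by Cauchy-Binet a sum
of terms `φ(v) φ(w)`, to which the constant functions contribute `1`; since every term has a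
nonnegative integral, the mean Jacobian is at least `1`.

On the other hand the nondegenerate fixed planes of a matrix are kernels of the factors of degree
`k` of its characteristic polynomial, so there are at most `n.choose k` of them. Counting the pairs
of a rotation `U` and a fixed plane of `U A` in both ways, with weight `log⁺ |det A|_g|` (which `U`
does not change), and letting `δ → 0` by Fatou's lemma gives the inequality.
-/

section Minors

open Matrix

variable {ι κ R : Type*} [Fintype ι] [DecidableEq ι] [Fintype κ] [CommRing R]

theorem det_transpose_mul_eq_sum (M N : Matrix κ ι R) :
    (Mᵀ * N).det = ∑ f : ι → κ, (∏ i, M (f i) i) * (N.submatrix f id).det := by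
  classical
  have hrow : Mᵀ * N = fun i => ∑ j, M j i • N j := by
    ext i l
    simp [mul_apply, Finset.sum_apply]
  rw [hrow]
  exact (detRowAlternating.toMultilinearMap.map_sum fun i j => M j i • N j).trans <|
    Finset.sum_congr rfl fun f _ =>
      detRowAlternating.map_smul_univ (fun i => M (f i) i) fun i => N (f i)

theorem sum_det_submatrix_mul_det_submatrix (M N : Matrix κ ι R) :
    ∑ f : ι → κ, (M.submatrix f id).det * (N.submatrix f id).det =
      (Fintype.card ι).factorial * (Mᵀ * N).det := by
  have hperm (σ : Equiv.Perm ι) : ∑ f : ι → κ,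
      (Equiv.Perm.sign σ : ℤ) * (∏ i, M (f (σ i)) i) * (N.submatrix f id).det =
        (Mᵀ * N).det := by
    rw [det_transpose_mul_eq_sum,
      ← (Equiv.arrowCongr σ.symm (Equiv.refl κ)).sum_comp fun f =>
        (∏ i, M (f i) i) * (N.submatrix f id).det]
    refine Finset.sum_congr rfl fun f _ => ?_
    have hdet : (N.submatrix (f ∘ σ) id).det = (Equiv.Perm.sign σ : ℤ) * (N.submatrix f id).det :=
      det_permute σ (N.submatrix f id)
    change _ = (∏ i, M (f (σ i)) i) * (N.submatrix (f ∘ σ) id).det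
    rw [hdet]
    ring
  calc ∑ f : ι → κ, (M.submatrix f id).det * (N.submatrix f id).det
      = ∑ f : ι → κ, ∑ σ : Equiv.Perm ι,
          (Equiv.Perm.sign σ : ℤ) * (∏ i, M (f (σ i)) i) * (N.submatrix f id).det := by
        simp only [det_apply' (M.submatrix _ id), Finset.sum_mul, submatrix_apply, id_eq]
    _ = ∑ _σ : Equiv.Perm ι, (Mᵀ * N).det := by rw [Finset.sum_comm]; simp_rw [hperm]
    _ = (Fintype.card ι).factorial * (Mᵀ * N).det := by simp [Fintype.card_perm]

theorem sum_det_submatrix_fromRows_mul_det_submatrix_fromRows (X Y : Matrix κ ι R) :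
    ∑ f : ι → κ ⊕ ι, ((fromRows X 1).submatrix f id).det * ((fromRows Y 1).submatrix f id).det =
      (Fintype.card ι).factorial * (1 + Xᵀ * Y).det := by
  rw [sum_det_submatrix_mul_det_submatrix, transpose_fromRows, fromCols_mul_fromRows,
    transpose_one, Matrix.one_mul, add_comm]

end Minors

section Averaging

open Matrix

variable {G : Type*} [MeasurableSpace G]

theorem measureReal_univ_mul_integral_eq_sum_sq [Group G] [MeasurableMul G] {α : Type*}
    [Fintype α] (μ : Measure G) [μ.IsMulLeftInvariant] {F : G → ℝ}
    {φ : α → G → ℝ} (hφ : ∀ a, Integrable (φ a) μ)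
    (hF : ∀ v w, F (v⁻¹ * w) = ∑ a, φ a v * φ a w) :
    μ.real Set.univ * ∫ h, F h ∂μ = ∑ a, (∫ v, φ a v ∂μ) ^ 2 := by
  have htranslate (v : G) : ∫ h, F h ∂μ = ∑ a, φ a v * ∫ w, φ a w ∂μ := by
    rw [← integral_mul_left_eq_self F v⁻¹]
    simp_rw [hF]
    rw [integral_finsetSum _ fun a _ => (hφ a).const_mul _]
    simp_rw [integral_const_mul]
  calc μ.real Set.univ * ∫ h, F h ∂μ = ∫ _, ∫ h, F h ∂μ ∂μ := by
        rw [integral_const, smul_eq_mul]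
    _ = ∫ v, ∑ a, φ a v * ∫ w, φ a w ∂μ ∂μ := integral_congr_ae (.of_forall htranslate)
    _ = ∑ a, (∫ v, φ a v ∂μ) ^ 2 := by
        rw [integral_finsetSum _ fun a _ => (hφ a).mul_const _]
        simp_rw [integral_mul_const, sq]

variable {ι κ : Type*} [Fintype ι] [Fintype κ]

-- The minors on permutations of the rows of the identity block are constant, equal to `± 1`.
theorem factorial_mul_measureReal_univ_sq_le_sum_sq [DecidableEq ι] (μ : Measure G)
    (X : G → Matrix κ ι ℝ) :
    (Fintype.card ι).factorial * μ.real Set.univ ^ 2 ≤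
      ∑ f : ι → κ ⊕ ι, (∫ v, ((fromRows (X v) 1).submatrix f id).det ∂μ) ^ 2 := by
  classical
  let e : Equiv.Perm ι ↪ (ι → κ ⊕ ι) :=
    ⟨fun σ i => Sum.inr (σ i), fun σ τ h => Equiv.ext fun i => Sum.inr_injective (congrFun h i)⟩
  have hperm (σ : Equiv.Perm ι) :
      (∫ v, ((fromRows (X v) 1).submatrix (e σ) id).det ∂μ) ^ 2 = μ.real Set.univ ^ 2 := by
    have hdet (v : G) :
        ((fromRows (X v) 1).submatrix (e σ) id).det = ((Equiv.Perm.sign σ : ℤ) : ℝ) := by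
      have : (fromRows (X v) 1).submatrix (e σ) id = (1 : Matrix ι ι ℝ).submatrix σ id := rfl
      rw [this, det_permute, det_one, mul_one]
    simp_rw [hdet]
    rw [integral_const, smul_eq_mul, mul_pow]
    rcases Int.units_eq_one_or (Equiv.Perm.sign σ) with h | h <;> simp [h]
  calc (Fintype.card ι).factorial * μ.real Set.univ ^ 2
      = ∑ σ : Equiv.Perm ι, (∫ v, ((fromRows (X v) 1).submatrix (e σ) id).det ∂μ) ^ 2 := by
        simp [hperm, Fintype.card_perm]
    _ = ∑ f ∈ Finset.univ.map e, (∫ v, ((fromRows (X v) 1).submatrix f id).det ∂μ) ^ 2 := by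
        rw [Finset.sum_map]
    _ ≤ _ := Finset.sum_le_sum_of_subset_of_nonneg (Finset.subset_univ _) fun f _ _ => sq_nonneg _

-- `det (1 + R ρ(v⁻¹w) Rᵀ)` is a positive definite kernel in `(v, w)`: by Cauchy-Binet it is a sum
-- of products `φ(v) φ(w)` over the maximal minors `φ` of the matrix with blocks `ρ(v) Rᵀ` and `1`.
theorem measureReal_univ_le_integral_det_one_add [Group G] [TopologicalSpace G] [CompactSpace G]
    [OpensMeasurableSpace G] [MeasurableMul G] [DecidableEq κ] (μ : Measure G)
    [IsFiniteMeasure μ] [μ.IsMulLeftInvariant] {ρ : G → Matrix κ κ ℝ} (hρ : Continuous ρ)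
    (hmul : ∀ v w, ρ (v⁻¹ * w) = (ρ v)ᵀ * ρ w) (R : Matrix ι κ ℝ) :
    μ.real Set.univ ≤ ∫ h, (1 + ρ h * (Rᵀ * R)).det ∂μ := by
  classical
  let φ : (ι → κ ⊕ ι) → G → ℝ := fun f v => ((fromRows (ρ v * Rᵀ) 1).submatrix f id).det
  have hφ (f : ι → κ ⊕ ι) : Integrable (φ f) μ := by
    have hrows : Continuous fun v => fromRows (ρ v * Rᵀ) (1 : Matrix ι ι ℝ) := by
      refine continuous_pi fun i => continuous_pi fun j => ?_
      rcases i with i | i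
      · exact (hρ.matrix_mul continuous_const).matrix_elem i j
      · exact continuous_const
    exact (hrows.matrix_submatrix f id).matrix_det.integrable_of_hasCompactSupport
      (.of_compactSpace _)
  have hkernel (v w : G) : (Fintype.card ι).factorial * (1 + ρ (v⁻¹ * w) * (Rᵀ * R)).det =
      ∑ f, φ f v * φ f w := by
    rw [sum_det_submatrix_fromRows_mul_det_submatrix_fromRows, hmul, transpose_mul,
      transpose_transpose, ← Matrix.mul_assoc _ Rᵀ, det_one_add_mul_comm]
    simp only [Matrix.mul_assoc]
  have hsq : (Fintype.card ι).factorial * μ.real Set.univ ^ 2 ≤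
      μ.real Set.univ * ((Fintype.card ι).factorial * ∫ h, (1 + ρ h * (Rᵀ * R)).det ∂μ) := by
    rw [← integral_const_mul, measureReal_univ_mul_integral_eq_sum_sq μ hφ hkernel]
    exact factorial_mul_measureReal_univ_sq_le_sum_sq μ _
  rcases (measureReal_nonneg (μ := μ) (s := Set.univ)).eq_or_lt with hzero | hpos
  · have hμ : μ = 0 :=
      Measure.measure_univ_eq_zero.1 ((measureReal_eq_zero_iff).1 hzero.symm)
    simp [hμ]
  · rw [sq, mul_left_comm] at hsq
    exact le_of_mul_le_mul_left (le_of_mul_le_mul_left hsq hpos) (by positivity)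

end Averaging

section Orthogonal

open Matrix

variable {ι : Type*} [Fintype ι]

open scoped MatrixOrder ComplexOrder in
theorem exists_posSemidef_mul_self_eq {A : Matrix ι ι ℝ} (hA : A.PosSemidef) :
    ∃ s : Matrix ι ι ℝ, s.PosSemidef ∧ s * s = A := by
  classical
  exact ⟨CFC.sqrt A, (CFC.sqrt_nonneg A).posSemidef, CFC.sqrt_mul_sqrt_self A hA.nonneg⟩

variable [DecidableEq ι]

-- Polar decomposition, with the positive factor written as `pᵀ * p`.
theorem exists_orthogonal_mul_transpose_mul {b : Matrix ι ι ℝ} (hb : IsUnit b.det) :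
    ∃ u : orthogonalGroup ι ℝ, ∃ p : Matrix ι ι ℝ, b = u * (pᵀ * p) := by
  obtain ⟨s, hs, hss⟩ : ∃ s : Matrix ι ι ℝ, s.PosSemidef ∧ s * s = bᵀ * b :=
    exists_posSemidef_mul_self_eq (posSemidef_conjTranspose_mul_self b)
  obtain ⟨p, hp, hps⟩ := exists_posSemidef_mul_self_eq hs
  have hsT : sᵀ = s := hs.1.eq
  have hpT : pᵀ = p := hp.1.eq
  have hdet : IsUnit s.det := by
    refine isUnit_of_mul_isUnit_left (y := s.det) ?_
    rw [← det_mul, hss, det_mul, det_transpose]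
    exact hb.mul hb
  refine ⟨⟨b * s⁻¹, ?_⟩, p, ?_⟩
  · rw [mem_orthogonalGroup_iff', transpose_mul, transpose_nonsing_inv, hsT,
      Matrix.mul_assoc, ← Matrix.mul_assoc bᵀ, ← hss,
      Matrix.mul_assoc, mul_nonsing_inv _ hdet, Matrix.mul_one, nonsing_inv_mul _ hdet]
  · rw [hpT, hps]
    exact (nonsing_inv_mul_cancel_right _ _ hdet).symm

instance orthogonalGroup_compactSpace : CompactSpace (orthogonalGroup ι ℝ) := by
  have hbox : IsCompact (Set.univ.pi fun _ : ι => Set.univ.pi fun _ : ι => Set.Icc (-1 : ℝ) 1) :=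
    isCompact_univ_pi fun _ => isCompact_univ_pi fun _ => isCompact_Icc
  have hclosed : IsClosed (orthogonalGroup ι ℝ : Set (Matrix ι ι ℝ)) := isClosed_unitary
  refine isCompact_iff_compactSpace.1 (hbox.of_isClosed_subset hclosed ?_)
  exact fun U hU i _ j _ => abs_le.1 (entry_norm_bound_of_unitary (𝕜 := ℝ) hU i j)

instance orthogonalGroup_secondCountableTopology :
    SecondCountableTopology (orthogonalGroup ι ℝ) :=
  haveI : SecondCountableTopology (Matrix ι ι ℝ) :=
    inferInstanceAs (SecondCountableTopology (ι → ι → ℝ))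
  TopologicalSpace.Subtype.secondCountableTopology _

theorem orthogonalGroup_coe_inv (U : orthogonalGroup ι ℝ) :
    ((U⁻¹ : orthogonalGroup ι ℝ) : Matrix ι ι ℝ) = (U : Matrix ι ι ℝ)ᵀ :=
  rfl

theorem orthogonalGroup_transpose_mul_self (U : orthogonalGroup ι ℝ) :
    (U : Matrix ι ι ℝ)ᵀ * (U : Matrix ι ι ℝ) = 1 :=
  (mem_orthogonalGroup_iff' _ _).1 U.2

theorem orthogonalGroup_mul_transpose_self (U : orthogonalGroup ι ℝ) :
    (U : Matrix ι ι ℝ) * (U : Matrix ι ι ℝ)ᵀ = 1 :=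
  (mem_orthogonalGroup_iff _ _).1 U.2

end Orthogonal

section KroneckerAverage

open Matrix
open scoped Kronecker

theorem continuous_kronecker {X ι κ : Type*} [TopologicalSpace X] {a : X → Matrix ι ι ℝ}
    {b : X → Matrix κ κ ℝ} (ha : Continuous a) (hb : Continuous b) :
    Continuous fun x => a x ⊗ₖ b x :=
  continuous_pi fun i => continuous_pi fun j =>
    (ha.matrix_elem i.1 j.1).mul (hb.matrix_elem i.2 j.2)

variable {k m : ℕ} (μ : Measure (orthogonalGroup (Fin k) ℝ)) [IsFiniteMeasure μ]
  [μ.IsMulLeftInvariant] (ν : Measure (orthogonalGroup (Fin m) ℝ)) [IsFiniteMeasure ν]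
  [ν.IsMulLeftInvariant]

theorem measureReal_univ_le_integral_det_one_add_kronecker (p : Matrix (Fin k) (Fin k) ℝ)
    (q : Matrix (Fin m) (Fin m) ℝ) :
    (μ.prod ν).real Set.univ ≤
      ∫ h, (1 + (h.1.1 * (pᵀ * p)) ⊗ₖ (h.2.1 * (qᵀ * q))).det ∂μ.prod ν := by
  have hmul (v w : orthogonalGroup (Fin k) ℝ × orthogonalGroup (Fin m) ℝ) :
      (v⁻¹ * w).1.1 ⊗ₖ (v⁻¹ * w).2.1 = (v.1.1 ⊗ₖ v.2.1)ᵀ * (w.1.1 ⊗ₖ w.2.1) := by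
    rw [← kroneckerMap_transpose, ← mul_kronecker_mul]
    rfl
  have h := measureReal_univ_le_integral_det_one_add (μ.prod ν)
    (continuous_kronecker (continuous_subtype_val.comp continuous_fst)
      (continuous_subtype_val.comp continuous_snd)) hmul (p ⊗ₖ q)
  simpa only [Function.comp_apply, ← kroneckerMap_transpose, ← mul_kronecker_mul] using h

theorem measure_univ_mul_measure_univ_le_lintegral_abs_det [μ.IsMulRightInvariant]
    [ν.IsMulRightInvariant] {b : Matrix (Fin k) (Fin k) ℝ} {d : Matrix (Fin m) (Fin m) ℝ}
    (hb : IsUnit b.det) (hd : IsUnit d.det) :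
    μ Set.univ * ν Set.univ ≤
      ∫⁻ h, ENNReal.ofReal |(1 - (h.1.1 * b) ⊗ₖ (h.2.1 * d)).det| ∂μ.prod ν := by
  obtain ⟨u, p, rfl⟩ := exists_orthogonal_mul_transpose_mul hb
  obtain ⟨v, q, rfl⟩ := exists_orthogonal_mul_transpose_mul hd
  let F : orthogonalGroup (Fin k) ℝ × orthogonalGroup (Fin m) ℝ → ℝ := fun h =>
    (1 - (h.1.1 * (u.1 * (pᵀ * p))) ⊗ₖ (h.2.1 * (v.1 * (qᵀ * q)))).det
  have hF : Integrable F (μ.prod ν) :=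
    (continuous_const.sub (continuous_kronecker
      ((continuous_subtype_val.comp continuous_fst).matrix_mul continuous_const)
      ((continuous_subtype_val.comp continuous_snd).matrix_mul continuous_const))).matrix_det
      |>.integrable_of_hasCompactSupport (.of_compactSpace _)
  -- The polar factors `u`, `v` and the sign are absorbed by a right translation.
  have htranslate (h : orthogonalGroup (Fin k) ℝ × orthogonalGroup (Fin m) ℝ) :
      F (h * (u⁻¹, -v⁻¹)) = (1 + (h.1.1 * (pᵀ * p)) ⊗ₖ (h.2.1 * (qᵀ * q))).det := by
    have hfst : (h.1 * u⁻¹).1 * (u.1 * (pᵀ * p)) = h.1.1 * (pᵀ * p) := by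
      rw [Submonoid.coe_mul, orthogonalGroup_coe_inv, Matrix.mul_assoc, ← Matrix.mul_assoc _ᵀ,
        orthogonalGroup_transpose_mul_self, Matrix.one_mul]
    have hsnd : (h.2 * -v⁻¹).1 * (v.1 * (qᵀ * q)) = (-1 : ℝ) • (h.2.1 * (qᵀ * q)) := by
      rw [mul_neg, Unitary.coe_neg, Submonoid.coe_mul, orthogonalGroup_coe_inv, Matrix.neg_mul,
        Matrix.mul_assoc, ← Matrix.mul_assoc _ᵀ, orthogonalGroup_transpose_mul_self,
        Matrix.one_mul, neg_one_smul]
    change (1 - ((h.1 * u⁻¹).1 * (u.1 * (pᵀ * p))) ⊗ₖ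
      ((h.2 * -v⁻¹).1 * (v.1 * (qᵀ * q)))).det = _
    rw [hfst, hsnd, kronecker_smul, neg_one_smul, sub_neg_eq_add]
  have hreal : (μ.prod ν).real Set.univ ≤ ∫ h, |F h| ∂μ.prod ν :=
    calc (μ.prod ν).real Set.univ
        ≤ ∫ h, (1 + (h.1.1 * (pᵀ * p)) ⊗ₖ (h.2.1 * (qᵀ * q))).det ∂μ.prod ν :=
          measureReal_univ_le_integral_det_one_add_kronecker μ ν p q
      _ = ∫ h, F h ∂μ.prod ν := by
          simp_rw [← htranslate]
          exact integral_mul_right_eq_self F _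
      _ ≤ ∫ h, |F h| ∂μ.prod ν := integral_mono hF hF.abs fun h => le_abs_self _
  have hlintegral := ENNReal.ofReal_le_ofReal hreal
  rwa [ofReal_integral_eq_lintegral_ofReal hF.abs (.of_forall fun _ => abs_nonneg _),
    ofReal_measureReal, ← Set.univ_prod_univ, Measure.prod_prod] at hlintegral

end KroneckerAverage

section Blocks

open Matrix Polynomial

variable {R : Type*} {k m : ℕ}

/-- The block matrix with the given blocks, indexed by `Fin (k + m)` rather than by
`Fin k ⊕ Fin m`, so that it acts on `ℝ^(k+m)`. -/
def finBlocks (a : Matrix (Fin k) (Fin k) R) (b : Matrix (Fin k) (Fin m) R)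
    (c : Matrix (Fin m) (Fin k) R) (d : Matrix (Fin m) (Fin m) R) :
    Matrix (Fin (k + m)) (Fin (k + m)) R :=
  (fromBlocks a b c d).submatrix finSumFinEquiv.symm finSumFinEquiv.symm

/-- The upper left block of a matrix indexed by `Fin (k + m)`. -/
def ulBlock (M : Matrix (Fin (k + m)) (Fin (k + m)) R) : Matrix (Fin k) (Fin k) R :=
  (M.submatrix finSumFinEquiv finSumFinEquiv).toBlocks₁₁

/-- The upper right block of a matrix indexed by `Fin (k + m)`. -/
def urBlock (M : Matrix (Fin (k + m)) (Fin (k + m)) R) : Matrix (Fin k) (Fin m) R :=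
  (M.submatrix finSumFinEquiv finSumFinEquiv).toBlocks₁₂

/-- The lower left block of a matrix indexed by `Fin (k + m)`, as a linear map because it gets
differentiated. -/
def llBlock [Semiring R] :
    Matrix (Fin (k + m)) (Fin (k + m)) R →ₗ[R] Matrix (Fin m) (Fin k) R where
  toFun M := (M.submatrix finSumFinEquiv finSumFinEquiv).toBlocks₂₁
  map_add' _ _ := by ext; rfl
  map_smul' _ _ := by ext; rfl

/-- The lower right block of a matrix indexed by `Fin (k + m)`. -/
def lrBlock (M : Matrix (Fin (k + m)) (Fin (k + m)) R) : Matrix (Fin m) (Fin m) R :=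
  (M.submatrix finSumFinEquiv finSumFinEquiv).toBlocks₂₂

variable (a a' : Matrix (Fin k) (Fin k) R) (b b' : Matrix (Fin k) (Fin m) R)
  (c c' : Matrix (Fin m) (Fin k) R) (d d' : Matrix (Fin m) (Fin m) R)

@[simp] theorem ulBlock_finBlocks : ulBlock (finBlocks a b c d) = a := by
  simp [ulBlock, finBlocks]

@[simp] theorem urBlock_finBlocks : urBlock (finBlocks a b c d) = b := by
  simp [urBlock, finBlocks]

@[simp] theorem lrBlock_finBlocks : lrBlock (finBlocks a b c d) = d := by
  simp [lrBlock, finBlocks]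

theorem finBlocks_transpose : (finBlocks a b c d)ᵀ = finBlocks aᵀ cᵀ bᵀ dᵀ := by
  simp [finBlocks, fromBlocks_transpose]

section Semiring

variable [Semiring R]

theorem llBlock_apply (M : Matrix (Fin (k + m)) (Fin (k + m)) R) :
    llBlock M = (M.submatrix finSumFinEquiv finSumFinEquiv).toBlocks₂₁ := rfl

@[simp] theorem llBlock_finBlocks : llBlock (finBlocks a b c d) = c := by
  simp [llBlock_apply, finBlocks]

theorem finBlocks_blocks (M : Matrix (Fin (k + m)) (Fin (k + m)) R) :
    finBlocks (ulBlock M) (urBlock M) (llBlock M) (lrBlock M) = M := by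
  rw [finBlocks, ulBlock, urBlock, llBlock_apply, lrBlock, fromBlocks_toBlocks]
  simp

theorem finBlocks_mul : finBlocks a b c d * finBlocks a' b' c' d' =
    finBlocks (a * a' + b * c') (a * b' + b * d') (c * a' + d * c') (c * b' + d * d') := by
  simp only [finBlocks]
  rw [submatrix_mul_equiv, fromBlocks_multiply]

theorem finBlocks_add : finBlocks a b c d + finBlocks a' b' c' d' =
    finBlocks (a + a') (b + b') (c + c') (d + d') := by
  rw [finBlocks, finBlocks, finBlocks, ← fromBlocks_add]
  rfl

theorem finBlocks_smul (r : R) :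
    r • finBlocks a b c d = finBlocks (r • a) (r • b) (r • c) (r • d) := by
  simp only [finBlocks, ← fromBlocks_smul, submatrix_smul, Pi.smul_apply]

theorem finBlocks_one :
    finBlocks (1 : Matrix (Fin k) (Fin k) R) 0 0 (1 : Matrix (Fin m) (Fin m) R) = 1 := by
  simp [finBlocks, fromBlocks_one]

end Semiring

section CommRing

variable [CommRing R]

theorem finBlocks_neg : -finBlocks a b c d = finBlocks (-a) (-b) (-c) (-d) := by
  simp only [finBlocks, ← fromBlocks_neg, submatrix_neg, Pi.neg_apply]

theorem finBlocks_sub : finBlocks a b c d - finBlocks a' b' c' d' =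
    finBlocks (a - a') (b - b') (c - c') (d - d') := by
  simp only [sub_eq_add_neg, finBlocks_neg, finBlocks_add]

theorem det_finBlocks_zero : (finBlocks a b 0 d).det = a.det * d.det := by
  simp [finBlocks, det_submatrix_equiv_self]

theorem charpoly_finBlocks_zero : (finBlocks a b 0 d).charpoly = a.charpoly * d.charpoly := by
  rw [← charpoly_fromBlocks_zero₂₁ a b d, ← charpoly_reindex finSumFinEquiv]
  rfl

theorem exists_finBlocks_zero_pow (n : ℕ) :
    ∃ b', finBlocks a b 0 d ^ n = finBlocks (a ^ n) b' 0 (d ^ n) := by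
  induction n with
  | zero => exact ⟨0, by simp only [pow_zero, finBlocks_one]⟩
  | succ n ih =>
    obtain ⟨b', hb'⟩ := ih
    refine ⟨a ^ n * b + b' * d, ?_⟩
    rw [pow_succ, hb', finBlocks_mul]
    simp only [Matrix.zero_mul, Matrix.mul_zero, add_zero, zero_add, ← pow_succ]

theorem exists_aeval_finBlocks_zero (p : R[X]) :
    ∃ b', aeval (finBlocks a b 0 d) p = finBlocks (aeval a p) b' 0 (aeval d p) := by
  induction p using Polynomial.induction_on' with
  | add p q hp hq =>
    obtain ⟨b₁, h₁⟩ := hp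
    obtain ⟨b₂, h₂⟩ := hq
    exact ⟨b₁ + b₂, by simp only [map_add, h₁, h₂, finBlocks_add, add_zero]⟩
  | monomial n r =>
    obtain ⟨b', hb'⟩ := exists_finBlocks_zero_pow a b d n
    refine ⟨r • b', ?_⟩
    simp only [aeval_monomial, ← Algebra.smul_def, hb', finBlocks_smul, smul_zero]

theorem finBlocks_zero_mulVec_eq_zero_iff (hd : IsUnit d.det) (y : Fin (k + m) → R) :
    finBlocks 0 b 0 d *ᵥ y = 0 ↔ ∀ i, y (Fin.natAdd k i) = 0 := by
  set z : Fin m → R := fun i => y (Fin.natAdd k i) with hz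
  have hy : y ∘ finSumFinEquiv = Sum.elim (fun i => y (Fin.castAdd m i)) z := by
    ext (i | i) <;> simp [hz]
  have hmul : finBlocks 0 b 0 d *ᵥ y = Sum.elim (b *ᵥ z) (d *ᵥ z) ∘ finSumFinEquiv.symm := by
    rw [finBlocks, submatrix_mulVec_equiv, Equiv.symm_symm, hy, fromBlocks_mulVec]
    simp
  suffices finBlocks 0 b 0 d *ᵥ y = 0 ↔ z = 0 by rwa [funext_iff (f := z)] at this
  rw [hmul]
  constructor
  · intro h
    have hdz : d *ᵥ z = 0 := by
      ext i
      simpa using congrFun h (finSumFinEquiv (Sum.inr i))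
    rw [← one_mulVec z, ← nonsing_inv_mul _ hd, ← mulVec_mulVec, hdz, mulVec_zero]
  · intro h
    simp [h]

end CommRing

end Blocks

section Sylvester

open Matrix Polynomial
open scoped Kronecker

variable {R ι κ : Type*} [Fintype ι] [DecidableEq ι] [Fintype κ] [DecidableEq κ]

/-- The matrix, with respect to `Matrix.vec`, of the Sylvester operator `X ↦ X a - d X`.  It is
invertible exactly when `a` and `d` have no common eigenvalue. -/
def sylvesterOperator [CommRing R] (a : Matrix ι ι R) (d : Matrix κ κ R) :
    Matrix (ι × κ) (ι × κ) R :=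
  aᵀ ⊗ₖ (1 : Matrix κ κ R) - (1 : Matrix ι ι R) ⊗ₖ d

theorem sylvesterOperator_mulVec_vec [CommRing R] (a : Matrix ι ι R) (d : Matrix κ κ R)
    (X : Matrix κ ι R) :
    sylvesterOperator a d *ᵥ X.vec = (X * a - d * X).vec := by
  rw [sylvesterOperator, sub_mulVec, kronecker_mulVec_vec, kronecker_mulVec_vec]
  simp

theorem det_sylvesterOperator_map {S : Type*} [CommRing R] [CommRing S] (f : R →+* S)
    (a : Matrix ι ι R) (d : Matrix κ κ R) :
    (sylvesterOperator (a.map f) (d.map f)).det = f (sylvesterOperator a d).det := by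
  rw [f.map_det]
  congr 1
  ext i j
  simp [sylvesterOperator, one_apply, apply_ite f]

variable {K : Type*} [Field K] {a : Matrix ι ι K} {d : Matrix κ κ K}

theorem det_sylvesterOperator_eq_zero_of_isRoot {r : K} (ha : a.charpoly.IsRoot r)
    (hd : d.charpoly.IsRoot r) :
    (sylvesterOperator a d).det = 0 := by
  rw [IsRoot, eval_charpoly, scalar_apply, ← smul_one_eq_diagonal] at ha hd
  obtain ⟨w, hw0, hw⟩ := exists_vecMul_eq_zero_iff.2 ha
  obtain ⟨u, hu0, hu⟩ := exists_mulVec_eq_zero_iff.2 hd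
  rw [vecMul_sub, vecMul_smul, vecMul_one, sub_eq_zero] at hw
  rw [sub_mulVec, smul_mulVec, one_mulVec, sub_eq_zero] at hu
  have hintertwine : vecMulVec u w * a = d * vecMulVec u w := by
    rw [vecMulVec_mul, mul_vecMulVec, ← hu, ← hw, vecMulVec_smul, smul_vecMulVec]
  refine exists_mulVec_eq_zero_iff.1 ⟨(vecMulVec u w).vec, ?_, ?_⟩
  · obtain ⟨i, hi⟩ := Function.ne_iff.1 hu0
    obtain ⟨j, hj⟩ := Function.ne_iff.1 hw0
    exact fun h => mul_ne_zero hi hj (congrFun h (j, i))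
  · rw [sylvesterOperator_mulVec_vec, hintertwine, sub_self, vec_zero]

theorem isCoprime_charpoly_of_det_sylvesterOperator_ne_zero (h : (sylvesterOperator a d).det ≠ 0) :
    IsCoprime a.charpoly d.charpoly := by
  rw [isCoprime_iff_aeval_ne_zero_of_isAlgClosed (k := K) (AlgebraicClosure K)]
  intro r
  by_contra! hr
  refine h ((algebraMap K (AlgebraicClosure K)).injective ?_)
  rw [← det_sylvesterOperator_map, map_zero]
  apply det_sylvesterOperator_eq_zero_of_isRoot (r := r)
  · rw [charpoly_map, IsRoot, eval_map_algebraMap, hr.1]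
  · rw [charpoly_map, IsRoot, eval_map_algebraMap, hr.2]

theorem isUnit_det_aeval_charpoly (h : (sylvesterOperator a d).det ≠ 0) :
    IsUnit (aeval d a.charpoly).det := by
  obtain ⟨p, q, hpq⟩ := isCoprime_charpoly_of_det_sylvesterOperator_ne_zero h
  have hone : aeval d p * aeval d a.charpoly = 1 := by
    simpa [aeval_self_charpoly] using congrArg (aeval d) hpq
  exact isUnit_det_of_left_inverse hone

end Sylvester

section Planes

open Matrix

variable {ι κ : Type*} [Fintype ι] [DecidableEq ι] [Fintype κ] [DecidableEq κ]

/-- The linear isometry of Euclidean spaces given by a matrix with orthonormal columns. -/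
def isometryOfMatrix (F : Matrix ι κ ℝ) (hF : Fᵀ * F = 1) :
    EuclideanSpace ℝ κ →ₗᵢ[ℝ] EuclideanSpace ℝ ι where
  toLinearMap := toEuclideanLin F
  norm_map' x := by
    rw [← sq_eq_sq₀ (norm_nonneg _) (norm_nonneg _), ← real_inner_self_eq_norm_sq,
      ← real_inner_self_eq_norm_sq, EuclideanSpace.inner_eq_star_dotProduct,
      EuclideanSpace.inner_eq_star_dotProduct]
    simp only [ofLp_toLpLin, toLin'_apply, star_trivial]
    rw [dotProduct_mulVec, ← mulVec_transpose, mulVec_mulVec, hF, one_mulVec]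

theorem starProjection_range_toEuclideanLin {F : Matrix ι κ ℝ} (hF : Fᵀ * F = 1) :
    toEuclideanLin.symm ((toEuclideanLin F).range.starProjection : _ →ₗ[ℝ] _) = F * Fᵀ := by
  rw [LinearEquiv.symm_apply_eq]
  ext1 x
  refine Submodule.eq_starProjection_of_mem_orthogonal ?_ ?_
  · rw [toLpLin_mul_same]
    exact ⟨_, rfl⟩
  · rw [Submodule.mem_orthogonal]
    rintro _ ⟨y, rfl⟩
    rw [inner_sub_right, sub_eq_zero, EuclideanSpace.inner_eq_star_dotProduct,
      EuclideanSpace.inner_eq_star_dotProduct]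
    simp only [ofLp_toLpLin, toLin'_apply, star_trivial]
    rw [dotProduct_mulVec, dotProduct_mulVec, ← mulVec_transpose, ← mulVec_transpose,
      mulVec_mulVec, ← Matrix.mul_assoc, hF, Matrix.one_mul]

theorem exists_orthogonalGroup_toEuclideanLin_eq
    (L : EuclideanSpace ℝ ι →ₗᵢ[ℝ] EuclideanSpace ℝ ι) :
    ∃ W : orthogonalGroup ι ℝ, toEuclideanLin W.1 = L.toLinearMap := by
  refine ⟨⟨toEuclideanLin.symm L.toLinearMap, ?_⟩, by simp⟩
  rw [mem_orthogonalGroup_iff', ← conjTranspose_eq_transpose_of_trivial]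
  apply toEuclideanLin.injective
  rw [toLpLin_mul_same, toEuclideanLin_conjTranspose_eq_adjoint, LinearEquiv.apply_symm_apply,
    toLpLin_one]
  refine LinearMap.ext fun x => ext_inner_left ℝ fun y => ?_
  simp

theorem toEuclideanLin_orthogonal_injective (U : orthogonalGroup ι ℝ) :
    Function.Injective (toEuclideanLin U.1) :=
  (isometryOfMatrix U.1 (orthogonalGroup_transpose_mul_self U)).injective

theorem toEuclideanLin_injective_of_isUnit_det {M : Matrix ι ι ℝ} (hM : IsUnit M.det) :
    Function.Injective (toEuclideanLin M) := fun _ _ hxy =>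
  WithLp.ofLp_injective 2 (mulVec_injective_of_isUnit ((isUnit_iff_isUnit_det M).2 hM)
    (congrArg WithLp.ofLp hxy))

section Grass

variable {n k : ℕ}

theorem continuous_grass_iff {X : Type*} [TopologicalSpace X] {f : X → Grass n k} :
    Continuous f ↔ Continuous fun x => projMatrix (f x) :=
  continuous_induced_rng

theorem continuous_projMatrix :
    Continuous (projMatrix : Grass n k → Matrix (Fin n) (Fin n) ℝ) :=
  continuous_grass_iff.1 continuous_id

/-- The action of the orthogonal group on planes. -/
def rotGrass (U : orthogonalGroup (Fin n) ℝ) (g : Grass n k) : Grass n k where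
  space := g.space.map (toEuclideanLin U.1)
  finrank_eq := by
    rw [(Submodule.equivMapOfInjective _ (toEuclideanLin_orthogonal_injective U)
      g.space).symm.finrank_eq, g.finrank_eq]

theorem projMatrix_rotGrass (U : orthogonalGroup (Fin n) ℝ) (g : Grass n k) :
    projMatrix (rotGrass U g) = U.1 * projMatrix g * U.1ᵀ := by
  have hcomm : projMatrix (rotGrass U g) * U.1 = U.1 * projMatrix g := by
    apply toEuclideanLin.injective
    rw [toLpLin_mul_same, toLpLin_mul_same, projMatrix, projMatrix,
      LinearEquiv.apply_symm_apply, LinearEquiv.apply_symm_apply]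
    ext1 x
    exact ((isometryOfMatrix U.1 (orthogonalGroup_transpose_mul_self U)).map_starProjection'
      g.space x).symm
  rw [← hcomm, Matrix.mul_assoc, orthogonalGroup_mul_transpose_self, Matrix.mul_one]

theorem continuous_rotGrass :
    Continuous fun p : orthogonalGroup (Fin n) ℝ × Grass n k => rotGrass p.1 p.2 := by
  rw [continuous_grass_iff]
  simp_rw [projMatrix_rotGrass]
  have hfst : Continuous fun p : orthogonalGroup (Fin n) ℝ × Grass n k => p.1.1 :=
    continuous_subtype_val.comp continuous_fst
  exact (hfst.matrix_mul (continuous_projMatrix.comp continuous_snd)).matrix_mul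
    hfst.matrix_transpose

theorem absDetOn_nonneg (A : Matrix (Fin n) (Fin n) ℝ) (g : Grass n k) :
    0 ≤ absDetOn A g :=
  LinearMap.normDet_nonneg _

theorem absDetOn_orthogonal_mul (A : Matrix (Fin n) (Fin n) ℝ)
    (U : orthogonalGroup (Fin n) ℝ) (g : Grass n k) :
    absDetOn (U.1 * A) g = absDetOn A g := by
  let f := (toEuclideanLin A).comp g.space.subtype
  let L := isometryOfMatrix U.1 (orthogonalGroup_transpose_mul_self U)
  calc absDetOn (U.1 * A) g = (L.toLinearMap ∘ₗ f).normDet := by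
        rw [absDetOn, toLpLin_mul_same]
        rfl
    _ = (L.comp f.range.subtypeₗᵢ).toLinearMap.normDet * f.normDet := f.normDet_comp L.toLinearMap
    _ = absDetOn A g := by
        rw [LinearIsometry.normDet_eq_one, one_mul]
        rfl

theorem mem_fixedPlanes_iff_map_le {M : Matrix (Fin n) (Fin n) ℝ} (hM : IsUnit M.det)
    {g : Grass n k} :
    g ∈ fixedPlanes k M ↔ g.space.map (toEuclideanLin M) ≤ g.space :=
  ⟨fun h => le_of_eq h, fun h => Submodule.eq_of_le_of_finrank_eq h
    (Submodule.equivMapOfInjective _ (toEuclideanLin_injective_of_isUnit_det hM) _).symm.finrank_eq⟩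

end Grass

variable {k m : ℕ}

/-- The matrix of the inclusion of the first `k` coordinates. -/
def inclMat (k m : ℕ) : Matrix (Fin (k + m)) (Fin k) ℝ :=
  (1 : Matrix (Fin (k + m)) (Fin (k + m)) ℝ).submatrix id (Fin.castAdd m)

theorem mul_inclMat {ι : Type*} (M : Matrix ι (Fin (k + m)) ℝ) :
    M * inclMat k m = M.submatrix id (Fin.castAdd m) := by
  ext i j
  simp [inclMat, mul_apply, one_apply]

theorem inclMat_transpose_mul_self : (inclMat k m)ᵀ * inclMat k m = 1 := by
  rw [mul_inclMat]
  ext i j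
  simp [inclMat, one_apply]

theorem inclMat_castAdd (i j : Fin k) :
    inclMat k m (Fin.castAdd m i) j = (1 : Matrix (Fin k) (Fin k) ℝ) i j := by
  simp [inclMat, one_apply]

theorem inclMat_natAdd (i : Fin m) (j : Fin k) : inclMat k m (Fin.natAdd k i) j = 0 := by
  simp only [inclMat, submatrix_apply, id, one_apply, Fin.ext_iff]
  rw [if_neg]
  simp only [Fin.val_natAdd, Fin.val_castAdd]
  omega

theorem inclMat_mul_transpose : inclMat k m * (inclMat k m)ᵀ = finBlocks 1 0 0 0 := by
  ext i j
  induction i using Fin.addCases with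
  | left i =>
    induction j using Fin.addCases with
    | left j => simp [mul_apply, finBlocks, inclMat_castAdd, one_apply]
    | right j => simp [mul_apply, finBlocks, inclMat_castAdd, inclMat_natAdd]
  | right i =>
    induction j using Fin.addCases with
    | left j => simp [mul_apply, finBlocks, inclMat_castAdd, inclMat_natAdd]
    | right j => simp [mul_apply, finBlocks, inclMat_natAdd]

theorem frame_transpose_mul_self (W : orthogonalGroup (Fin (k + m)) ℝ) :
    (W.1 * inclMat k m)ᵀ * (W.1 * inclMat k m) = 1 := by
  rw [transpose_mul, Matrix.mul_assoc, ← Matrix.mul_assoc _ᵀ W.1,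
    orthogonalGroup_transpose_mul_self, Matrix.one_mul, inclMat_transpose_mul_self]

/-- The `k`-plane spanned by the first `k` columns of `W`. -/
def planeOf (W : orthogonalGroup (Fin (k + m)) ℝ) : Grass (k + m) k where
  space := (toEuclideanLin (W.1 * inclMat k m)).range
  finrank_eq := by
    have h := LinearMap.finrank_range_of_inj (f := toEuclideanLin (W.1 * inclMat k m))
      (isometryOfMatrix _ (frame_transpose_mul_self W)).injective
    rw [h]
    simp

theorem projMatrix_planeOf (W : orthogonalGroup (Fin (k + m)) ℝ) :
    projMatrix (planeOf W) = W.1 * finBlocks 1 0 0 0 * W.1ᵀ := by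
  rw [projMatrix, planeOf, starProjection_range_toEuclideanLin (frame_transpose_mul_self W),
    transpose_mul, ← inclMat_mul_transpose]
  simp only [Matrix.mul_assoc]

theorem mem_planeOf_iff (W : orthogonalGroup (Fin (k + m)) ℝ)
    (x : EuclideanSpace ℝ (Fin (k + m))) :
    x ∈ (planeOf W).space ↔ ∀ i, (W.1ᵀ *ᵥ x.ofLp) (Fin.natAdd k i) = 0 := by
  constructor
  · rintro ⟨y, rfl⟩ i
    simp only [ofLp_toLpLin, toLin'_apply]
    rw [mulVec_mulVec, ← Matrix.mul_assoc, orthogonalGroup_transpose_mul_self, Matrix.one_mul]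
    simp [mulVec, dotProduct, inclMat_natAdd]
  · intro h
    refine ⟨WithLp.toLp 2 fun j => (W.1ᵀ *ᵥ x.ofLp) (Fin.castAdd m j), ?_⟩
    have hincl : inclMat k m *ᵥ (fun j => (W.1ᵀ *ᵥ x.ofLp) (Fin.castAdd m j)) =
        W.1ᵀ *ᵥ x.ofLp := by
      ext i
      induction i using Fin.addCases with
      | left i =>
        simp [mulVec, dotProduct, inclMat_castAdd, one_apply]
      | right i =>
        rw [h i]
        simp [mulVec, dotProduct, inclMat_natAdd]
    rw [toLpLin_toLp, toLin'_apply, ← mulVec_mulVec, hincl, mulVec_mulVec,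
      orthogonalGroup_mul_transpose_self, one_mulVec]

theorem rotGrass_planeOf (U W : orthogonalGroup (Fin (k + m)) ℝ) :
    rotGrass U (planeOf W) = planeOf (U * W) := by
  refine Grass.ext ?_
  simp only [rotGrass, planeOf]
  rw [← LinearMap.range_comp, ← toLpLin_mul_same, ← Matrix.mul_assoc]
  rfl

theorem exists_rotGrass_eq {n : ℕ} (g₀ g : Grass n k) :
    ∃ W : orthogonalGroup (Fin n) ℝ, rotGrass W g₀ = g := by
  let b₀ := (stdOrthonormalBasis ℝ g₀.space).reindex (finCongr g₀.finrank_eq)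
  let b := (stdOrthonormalBasis ℝ g.space).reindex (finCongr g.finrank_eq)
  let e := b₀.equiv b (Equiv.refl _)
  let L := g.space.subtypeₗᵢ.comp e.toLinearIsometry
  obtain ⟨W, hW⟩ := exists_orthogonalGroup_toEuclideanLin_eq L.extend
  refine ⟨W, Grass.ext ?_⟩
  change g₀.space.map (toEuclideanLin W.1) = g.space
  rw [hW]
  ext x
  constructor
  · rintro ⟨y, hy, rfl⟩
    have hLy : L.extend y = L ⟨y, hy⟩ := L.extend_apply ⟨y, hy⟩
    change L.extend y ∈ _
    rw [hLy]
    exact (e ⟨y, hy⟩).2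
  · intro hx
    refine ⟨e.symm ⟨x, hx⟩, (e.symm ⟨x, hx⟩).2, ?_⟩
    change L.extend _ = x
    rw [L.extend_apply]
    simp [L]

theorem planeOf_surjective :
    Function.Surjective (planeOf : orthogonalGroup (Fin (k + m)) ℝ → Grass (k + m) k) := by
  intro g
  obtain ⟨W, hW⟩ := exists_rotGrass_eq (planeOf 1) g
  exact ⟨W, by rw [← hW, rotGrass_planeOf, mul_one]⟩

theorem continuous_planeOf :
    Continuous (planeOf : orthogonalGroup (Fin (k + m)) ℝ → Grass (k + m) k) := by
  rw [continuous_grass_iff]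
  simp_rw [projMatrix_planeOf]
  exact (continuous_subtype_val.matrix_mul continuous_const).matrix_mul
    continuous_subtype_val.matrix_transpose

instance grass_compactSpace : CompactSpace (Grass (k + m) k) :=
  planeOf_surjective.compactSpace continuous_planeOf

theorem isQuotientMap_planeOf : Topology.IsQuotientMap
    (planeOf : orthogonalGroup (Fin (k + m)) ℝ → Grass (k + m) k) :=
  continuous_planeOf.isClosedMap.isQuotientMap continuous_planeOf planeOf_surjective

theorem absDetOn_planeOf (A : Matrix (Fin (k + m)) (Fin (k + m)) ℝ)
    (W : orthogonalGroup (Fin (k + m)) ℝ) :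
    absDetOn A (planeOf W) =
      √((A * (W.1 * inclMat k m))ᵀ * (A * (W.1 * inclMat k m))).det := by
  let T : EuclideanSpace ℝ (Fin k) ≃ₗᵢ[ℝ] (planeOf W).space :=
    (isometryOfMatrix _ (frame_transpose_mul_self W)).equivRange
  have hcomp : toEuclideanLin (A * (W.1 * inclMat k m)) =
      ((toEuclideanLin A).comp (planeOf W).space.subtype) ∘ₗ T.toLinearIsometry.toLinearMap := by
    rw [toLpLin_mul_same]
    rfl
  have hnormDet : absDetOn A (planeOf W) = (toEuclideanLin (A * (W.1 * inclMat k m))).normDet := by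
    rw [hcomp, LinearMap.normDet_comp_of_finrank_eq _ _ T.toLinearEquiv.finrank_eq,
      LinearIsometry.normDet_eq_one, mul_one]
    rfl
  have hsq := LinearMap.normDet_sq (toEuclideanLin (A * (W.1 * inclMat k m)))
  rw [← toEuclideanLin_conjTranspose_eq_adjoint, ← toLpLin_mul_same, LinearMap.det_toLpLin,
    conjTranspose_eq_transpose_of_trivial, ← hnormDet] at hsq
  rw [← hsq]
  exact (Real.sqrt_sq (absDetOn_nonneg _ _)).symm

theorem continuous_absDetOn (A : Matrix (Fin (k + m)) (Fin (k + m)) ℝ) :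
    Continuous fun g : Grass (k + m) k => absDetOn A g := by
  rw [isQuotientMap_planeOf.continuous_iff]
  simp only [Function.comp_def, absDetOn_planeOf]
  have hrestr : Continuous fun W : orthogonalGroup (Fin (k + m)) ℝ => A * (W.1 * inclMat k m) :=
    continuous_const.matrix_mul (continuous_subtype_val.matrix_mul continuous_const)
  exact (hrestr.matrix_transpose.matrix_mul hrestr).matrix_det.sqrt

theorem map_planeOf_le_iff (M : Matrix (Fin (k + m)) (Fin (k + m)) ℝ)
    (W : orthogonalGroup (Fin (k + m)) ℝ) :
    (planeOf W).space.map (toEuclideanLin M) ≤ (planeOf W).space ↔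
      llBlock (W.1ᵀ * M * W.1) = 0 := by
  have hcoord (y : EuclideanSpace ℝ (Fin k)) : W.1ᵀ *ᵥ
      (toEuclideanLin M (toEuclideanLin (W.1 * inclMat k m) y)).ofLp =
      (W.1ᵀ * M * W.1).submatrix id (Fin.castAdd m) *ᵥ y.ofLp := by
    simp only [ofLp_toLpLin, toLin'_apply, mulVec_mulVec, ← mul_inclMat, Matrix.mul_assoc]
  have hblock : llBlock (W.1ᵀ * M * W.1) = 0 ↔ ∀ (i : Fin m) (j : Fin k),
      (W.1ᵀ * M * W.1) (Fin.natAdd k i) (Fin.castAdd m j) = 0 := by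
    rw [← Matrix.ext_iff]
    rfl
  rw [hblock, Submodule.map_le_iff_le_comap]
  constructor
  · intro h i j
    have hmem := h (show toEuclideanLin (W.1 * inclMat k m) (EuclideanSpace.single j 1) ∈
      (planeOf W).space from ⟨_, rfl⟩)
    rw [Submodule.mem_comap, mem_planeOf_iff] at hmem
    have hi := hmem i
    rw [hcoord] at hi
    simpa [mulVec, dotProduct] using hi
  · rintro h _ ⟨y, rfl⟩
    rw [Submodule.mem_comap, mem_planeOf_iff]
    intro i
    rw [hcoord]
    simp [mulVec, dotProduct, h]

theorem planeOf_mem_fixedPlanes_iff {M : Matrix (Fin (k + m)) (Fin (k + m)) ℝ}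
    (hM : IsUnit M.det) (W : orthogonalGroup (Fin (k + m)) ℝ) :
    planeOf W ∈ fixedPlanes k M ↔ llBlock (W.1ᵀ * M * W.1) = 0 :=
  (mem_fixedPlanes_iff_map_le hM).trans (map_planeOf_le_iff M W)

end Planes

section GoodFrames

open Matrix Polynomial

section Polynomial

theorem semiconjBy_aeval {R A : Type*} [CommSemiring R] [Semiring A] [Algebra R A] {w x y : A}
    (h : SemiconjBy w x y) (p : R[X]) : SemiconjBy w (aeval x p) (aeval y p) := by
  induction p using Polynomial.induction_on' with
  | add p q hp hq => simpa only [map_add] using hp.add_right hq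
  | monomial i r =>
    simp only [aeval_monomial]
    exact SemiconjBy.mul_right (Algebra.commutes r w).symm (h.pow_right i)

theorem finite_and_ncard_monic_dvd_le {K : Type*} [Field K] {p : K[X]} (hp : p ≠ 0) (k : ℕ) :
    {q : K[X] | q.Monic ∧ q.natDegree = k ∧ q ∣ p}.Finite ∧
      {q : K[X] | q.Monic ∧ q.natDegree = k ∧ q ∣ p}.ncard ≤ p.natDegree.choose k := by
  classical
  let f := algebraMap K (AlgebraicClosure K)
  let r : K[X] → Multiset (AlgebraicClosure K) := fun q => (q.map f).roots
  let T := ((r p).powersetCard k).toFinset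
  have hmaps : ∀ q ∈ {q : K[X] | q.Monic ∧ q.natDegree = k ∧ q ∣ p}, r q ∈ (T : Set _) := by
    rintro q ⟨-, hdeg, hdvd⟩
    rw [Finset.mem_coe, Multiset.mem_toFinset, Multiset.mem_powersetCard]
    exact ⟨roots.le_of_dvd (map_ne_zero hp) (Polynomial.map_dvd f hdvd),
      by rw [← (IsAlgClosed.splits _).natDegree_eq_card_roots, natDegree_map, hdeg]⟩
  have hinj : Set.InjOn r {q : K[X] | q.Monic ∧ q.natDegree = k ∧ q ∣ p} := by
    intro q hq q' hq' hr
    apply Polynomial.map_injective f f.injective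
    rw [(IsAlgClosed.splits (q.map f)).eq_prod_roots_of_monic (hq.1.map f),
      (IsAlgClosed.splits (q'.map f)).eq_prod_roots_of_monic (hq'.1.map f)]
    exact congrArg (fun s => (Multiset.map _ s).prod) hr
  refine ⟨Set.Finite.of_injOn hmaps hinj T.finite_toSet, ?_⟩
  calc _ ≤ (T : Set _).ncard := Set.ncard_le_ncard_of_injOn r hmaps hinj T.finite_toSet
    _ ≤ ((r p).powersetCard k).card := by
        rw [Set.ncard_coe_finset]
        exact Multiset.toFinset_card_le _
    _ = p.natDegree.choose k := by
        rw [Multiset.card_powersetCard, ← (IsAlgClosed.splits _).natDegree_eq_card_roots,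
          natDegree_map]

end Polynomial

variable {k m : ℕ}

/-- The span of the first `k` columns of `W` is invariant under `M` and is a nondegenerate fixed
point of the action of `M` on planes.  In the chart of the Grassmannian at that plane the
fixed-point equation linearizes to the Sylvester operator `X ↦ X a - d X` of the diagonal blocks,
whence the determinant. -/
def IsGoodFrame (M : Matrix (Fin (k + m)) (Fin (k + m)) ℝ)
    (W : orthogonalGroup (Fin (k + m)) ℝ) : Prop :=
  llBlock (W.1ᵀ * M * W.1) = 0 ∧
    (sylvesterOperator (ulBlock (W.1ᵀ * M * W.1)) (lrBlock (W.1ᵀ * M * W.1))).det ≠ 0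

/-- The nondegenerate fixed `k`-planes of `M`; only these can be counted. -/
def goodPlanes (M : Matrix (Fin (k + m)) (Fin (k + m)) ℝ) : Set (Grass (k + m) k) :=
  {g | ∃ W, planeOf W = g ∧ IsGoodFrame M W}

section IsGoodFrame

variable {M : Matrix (Fin (k + m)) (Fin (k + m)) ℝ} {W : orthogonalGroup (Fin (k + m)) ℝ}

theorem IsGoodFrame.eq_finBlocks (h : IsGoodFrame M W) :
    W.1ᵀ * M * W.1 = finBlocks (ulBlock (W.1ᵀ * M * W.1)) (urBlock (W.1ᵀ * M * W.1)) 0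
      (lrBlock (W.1ᵀ * M * W.1)) := by
  conv_lhs => rw [← finBlocks_blocks (W.1ᵀ * M * W.1), h.1]

theorem IsGoodFrame.mem_planeOf_iff (h : IsGoodFrame M W) (x : EuclideanSpace ℝ (Fin (k + m))) :
    x ∈ (planeOf W).space ↔ aeval M (ulBlock (W.1ᵀ * M * W.1)).charpoly *ᵥ x.ofLp = 0 := by
  have heq := h.eq_finBlocks
  have hdet := h.2
  have hsemi : SemiconjBy W.1 (W.1ᵀ * M * W.1) M := by
    rw [SemiconjBy, ← Matrix.mul_assoc, ← Matrix.mul_assoc, orthogonalGroup_mul_transpose_self,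
      Matrix.one_mul]
  generalize W.1ᵀ * M * W.1 = N at heq hdet hsemi ⊢
  set p := (ulBlock N).charpoly
  obtain ⟨b', hb'⟩ := exists_aeval_finBlocks_zero (ulBlock N) (urBlock N) (lrBlock N) p
  rw [← heq, aeval_self_charpoly] at hb'
  have haeval : aeval M p *ᵥ x.ofLp = W.1 *ᵥ (aeval N p *ᵥ (W.1ᵀ *ᵥ x.ofLp)) := by
    rw [mulVec_mulVec, mulVec_mulVec, (semiconjBy_aeval hsemi p).eq,
      Matrix.mul_assoc, orthogonalGroup_mul_transpose_self, Matrix.mul_one]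
  rw [_root_.mem_planeOf_iff,
    ← finBlocks_zero_mulVec_eq_zero_iff b' _ (isUnit_det_aeval_charpoly hdet),
    ← hb', haeval]
  refine ⟨fun h0 => by rw [h0, mulVec_zero], fun h0 => ?_⟩
  have hcancel := congrArg (W.1ᵀ *ᵥ ·) h0
  simpa only [mulVec_mulVec, ← Matrix.mul_assoc, orthogonalGroup_transpose_mul_self,
    Matrix.one_mul, mulVec_zero] using hcancel

theorem IsGoodFrame.charpoly_dvd (h : IsGoodFrame M W) :
    (ulBlock (W.1ᵀ * M * W.1)).charpoly ∣ M.charpoly := by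
  have hconj : M.charpoly = (W.1ᵀ * M * W.1).charpoly := by
    rw [Matrix.mul_assoc, charpoly_mul_comm, Matrix.mul_assoc,
      orthogonalGroup_mul_transpose_self, Matrix.mul_one]
  rw [hconj, h.eq_finBlocks, charpoly_finBlocks_zero, ulBlock_finBlocks]
  exact dvd_mul_right _ _

end IsGoodFrame

-- A good plane is the kernel of `q(M)`, where `q`, the characteristic polynomial of `M` on the
-- plane, is one of the at most `(k + m).choose k` monic factors of degree `k` of that of `M`.
theorem goodPlanes_finite_and_ncard_le (M : Matrix (Fin (k + m)) (Fin (k + m)) ℝ) :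
    (goodPlanes M : Set (Grass (k + m) k)).Finite ∧
      (goodPlanes M : Set (Grass (k + m) k)).ncard ≤ (k + m).choose k := by
  choose! W hplane hgood using fun (g : Grass (k + m) k) (hg : g ∈ goodPlanes M) => hg
  let q : Grass (k + m) k → ℝ[X] := fun g => (ulBlock ((W g).1ᵀ * M * (W g).1)).charpoly
  obtain ⟨hfin, hcard⟩ := finite_and_ncard_monic_dvd_le (charpoly_monic M).ne_zero k
  rw [charpoly_natDegree_eq_dim, Fintype.card_fin] at hcard
  have hmaps : ∀ g ∈ goodPlanes M,
      q g ∈ {q : ℝ[X] | q.Monic ∧ q.natDegree = k ∧ q ∣ M.charpoly} := fun g hg =>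
    ⟨charpoly_monic _, by simp [q], (hgood g hg).charpoly_dvd⟩
  have hinj : Set.InjOn q (goodPlanes M) := by
    intro g hg g' hg' hq
    refine Grass.ext (Submodule.ext fun x => ?_)
    rw [← hplane g hg, ← hplane g' hg', (hgood g hg).mem_planeOf_iff,
      (hgood g' hg').mem_planeOf_iff]
    change aeval M (q g) *ᵥ _ = 0 ↔ aeval M (q g') *ᵥ _ = 0
    rw [hq]
  exact ⟨hfin.of_injOn hmaps hinj, (Set.ncard_le_ncard_of_injOn q hmaps hinj hfin).trans hcard⟩

theorem goodPlanes_subset_fixedPlanes {M : Matrix (Fin (k + m)) (Fin (k + m)) ℝ}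
    (hM : IsUnit M.det) : (goodPlanes M : Set (Grass (k + m) k)) ⊆ fixedPlanes k M := by
  rintro _ ⟨W, rfl, hW⟩
  exact (planeOf_mem_fixedPlanes_iff hM W).2 hW.1

theorem isGoodFrame_mul_iff (M : Matrix (Fin (k + m)) (Fin (k + m)) ℝ)
    (V W : orthogonalGroup (Fin (k + m)) ℝ) :
    IsGoodFrame M (V * W) ↔ IsGoodFrame (V.1ᵀ * M * V.1) W := by
  have hconj : (V * W).1ᵀ * M * (V * W).1 = W.1ᵀ * (V.1ᵀ * M * V.1) * W.1 := by
    rw [Submonoid.coe_mul, transpose_mul]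
    simp only [Matrix.mul_assoc]
  rw [IsGoodFrame, hconj, IsGoodFrame]

/-- The embedding of `O_k × O_m` in `O_(k+m)` as block diagonal matrices, the stabilizer of the
coordinate `k`-plane. -/
def blockOrthogonal (h : orthogonalGroup (Fin k) ℝ × orthogonalGroup (Fin m) ℝ) :
    orthogonalGroup (Fin (k + m)) ℝ :=
  ⟨finBlocks h.1.1 0 0 h.2.1, by
    rw [mem_orthogonalGroup_iff, finBlocks_transpose, finBlocks_mul]
    simp only [transpose_zero, Matrix.mul_zero, Matrix.zero_mul, add_zero, zero_add,
      orthogonalGroup_mul_transpose_self, finBlocks_one]⟩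

theorem blockOrthogonal_mul (h h' : orthogonalGroup (Fin k) ℝ × orthogonalGroup (Fin m) ℝ) :
    blockOrthogonal (h * h') = blockOrthogonal h * blockOrthogonal h' := by
  apply Subtype.ext
  change finBlocks _ _ _ _ = finBlocks _ _ _ _ * finBlocks _ _ _ _
  rw [finBlocks_mul]
  simp

theorem continuous_blockOrthogonal : Continuous
    (blockOrthogonal : orthogonalGroup (Fin k) ℝ × orthogonalGroup (Fin m) ℝ →
      orthogonalGroup (Fin (k + m)) ℝ) := by
  refine Continuous.subtype_mk ?_ _
  refine Continuous.matrix_submatrix ?_ _ _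
  exact Continuous.matrix_fromBlocks (continuous_subtype_val.comp continuous_fst) continuous_const
    continuous_const (continuous_subtype_val.comp continuous_snd)

theorem exists_blockOrthogonal_eq {U : orthogonalGroup (Fin (k + m)) ℝ} (hur : urBlock U.1 = 0)
    (hll : llBlock U.1 = 0) : ∃ b, blockOrthogonal b = U := by
  have hUb : U.1 = finBlocks (ulBlock U.1) 0 0 (lrBlock U.1) := by
    conv_lhs => rw [← finBlocks_blocks U.1, hll, hur]
  have horth := orthogonalGroup_mul_transpose_self U
  rw [hUb, finBlocks_transpose, finBlocks_mul, ← finBlocks_one] at horth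
  have hul := congrArg ulBlock horth
  have hlr := congrArg lrBlock horth
  simp only [transpose_zero, Matrix.mul_zero, Matrix.zero_mul, add_zero, zero_add,
    ulBlock_finBlocks,
    lrBlock_finBlocks] at hul hlr
  exact ⟨(⟨_, (mem_orthogonalGroup_iff _ _).2 hul⟩, ⟨_, (mem_orthogonalGroup_iff _ _).2 hlr⟩),
    Subtype.ext hUb.symm⟩

theorem exists_eq_mul_blockOrthogonal {W W' : orthogonalGroup (Fin (k + m)) ℝ}
    (h : planeOf W = planeOf W') :
    ∃ b, W' = W * blockOrthogonal b := by
  have hP := congrArg (fun g => W.1ᵀ * projMatrix g * W'.1) h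
  set U := W⁻¹ * W' with hU
  have hcomm : finBlocks (1 : Matrix (Fin k) (Fin k) ℝ) 0 0 (0 : Matrix (Fin m) (Fin m) ℝ) * U.1 =
      U.1 * finBlocks 1 0 0 0 := by
    simp only [projMatrix_planeOf, Matrix.mul_assoc, orthogonalGroup_transpose_mul_self,
      Matrix.mul_one] at hP
    simp only [← Matrix.mul_assoc, orthogonalGroup_transpose_mul_self, Matrix.one_mul] at hP
    rw [Matrix.mul_assoc] at hP
    exact hP
  rw [← finBlocks_blocks U.1, finBlocks_mul, finBlocks_mul] at hcomm
  have hur : urBlock U.1 = 0 := by simpa using congrArg urBlock hcomm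
  have hll : llBlock U.1 = 0 := by simpa using (congrArg llBlock hcomm).symm
  obtain ⟨b, hb⟩ := exists_blockOrthogonal_eq hur hll
  exact ⟨b, by rw [hb, hU, mul_inv_cancel_left]⟩

theorem planeOf_mul_blockOrthogonal (W : orthogonalGroup (Fin (k + m)) ℝ)
    (b : orthogonalGroup (Fin k) ℝ × orthogonalGroup (Fin m) ℝ) :
    planeOf (W * blockOrthogonal b) = planeOf W := by
  apply projMatrix_injective
  rw [projMatrix_planeOf, projMatrix_planeOf, Submonoid.coe_mul, transpose_mul]
  have hstab : (blockOrthogonal b).1 * finBlocks 1 0 0 0 * (blockOrthogonal b).1ᵀ =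
      finBlocks 1 0 0 0 := by
    change finBlocks _ _ _ _ * finBlocks _ _ _ _ * (finBlocks _ _ _ _)ᵀ = _
    rw [finBlocks_transpose, finBlocks_mul, finBlocks_mul]
    simp [orthogonalGroup_mul_transpose_self]
  rw [show W.1 * (blockOrthogonal b).1 * finBlocks 1 0 0 0 * ((blockOrthogonal b).1ᵀ * W.1ᵀ) =
    W.1 * ((blockOrthogonal b).1 * finBlocks 1 0 0 0 * (blockOrthogonal b).1ᵀ) * W.1ᵀ by
      simp only [Matrix.mul_assoc], hstab]

end GoodFrames

section AsymptoticIsometry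

open Metric Filter Topology

/-- A map is an asymptotic isometry at the origin if it distorts distances near the origin by
factors arbitrarily close to one.  Such maps compare Hausdorff measures on a manifold with Lebesgue
measure on a tangent space. -/
def IsAsymptoticIsometry {E X : Type*} [NormedAddCommGroup E] [PseudoMetricSpace X]
    (f : E → X) : Prop :=
  ∀ ε > 0, ∃ r > 0, ∀ x ∈ closedBall (0 : E) r, ∀ y ∈ closedBall (0 : E) r,
    (1 - ε) * dist x y ≤ dist (f x) (f y) ∧ dist (f x) (f y) ≤ (1 + ε) * dist x y

theorem isAsymptoticIsometry_of_hasStrictFDerivAt {E F : Type*} [NormedAddCommGroup E]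
    [NormedSpace ℝ E] [NormedAddCommGroup F] [NormedSpace ℝ F] {f : E → F} {f' : E →L[ℝ] F}
    (hf : HasStrictFDerivAt f f' 0) (hf' : ∀ v, ‖f' v‖ = ‖v‖) : IsAsymptoticIsometry f := by
  intro ε hε
  obtain ⟨r, hr, hball⟩ := Metric.eventually_nhds_iff.1 (hf.isLittleO.def hε)
  refine ⟨r / 2, half_pos hr, fun x hx y hy => ?_⟩
  have happrox : ‖f x - f y - f' (x - y)‖ ≤ ε * ‖x - y‖ := by
    refine @hball (x, y) ?_
    rw [Prod.dist_eq, max_lt_iff]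
    rw [mem_closedBall] at hx hy
    exact ⟨by dsimp; linarith, by dsimp; linarith⟩
  have hnorm := abs_le.1 ((abs_norm_sub_norm_le (f x - f y) (f' (x - y))).trans happrox)
  rw [hf'] at hnorm
  rw [dist_eq_norm, dist_eq_norm]
  constructor <;> linarith

theorem injOn_of_mul_dist_le {Y Z : Type*} [MetricSpace Y] [PseudoMetricSpace Z] {K : ℝ} {g : Y → Z}
    {u : Set Y} (hK : 0 < K)
    (hg : ∀ x ∈ u, ∀ y ∈ u, K * dist x y ≤ dist (g x) (g y)) : Set.InjOn g u := by
  intro x hx y hy hxy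
  have hle := hg x hx y hy
  rw [hxy, dist_self] at hle
  exact dist_le_zero.1 (nonpos_of_mul_nonpos_right hle hK)

section HausdorffMeasure

variable {Y Z : Type*} [MetricSpace Y] [MeasurableSpace Y] [BorelSpace Y] [MetricSpace Z]
  [MeasurableSpace Z] [BorelSpace Z] {d : ℕ} {K : ℝ} {g : Y → Z} {u : Set Y}

theorem euclideanHausdorffMeasure_image_le (hK : 0 ≤ K) (hg : LipschitzOnWith K.toNNReal g u) :
    μHE[d] (g '' u) ≤ ENNReal.ofReal (K ^ d) * μHE[d] u := by
  have hausdorff_le := hg.hausdorffMeasure_image_le (d := d) (Nat.cast_nonneg d)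
  simp only [Measure.euclideanHausdorffMeasure_def, Measure.smul_apply,
    Measure.nnreal_smul_coe_apply]
  rw [ENNReal.rpow_natCast] at hausdorff_le
  rw [ENNReal.ofReal_pow hK, mul_left_comm]
  gcongr
  exact hausdorff_le

theorem euclideanHausdorffMeasure_preimage_image_le {X Z : Type*} [MetricSpace X]
    [MeasurableSpace X] [BorelSpace X] [MetricSpace Z] {f : X → Z} {g : Y → Z} (hf : Isometry f)
    (hK : 0 ≤ K) (hg : LipschitzOnWith K.toNNReal g u) :
    μHE[d] (f ⁻¹' (g '' u)) ≤ ENNReal.ofReal (K ^ d) * μHE[d] u := by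
  borelize Z
  rw [← hf.euclideanHausdorffMeasure_image]
  exact (measure_mono (Set.image_preimage_subset _ _)).trans
    (euclideanHausdorffMeasure_image_le hK hg)

theorem le_euclideanHausdorffMeasure_image (hK : 0 < K)
    (hg : ∀ x ∈ u, ∀ y ∈ u, K * dist x y ≤ dist (g x) (g y)) :
    ENNReal.ofReal (K ^ d) * μHE[d] u ≤ μHE[d] (g '' u) := by
  rcases u.eq_empty_or_nonempty with rfl | ⟨z, -⟩
  · simp
  have : Nonempty Y := ⟨z⟩
  have hinj := injOn_of_mul_dist_le hK hg
  have hlip : LipschitzOnWith (K⁻¹).toNNReal (Function.invFunOn g u) (g '' u) := by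
    refine LipschitzOnWith.of_dist_le_mul ?_
    rintro _ ⟨x, hx, rfl⟩ _ ⟨y, hy, rfl⟩
    rw [hinj.leftInvOn_invFunOn hx, hinj.leftInvOn_invFunOn hy,
      Real.coe_toNNReal _ (by positivity), inv_mul_eq_div, le_div_iff₀ hK, mul_comm]
    exact hg x hx y hy
  have hle := euclideanHausdorffMeasure_image_le (d := d) (by positivity) hlip
  rw [hinj.invFunOn_image subset_rfl] at hle
  calc ENNReal.ofReal (K ^ d) * μHE[d] u
      ≤ ENNReal.ofReal (K ^ d) * (ENNReal.ofReal (K⁻¹ ^ d) * μHE[d] (g '' u)) := by gcongr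
    _ = μHE[d] (g '' u) := by
        rw [← mul_assoc, ← ENNReal.ofReal_mul (by positivity), ← mul_pow,
          mul_inv_cancel₀ hK.ne', one_pow, ENNReal.ofReal_one, one_mul]

end HausdorffMeasure

theorem exists_one_sub_pow_ge_and_one_add_pow_le (d : ℕ) {ε : ℝ} (hε : 0 < ε) :
    ∃ t : ℝ, 0 < t ∧ t < 1 ∧ 1 - ε ≤ (1 - t) ^ d ∧ (1 + t) ^ d ≤ 1 + ε := by
  have hlow : ∀ᶠ t : ℝ in 𝓝 0, 1 - ε < (1 - t) ^ d :=
    continuousAt_const.eventually_lt (by fun_prop) (by simpa using hε)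
  have hup : ∀ᶠ t : ℝ in 𝓝 0, (1 + t) ^ d < 1 + ε :=
    ContinuousAt.eventually_lt (by fun_prop) continuousAt_const (by simpa using hε)
  obtain ⟨t, ⟨⟨hlow, hup⟩, hlt⟩, hpos⟩ :=
    ((((hlow.and hup).and (eventually_lt_nhds one_pos)).filter_mono nhdsWithin_le_nhds).and
      (self_mem_nhdsWithin (s := Set.Ioi (0 : ℝ)))).exists
  exact ⟨t, hpos, hlt, hlow.le, hup.le⟩

theorem IsAsymptoticIsometry.exists_measure_image {E X : Type*} [NormedAddCommGroup E]
    [InnerProductSpace ℝ E] [FiniteDimensional ℝ E] [MeasurableSpace E] [BorelSpace E]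
    [MetricSpace X] [MeasurableSpace X] [BorelSpace X] {f : E → X} (hf : IsAsymptoticIsometry f)
    {d : ℕ} (hd : Module.finrank ℝ E = d) {ε : ℝ} (hε : 0 < ε) :
    ∃ r > 0, Set.InjOn f (closedBall 0 r) ∧ ContinuousOn f (closedBall 0 r) ∧
      ∀ s ⊆ closedBall (0 : E) r,
      ENNReal.ofReal (1 - ε) * volume s ≤ μHE[d] (f '' s) ∧
      μHE[d] (f '' s) ≤ ENNReal.ofReal (1 + ε) * volume s := by
  obtain ⟨t, ht0, ht1, hlow, hup⟩ := exists_one_sub_pow_ge_and_one_add_pow_le d hε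
  obtain ⟨r, hr, hdist⟩ := hf t ht0
  have hlip : LipschitzOnWith (1 + t).toNNReal f (closedBall 0 r) := by
    refine LipschitzOnWith.of_dist_le_mul fun x hx y hy => ?_
    rw [Real.coe_toNNReal _ (by positivity)]
    exact (hdist x hx y hy).2
  have hexpand : ∀ x ∈ closedBall (0 : E) r, ∀ y ∈ closedBall (0 : E) r,
      (1 - t) * dist x y ≤ dist (f x) (f y) := fun x hx y hy => (hdist x hx y hy).1
  have hpos : 0 < 1 - t := sub_pos.2 ht1
  have hvol : (μHE[d] : Measure E) = volume := by
    rw [← hd, InnerProductSpace.euclideanHausdorffMeasure_eq_volume]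
  refine ⟨r, hr, injOn_of_mul_dist_le hpos hexpand, hlip.continuousOn, fun s hs => ?_⟩
  rw [← hvol]
  constructor
  · refine le_trans (by gcongr) (le_euclideanHausdorffMeasure_image hpos
      fun x hx y hy => hexpand x (hs hx) y (hs hy))
  · exact (euclideanHausdorffMeasure_image_le (by positivity) (hlip.mono hs)).trans (by gcongr)

end AsymptoticIsometry

section Cayley

open Metric Filter Topology

/-- The Cayley transform `(1 + Z/2) (1 - Z/2)⁻¹`, which maps skew-symmetric matrices to orthogonal
ones and serves as a chart of the orthogonal group at `1`.  It is scaled to have derivative the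
identity at `0`. -/
def cayley {R : Type*} [Ring R] [Algebra ℝ R] (Z : R) : R :=
  (1 + (1 / 2 : ℝ) • Z) * Ring.inverse (1 - (1 / 2 : ℝ) • Z)

theorem cayley_zero {R : Type*} [Ring R] [Algebra ℝ R] : cayley (0 : R) = 1 := by
  simp [cayley]

section Derivative

variable {R E : Type*} [NormedRing R] [NormedAlgebra ℝ R] [NormedAddCommGroup E] [NormedSpace ℝ E]

theorem hasStrictFDerivAt_cayley [HasSummableGeomSeries R] :
    HasStrictFDerivAt (cayley : R → R) (ContinuousLinearMap.id ℝ R) 0 := by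
  have hhalf : HasStrictFDerivAt (fun Z : R => (1 / 2 : ℝ) • Z)
      ((1 / 2 : ℝ) • ContinuousLinearMap.id ℝ R) 0 :=
    (hasStrictFDerivAt_id (0 : R)).const_smul (1 / 2 : ℝ)
  have hinverse : HasStrictFDerivAt Ring.inverse (-((ContinuousLinearMap.mulLeftRight ℝ R) 1) 1)
      (1 - (1 / 2 : ℝ) • (0 : R)) := by
    simpa using hasStrictFDerivAt_ringInverse (𝕜 := ℝ) (1 : Rˣ)
  refine ((hhalf.const_add 1).mul' (hinverse.comp (0 : R) (hhalf.const_sub 1))).congr_fderiv ?_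
  ext Z
  have hhalves : (2⁻¹ + 2⁻¹ : ℝ) • Z = Z := by
    rw [← two_mul, mul_inv_cancel₀ two_ne_zero, one_smul]
  simpa [← add_smul] using hhalves

variable [FiniteDimensional ℝ E]

theorem hasStrictFDerivAt_cayley_comp [HasSummableGeomSeries R] (ℓ : E →ₗ[ℝ] R) :
    HasStrictFDerivAt (fun x => cayley (ℓ x)) (LinearMap.toContinuousLinearMap ℓ) 0 := by
  have hcayley : HasStrictFDerivAt (cayley : R → R) (ContinuousLinearMap.id ℝ R)
      (LinearMap.toContinuousLinearMap ℓ 0) := by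
    rw [map_zero]; exact hasStrictFDerivAt_cayley
  exact (hcayley.comp (0 : E) (LinearMap.toContinuousLinearMap ℓ).hasStrictFDerivAt).congr_fderiv
    (by ext; simp)

theorem isAsymptoticIsometry_cayley [HasSummableGeomSeries R] (ℓ : E →ₗ[ℝ] R)
    (h : ∀ x, ‖ℓ x‖ = ‖x‖) : IsAsymptoticIsometry fun x => cayley (ℓ x) :=
  isAsymptoticIsometry_of_hasStrictFDerivAt (hasStrictFDerivAt_cayley_comp ℓ) h

theorem isAsymptoticIsometry_cayley_mul_cayley [HasSummableGeomSeries R] (ℓ ℓ' : E →ₗ[ℝ] R)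
    (h : ∀ x, ‖ℓ x + ℓ' x‖ = ‖x‖) :
    IsAsymptoticIsometry fun x => cayley (ℓ x) * cayley (ℓ' x) := by
  refine isAsymptoticIsometry_of_hasStrictFDerivAt
    ((hasStrictFDerivAt_cayley_comp ℓ).mul' (hasStrictFDerivAt_cayley_comp ℓ')) fun v => ?_
  rw [← h v]
  simp [cayley_zero, add_comm]

theorem isAsymptoticIsometry_cayley_conj [HasSummableGeomSeries R] (ℓ : E →ₗ[ℝ] R) (P : R)
    (h : ∀ x, ‖ℓ x * P - P * ℓ x‖ = ‖x‖) :
    IsAsymptoticIsometry fun x => cayley (ℓ x) * P * cayley (-ℓ x) := by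
  refine isAsymptoticIsometry_of_hasStrictFDerivAt
    (((hasStrictFDerivAt_cayley_comp ℓ).mul_const' P).mul'
      (hasStrictFDerivAt_cayley_comp (-ℓ))) fun v => ?_
  rw [← h v]
  simp [cayley_zero, sub_eq_add_neg, add_comm]

end Derivative

theorem exists_solution_of_hasStrictFDerivAt {E F G : Type*} [NormedAddCommGroup E]
    [NormedSpace ℝ E] [CompleteSpace E] [NormedAddCommGroup F] [NormedSpace ℝ F] [CompleteSpace F]
    [NormedAddCommGroup G] [NormedSpace ℝ G] [CompleteSpace G]
    {Φ : E × F → G} {S : E →L[ℝ] F} {T : F ≃L[ℝ] G}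
    (hΦ : HasStrictFDerivAt Φ (((T : F →L[ℝ] G) ∘L S).coprod (-(T : F →L[ℝ] G))) 0)
    (hΦ0 : Φ 0 = 0) {ε : ℝ} (hε : 0 < ε) :
    ∃ r > 0, ∀ y ∈ closedBall (0 : E) r, ∃ x, ‖x - S y‖ ≤ ε * ‖y‖ ∧ Φ (y, x) = 0 := by
  set Φ' := ((T : F →L[ℝ] G) ∘L S).coprod (-(T : F →L[ℝ] G))
  have hinr : Φ' ∘L ContinuousLinearMap.inr ℝ E F =
      ((T.trans (ContinuousLinearEquiv.neg ℝ) : F ≃L[ℝ] G) : F →L[ℝ] G) := by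
    ext v; simp [Φ']
  have hinv : (Φ' ∘L ContinuousLinearMap.inr ℝ E F).IsInvertible := ⟨_, hinr.symm⟩
  have hderiv := hΦ.hasStrictFDerivAt_implicitFunctionOfProdDomain hinv
  have hiff := hΦ.eventually_apply_eq_iff_implicitFunctionOfProdDomain hinv
  set ψ := hΦ.implicitFunctionOfProdDomain hinv
  have hψ0 : ψ 0 = 0 := hiff.self_of_nhds.1 rfl
  have hsol : ∀ᶠ y in 𝓝 (0 : E), Φ (y, ψ y) = 0 := by
    have hlim : Tendsto (fun y => (y, ψ y)) (𝓝 (0 : E)) (𝓝 (0 : E × F)) := by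
      have hcont : ContinuousAt (fun y => (y, ψ y)) 0 :=
        continuousAt_id.prodMk hderiv.continuousAt
      rwa [ContinuousAt, hψ0] at hcont
    filter_upwards [hlim.eventually hiff] with y hy
    rw [hy.2 rfl, hΦ0]
  have hψ' : -(Φ' ∘L ContinuousLinearMap.inr ℝ E F).inverse ∘L
      (Φ' ∘L ContinuousLinearMap.inl ℝ E F) = S := by
    rw [hinr, ContinuousLinearMap.inverse_equiv]
    ext v
    simp [Φ']
  obtain ⟨r, hr, hball⟩ :=
    Metric.eventually_nhds_iff_ball.1 (hsol.and (hderiv.hasFDerivAt.isLittleO.def hε))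
  refine ⟨r / 2, half_pos hr, fun y hy => ⟨ψ y, ?_, ?_⟩⟩
  · have happrox := (hball y (closedBall_subset_ball (half_lt_self hr) hy)).2
    rw [← hψ']
    simpa [hψ0] using happrox
  · exact (hball y (closedBall_subset_ball (half_lt_self hr) hy)).1

variable {R E F : Type*} [NormedRing R] [NormedAlgebra ℝ R] [FiniteDimensional ℝ R]
  [NormedAddCommGroup E] [NormedSpace ℝ E] [FiniteDimensional ℝ E]
  [NormedAddCommGroup F] [NormedSpace ℝ F] [FiniteDimensional ℝ F]

theorem exists_solution_cayley (ℓ ℓ' : E →ₗ[ℝ] R) (π : R →ₗ[ℝ] F) (B : R) (hB : π B = 0)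
    (T : E ≃ₗ[ℝ] F) (hT : ∀ x, T x = π (ℓ x * B - B * ℓ x)) (hT' : ∀ y, T y = π (ℓ' y * B))
    {ε : ℝ} (hε : 0 < ε) :
    ∃ r > 0, ∀ y ∈ closedBall (0 : E) r, ∃ x, ‖x - y‖ ≤ ε * ‖y‖ ∧
      π (cayley (-ℓ x) * cayley (ℓ' y) * B * cayley (ℓ x)) = 0 := by
  have : CompleteSpace E := FiniteDimensional.complete ℝ E
  have : CompleteSpace F := FiniteDimensional.complete ℝ F
  have : CompleteSpace R := FiniteDimensional.complete ℝ R
  have hleft := hasStrictFDerivAt_cayley_comp (-(ℓ ∘ₗ LinearMap.snd ℝ E E))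
  have hmid := hasStrictFDerivAt_cayley_comp (ℓ' ∘ₗ LinearMap.fst ℝ E E)
  have hright := hasStrictFDerivAt_cayley_comp (ℓ ∘ₗ LinearMap.snd ℝ E E)
  have hderiv := (LinearMap.toContinuousLinearMap π).hasStrictFDerivAt.comp (0 : E × E)
    (((hleft.mul' hmid).mul_const' B).mul' hright)
  refine exists_solution_of_hasStrictFDerivAt
    (Φ := fun p : E × E => π (cayley (-ℓ p.2) * cayley (ℓ' p.1) * B * cayley (ℓ p.2)))
    (S := ContinuousLinearMap.id ℝ E) (T := T.toContinuousLinearEquiv)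
    (hderiv.congr_fderiv ?_) (by simp [cayley_zero, hB]) hε
  ext v
  · simp [cayley_zero, hT']
  · simp [cayley_zero, hT, sub_eq_add_neg]

end Cayley

section SkewCayley

open Matrix

theorem transpose_half_smul_of_skew {ι : Type*} {Z : Matrix ι ι ℝ} (hZ : Zᵀ = -Z) :
    ((1 / 2 : ℝ) • Z)ᵀ = -((1 / 2 : ℝ) • Z) := by
  rw [transpose_smul, hZ, smul_neg]

variable {ι : Type*} [Fintype ι] [DecidableEq ι]

theorem isUnit_det_one_add_of_skew {Z : Matrix ι ι ℝ} (hZ : Zᵀ = -Z) : IsUnit (1 + Z).det := by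
  rw [isUnit_iff_ne_zero]
  intro hdet
  obtain ⟨v, hv, hv0⟩ := exists_mulVec_eq_zero_iff.2 hdet
  have hskew : v ⬝ᵥ (Z *ᵥ v) = -(v ⬝ᵥ (Z *ᵥ v)) := by
    conv_lhs => rw [dotProduct_mulVec, ← mulVec_transpose, hZ, neg_mulVec, neg_dotProduct,
      dotProduct_comm]
  have hself := congrArg (v ⬝ᵥ ·) hv0
  simp only [add_mulVec, one_mulVec, dotProduct_add, self_eq_neg.1 hskew, add_zero,
    dotProduct_zero] at hself
  exact hv (dotProduct_self_eq_zero.1 hself)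

theorem isUnit_det_one_sub_half_smul_of_skew {Z : Matrix ι ι ℝ} (hZ : Zᵀ = -Z) :
    IsUnit (1 - (1 / 2 : ℝ) • Z).det := by
  rw [sub_eq_add_neg]
  refine isUnit_det_one_add_of_skew ?_
  rw [transpose_neg, transpose_half_smul_of_skew hZ]

theorem cayley_eq (Z : Matrix ι ι ℝ) :
    cayley Z = (1 + (1 / 2 : ℝ) • Z) * (1 - (1 / 2 : ℝ) • Z)⁻¹ := by
  rw [cayley, nonsing_inv_eq_ringInverse]

theorem commute_nonsing_inv_right {M N : Matrix ι ι ℝ} (h : Commute M N) : Commute M N⁻¹ := by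
  simpa only [Matrix.zpow_neg_one] using Matrix.Commute.zpow_right h (-1)

theorem cayley_neg_mul_cayley {Z : Matrix ι ι ℝ} (hZ : Zᵀ = -Z) : cayley (-Z) * cayley Z = 1 := by
  have hsub := isUnit_det_one_sub_half_smul_of_skew hZ
  have hadd := isUnit_det_one_add_of_skew (transpose_half_smul_of_skew hZ)
  rw [cayley_eq, cayley_eq, smul_neg, sub_neg_eq_add, ← sub_eq_add_neg, Matrix.mul_assoc,
    nonsing_inv_mul_cancel_left _ _ hadd, mul_nonsing_inv _ hsub]

theorem transpose_cayley {Z : Matrix ι ι ℝ} (hZ : Zᵀ = -Z) : (cayley Z)ᵀ = cayley (-Z) := by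
  have hcomm : Commute (1 - (1 / 2 : ℝ) • Z) (1 + (1 / 2 : ℝ) • Z) :=
    ((Commute.one_left _).sub_left ((Commute.one_right _).add_right (Commute.refl _)))
  rw [cayley_eq, cayley_eq, transpose_mul, transpose_nonsing_inv, transpose_add, transpose_sub,
    transpose_half_smul_of_skew hZ, transpose_one, smul_neg, sub_neg_eq_add, ← sub_eq_add_neg,
    (commute_nonsing_inv_right hcomm).eq]

theorem cayley_mem_orthogonalGroup {Z : Matrix ι ι ℝ} (hZ : Zᵀ = -Z) :
    cayley Z ∈ orthogonalGroup ι ℝ := by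
  rw [mem_orthogonalGroup_iff', transpose_cayley hZ, cayley_neg_mul_cayley hZ]

theorem continuous_cayley {X : Type*} [TopologicalSpace X] {Z : X → Matrix ι ι ℝ}
    (hZ : Continuous Z) (hskew : ∀ x, (Z x)ᵀ = -Z x) : Continuous fun x => cayley (Z x) := by
  simp_rw [cayley_eq, inv_def, Ring.inverse_eq_inv']
  have hhalf : Continuous fun x => (1 / 2 : ℝ) • Z x := hZ.const_smul (1 / 2 : ℝ)
  have hsub : Continuous fun x => 1 - (1 / 2 : ℝ) • Z x := continuous_const.sub hhalf
  exact (continuous_const.add hhalf).matrix_mul ((hsub.matrix_det.inv₀ fun x =>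
    (isUnit_det_one_sub_half_smul_of_skew (hskew x)).ne_zero).smul hsub.matrix_adjugate)

/-- The inverse Cayley transform, meaningful when `U + 1` is invertible. -/
def invCayley (U : Matrix ι ι ℝ) : Matrix ι ι ℝ :=
  (2 : ℝ) • ((U - 1) * (U + 1)⁻¹)

theorem invCayley_one : invCayley (1 : Matrix ι ι ℝ) = 0 := by
  simp [invCayley]

theorem det_one_add_one_ne_zero : ((1 : Matrix ι ι ℝ) + 1).det ≠ 0 := by
  rw [← two_smul ℝ (1 : Matrix ι ι ℝ), det_smul]
  simp

theorem continuousAt_invCayley : ContinuousAt (invCayley (ι := ι)) 1 := by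
  have hadd : Continuous fun U : Matrix ι ι ℝ => U + 1 := continuous_id.add continuous_const
  have hinv : ContinuousAt (fun U : Matrix ι ι ℝ => (U + 1)⁻¹) 1 := by
    simp_rw [inv_def, Ring.inverse_eq_inv']
    exact (hadd.matrix_det.continuousAt.inv₀ det_one_add_one_ne_zero).smul
      hadd.matrix_adjugate.continuousAt
  exact ContinuousAt.const_smul ((continuousAt_id.sub continuousAt_const).mul hinv) (2 : ℝ)

theorem cayley_invCayley {U : Matrix ι ι ℝ} (hU : IsUnit (U + 1).det) :
    cayley (invCayley U) = U := by
  have hhalf : (1 / 2 : ℝ) • invCayley U = (U - 1) * (U + 1)⁻¹ := by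
    rw [invCayley, smul_smul, one_div_mul_cancel two_ne_zero, one_smul]
  have hadd : 1 + (U - 1) * (U + 1)⁻¹ = U * ((2 : ℝ) • (U + 1)⁻¹) := by
    calc 1 + (U - 1) * (U + 1)⁻¹ = ((U + 1) + (U - 1)) * (U + 1)⁻¹ := by
          rw [Matrix.add_mul, mul_nonsing_inv _ hU]
      _ = ((2 : ℝ) • U) * (U + 1)⁻¹ := by rw [two_smul]; congr 1; abel
      _ = U * ((2 : ℝ) • (U + 1)⁻¹) := by rw [Matrix.smul_mul, Matrix.mul_smul]
  have hsub : 1 - (U - 1) * (U + 1)⁻¹ = (2 : ℝ) • (U + 1)⁻¹ := by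
    calc 1 - (U - 1) * (U + 1)⁻¹ = ((U + 1) - (U - 1)) * (U + 1)⁻¹ := by
          rw [Matrix.sub_mul (U + 1), mul_nonsing_inv _ hU]
      _ = ((2 : ℝ) • (1 : Matrix ι ι ℝ)) * (U + 1)⁻¹ := by rw [two_smul]; congr 1; abel
      _ = (2 : ℝ) • (U + 1)⁻¹ := by rw [Matrix.smul_mul, Matrix.one_mul]
  have hunit : IsUnit ((2 : ℝ) • (U + 1)⁻¹).det := by
    rw [det_smul]
    exact ((isUnit_iff_ne_zero.2 two_ne_zero).pow _).mul (isUnit_nonsing_inv_det _ hU)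
  rw [cayley_eq, hhalf, hadd, hsub, mul_nonsing_inv_cancel_right _ _ hunit]

theorem transpose_invCayley (U : Matrix ι ι ℝ) : (invCayley U)ᵀ = invCayley Uᵀ := by
  have hcomm : Commute (Uᵀ - 1) (Uᵀ + 1) := by rw [commute_iff_eq]; noncomm_ring
  rw [invCayley, invCayley, transpose_smul, transpose_mul, transpose_nonsing_inv, transpose_add,
    transpose_sub, transpose_one, (commute_nonsing_inv_right hcomm).eq]

theorem invCayley_transpose_of_orthogonal {U : Matrix ι ι ℝ} (hU : U * Uᵀ = 1) :
    invCayley Uᵀ = -invCayley U := by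
  have hU' : Uᵀ * U = 1 := mul_eq_one_comm.1 hU
  have hsub : Uᵀ - 1 = -((U - 1) * Uᵀ) := by
    rw [Matrix.sub_mul, hU, Matrix.one_mul, neg_sub]
  have hadd : Uᵀ + 1 = (U + 1) * Uᵀ := by rw [Matrix.add_mul, hU, Matrix.one_mul, add_comm]
  rw [invCayley, invCayley, hsub, hadd, Matrix.mul_inv_rev, inv_eq_right_inv hU', Matrix.neg_mul,
    smul_neg, Matrix.mul_assoc, ← Matrix.mul_assoc Uᵀ, hU', Matrix.one_mul]

theorem invCayley_conj_of_mul_self {R : Matrix ι ι ℝ} (hR : R * R = 1) (U : Matrix ι ι ℝ) :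
    invCayley (R * U * R) = R * invCayley U * R := by
  have hsub : R * U * R - 1 = R * (U - 1) * R := by
    rw [Matrix.mul_sub, Matrix.sub_mul, Matrix.mul_one, hR]
  have hadd : R * U * R + 1 = R * (U + 1) * R := by
    rw [Matrix.mul_add, Matrix.add_mul, Matrix.mul_one, hR]
  rw [invCayley, invCayley, hsub, hadd, Matrix.mul_inv_rev, Matrix.mul_inv_rev, inv_eq_right_inv hR,
    Matrix.mul_smul, Matrix.smul_mul]
  simp only [Matrix.mul_assoc]
  rw [← Matrix.mul_assoc R R, hR, Matrix.one_mul]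

end SkewCayley

section Charts

open Matrix

attribute [local instance] Matrix.frobeniusNormedAddCommGroup Matrix.frobeniusNormedSpace
  Matrix.frobeniusNormedRing Matrix.frobeniusNormedAlgebra

theorem frobenius_norm_sq {ι κ : Type*} [Fintype ι] [Fintype κ] (M : Matrix ι κ ℝ) :
    ‖M‖ ^ 2 = ∑ i, ∑ j, M i j ^ 2 := by
  rw [frobenius_norm_def, ← Real.rpow_natCast, ← Real.rpow_mul (by positivity)]
  simp

variable {k m n : ℕ}

theorem frobenius_norm_sq_finBlocks (a : Matrix (Fin k) (Fin k) ℝ) (b : Matrix (Fin k) (Fin m) ℝ)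
    (c : Matrix (Fin m) (Fin k) ℝ) (d : Matrix (Fin m) (Fin m) ℝ) :
    ‖finBlocks a b c d‖ ^ 2 = ‖a‖ ^ 2 + ‖b‖ ^ 2 + ‖c‖ ^ 2 + ‖d‖ ^ 2 := by
  simp only [frobenius_norm_sq, Fin.sum_univ_add, finBlocks, submatrix_apply,
    finSumFinEquiv_symm_apply_castAdd, finSumFinEquiv_symm_apply_natAdd, fromBlocks_apply₁₁,
    fromBlocks_apply₁₂, fromBlocks_apply₂₁, fromBlocks_apply₂₂, Finset.sum_add_distrib]
  ring

/-- The pairs of indices `i < j`, which index the entries above the diagonal and hence the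
coordinates on skew-symmetric matrices. -/
abbrev LtPair (n : ℕ) := {p : Fin n × Fin n // p.1 < p.2}

theorem card_ltPair (n : ℕ) : Fintype.card (LtPair n) = n * (n - 1) / 2 := by
  have hcol : ∀ j : Fin n, (∑ i : Fin n, if i < j then 1 else 0) = (j : ℕ) := fun j => by
    rw [← Finset.card_filter, Finset.filter_gt_eq_Iio, Fin.card_Iio]
  rw [Fintype.card_subtype, Finset.card_filter, Fintype.sum_prod_type_right]
  simp only [hcol]
  rw [Fin.sum_univ_eq_sum_range (fun j => j), Finset.sum_range_id]

theorem sum_sum_eq_two_mul_sum_ltPair {R : Type*} [Semiring R] (f : Fin n → Fin n → R)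
    (hdiag : ∀ i, f i i = 0) (hsymm : ∀ i j, f i j = f j i) :
    ∑ i, ∑ j, f i j = 2 * ∑ p : LtPair n, f p.1.1 p.1.2 := by
  have hsplit : ∀ i j, f i j = (if i < j then f i j else 0) + if j < i then f j i else 0 := by
    intro i j
    rcases lt_trichotomy i j with h | rfl | h
    · simp [h, h.not_gt]
    · simp [hdiag]
    · simp [h, h.not_gt, hsymm i j]
  have hupper : ∑ i, ∑ j, (if i < j then f i j else 0) = ∑ p : LtPair n, f p.1.1 p.1.2 := by
    rw [← Fintype.sum_prod_type', ← Finset.sum_filter]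
    exact Finset.sum_subtype _ (by simp) (fun p : Fin n × Fin n => f p.1 p.2)
  calc ∑ i, ∑ j, f i j
      = ∑ i, ∑ j, (if i < j then f i j else 0) + ∑ i, ∑ j, (if j < i then f j i else 0) := by
        simp only [← Finset.sum_add_distrib, ← hsplit]
    _ = 2 * ∑ p : LtPair n, f p.1.1 p.1.2 := by
        rw [Finset.sum_comm (f := fun i j => if j < i then f j i else 0), hupper, two_mul]

/-- The skew-symmetric matrix with coordinates `z` above the diagonal, scaled by `1/√2` so as to be
isometric for the Frobenius norm. -/
def skewMat (n : ℕ) : EuclideanSpace ℝ (LtPair n) →ₗ[ℝ] Matrix (Fin n) (Fin n) ℝ where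
  toFun z := of fun i j => if h : i < j then (√2)⁻¹ * z ⟨(i, j), h⟩ else
    if h : j < i then -((√2)⁻¹ * z ⟨(j, i), h⟩) else 0
  map_add' z w := by
    ext i j
    simp only [of_apply, Matrix.add_apply, PiLp.add_apply]
    split_ifs <;> ring
  map_smul' r z := by
    ext i j
    simp only [of_apply, Matrix.smul_apply, PiLp.smul_apply, RingHom.id_apply, smul_eq_mul]
    split_ifs <;> ring

theorem skewMat_apply (z : EuclideanSpace ℝ (LtPair n)) (i j : Fin n) :
    skewMat n z i j = if h : i < j then (√2)⁻¹ * z ⟨(i, j), h⟩ else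
      if h : j < i then -((√2)⁻¹ * z ⟨(j, i), h⟩) else 0 := rfl

theorem transpose_skewMat (z : EuclideanSpace ℝ (LtPair n)) :
    (skewMat n z)ᵀ = -skewMat n z := by
  ext i j
  rw [transpose_apply, Matrix.neg_apply, skewMat_apply, skewMat_apply]
  rcases lt_trichotomy i j with h | h | h
  · simp [h, h.not_gt]
  · simp [h]
  · simp [h, h.not_gt]

theorem norm_skewMat (z : EuclideanSpace ℝ (LtPair n)) : ‖skewMat n z‖ = ‖z‖ := by
  have hskew := fun i j => congrFun (congrFun (transpose_skewMat z) i) j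
  simp only [transpose_apply, Matrix.neg_apply] at hskew
  rw [← sq_eq_sq₀ (norm_nonneg _) (norm_nonneg _), frobenius_norm_sq,
    sum_sum_eq_two_mul_sum_ltPair, EuclideanSpace.real_norm_sq_eq, Finset.mul_sum]
  · refine Finset.sum_congr rfl fun p _ => ?_
    rw [skewMat_apply, dif_pos p.2, mul_pow, inv_pow, Real.sq_sqrt zero_le_two,
      mul_inv_cancel_left₀ two_ne_zero]
  · intro i; simp [skewMat_apply]
  · intro i j
    rw [hskew i j, neg_sq]

theorem exists_skewMat_eq {Z : Matrix (Fin n) (Fin n) ℝ} (hZ : Zᵀ = -Z) :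
    ∃ z, skewMat n z = Z := by
  refine ⟨WithLp.toLp 2 fun p => √2 * Z p.1.1 p.1.2, ?_⟩
  have hskew : ∀ i j, Z j i = -Z i j := fun i j => congrFun (congrFun hZ i) j
  ext i j
  rw [skewMat_apply]
  rcases lt_trichotomy i j with hij | rfl | hij
  · simp [hij]
  · simp [self_eq_neg.1 (hskew i i)]
  · simp [hij, hij.not_gt, hskew i j]

/-- The matrix with entries `y / √2`: half of the squared norm of `y` goes to each of the two
off-diagonal blocks of `offSkew`. -/
def offMat (k m : ℕ) : EuclideanSpace ℝ (Fin k × Fin m) →ₗ[ℝ] Matrix (Fin m) (Fin k) ℝ where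
  toFun y := of fun i j => (√2)⁻¹ * y (j, i)
  map_add' y w := by
    ext i j
    simp only [of_apply, Matrix.add_apply, PiLp.add_apply]
    ring
  map_smul' r y := by
    ext i j
    simp only [of_apply, Matrix.smul_apply, PiLp.smul_apply, RingHom.id_apply, smul_eq_mul]
    ring

theorem offMat_apply (y : EuclideanSpace ℝ (Fin k × Fin m)) (i : Fin m) (j : Fin k) :
    offMat k m y i j = (√2)⁻¹ * y (j, i) := rfl

theorem two_mul_norm_offMat_sq (y : EuclideanSpace ℝ (Fin k × Fin m)) :
    2 * ‖offMat k m y‖ ^ 2 = ‖y‖ ^ 2 := by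
  rw [frobenius_norm_sq, EuclideanSpace.real_norm_sq_eq, Fintype.sum_prod_type, Finset.sum_comm]
  simp only [offMat_apply, mul_pow, inv_pow, ← Finset.mul_sum]
  rw [Real.sq_sqrt zero_le_two, mul_inv_cancel_left₀ two_ne_zero]

/-- The skew-symmetric matrix with zero diagonal blocks and off-diagonal coordinates `y`.  These
matrices form the horizontal tangent space of the fibration of `O_{k+m}` over the Grassmannian. -/
def offSkew (k m : ℕ) :
    EuclideanSpace ℝ (Fin k × Fin m) →ₗ[ℝ] Matrix (Fin (k + m)) (Fin (k + m)) ℝ where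
  toFun y := finBlocks 0 (-(offMat k m y)ᵀ) (offMat k m y) 0
  map_add' y w := by
    rw [map_add, finBlocks_add, transpose_add, neg_add, add_zero, add_zero]
  map_smul' r y := by
    rw [map_smul, transpose_smul, RingHom.id_apply, finBlocks_smul, smul_neg, smul_zero, smul_zero]

theorem offSkew_apply (y : EuclideanSpace ℝ (Fin k × Fin m)) :
    offSkew k m y = finBlocks 0 (-(offMat k m y)ᵀ) (offMat k m y) 0 := rfl

theorem transpose_offSkew (y : EuclideanSpace ℝ (Fin k × Fin m)) :
    (offSkew k m y)ᵀ = -offSkew k m y := by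
  simp [offSkew_apply, finBlocks_transpose, finBlocks_neg]

theorem norm_offSkew (y : EuclideanSpace ℝ (Fin k × Fin m)) : ‖offSkew k m y‖ = ‖y‖ := by
  rw [← sq_eq_sq₀ (norm_nonneg _) (norm_nonneg _), offSkew_apply, frobenius_norm_sq_finBlocks,
    norm_neg,
    frobenius_norm_transpose, norm_zero, norm_zero, ← two_mul_norm_offMat_sq]
  ring

/-- The orthogonal matrix with Cayley coordinates `offSkew y`, a section near the base point of the
projection of `O_{k+m}` to the Grassmannian. -/
def cayleyRot (y : EuclideanSpace ℝ (Fin k × Fin m)) : orthogonalGroup (Fin (k + m)) ℝ :=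
  ⟨cayley (offSkew k m y), cayley_mem_orthogonalGroup (transpose_offSkew y)⟩

theorem cayleyRot_zero : cayleyRot (0 : EuclideanSpace ℝ (Fin k × Fin m)) = 1 :=
  Subtype.ext ((congrArg cayley (map_zero (offSkew k m))).trans cayley_zero)

theorem transpose_cayleyRot (y : EuclideanSpace ℝ (Fin k × Fin m)) :
    (cayleyRot y).1ᵀ = cayley (-offSkew k m y) :=
  transpose_cayley (transpose_offSkew y)

theorem continuous_cayleyRot :
    Continuous (cayleyRot : EuclideanSpace ℝ (Fin k × Fin m) → orthogonalGroup (Fin (k + m)) ℝ) :=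
  Continuous.subtype_mk
    (continuous_cayley (offSkew k m).continuous_of_finiteDimensional transpose_offSkew) _

/-- The Cayley chart of the orthogonal group at `1`. -/
def cayleyChart (z : EuclideanSpace ℝ (LtPair n)) : orthogonalGroup (Fin n) ℝ :=
  ⟨cayley (skewMat n z), cayley_mem_orthogonalGroup (transpose_skewMat z)⟩

theorem continuous_cayleyChart :
    Continuous (cayleyChart : EuclideanSpace ℝ (LtPair n) → orthogonalGroup (Fin n) ℝ) :=
  Continuous.subtype_mk
    (continuous_cayley (skewMat n).continuous_of_finiteDimensional transpose_skewMat) _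

theorem isAsymptoticIsometry_cayleyChart :
    IsAsymptoticIsometry (cayleyChart : EuclideanSpace ℝ (LtPair n) → orthogonalGroup (Fin n) ℝ) :=
  isAsymptoticIsometry_cayley (skewMat n) norm_skewMat

/-- The chart of the Grassmannian at the plane of the first `k` coordinates. -/
def grassChart (y : EuclideanSpace ℝ (Fin k × Fin m)) : Grass (k + m) k :=
  planeOf (cayleyRot y)

theorem projMatrix_grassChart (y : EuclideanSpace ℝ (Fin k × Fin m)) :
    projMatrix (grassChart y) = cayley (offSkew k m y) *
      finBlocks (1 : Matrix (Fin k) (Fin k) ℝ) 0 0 (0 : Matrix (Fin m) (Fin m) ℝ) *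
      cayley (-offSkew k m y) := by
  rw [grassChart, projMatrix_planeOf, transpose_cayleyRot, cayleyRot]

theorem isAsymptoticIsometry_grassChart :
    IsAsymptoticIsometry (grassChart : EuclideanSpace ℝ (Fin k × Fin m) → Grass (k + m) k) := by
  have hproj : IsAsymptoticIsometry fun y : EuclideanSpace ℝ (Fin k × Fin m) =>
      projMatrix (grassChart y) := by
    simp only [projMatrix_grassChart]
    refine isAsymptoticIsometry_cayley_conj (offSkew k m) _ fun y => ?_
    rw [← norm_offSkew, ← sq_eq_sq₀ (norm_nonneg _) (norm_nonneg _), offSkew_apply, finBlocks_mul,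
      finBlocks_mul, finBlocks_sub, frobenius_norm_sq_finBlocks, frobenius_norm_sq_finBlocks]
    simp
  exact hproj

/-- Pullback of coordinate vectors along a map of index sets. -/
def coordPullback {ι κ : Type*} (f : κ → ι) : EuclideanSpace ℝ ι →ₗ[ℝ] EuclideanSpace ℝ κ :=
  (WithLp.linearEquiv 2 ℝ (κ → ℝ)).symm.toLinearMap ∘ₗ LinearMap.funLeft ℝ ℝ f ∘ₗ
    (WithLp.linearEquiv 2 ℝ (ι → ℝ)).toLinearMap

theorem norm_sq_coordPullback_inl_add_inr {ι κ : Type*} [Fintype ι] [Fintype κ]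
    (w : EuclideanSpace ℝ (ι ⊕ κ)) :
    ‖coordPullback Sum.inl w‖ ^ 2 + ‖coordPullback Sum.inr w‖ ^ 2 = ‖w‖ ^ 2 := by
  simp only [EuclideanSpace.real_norm_sq_eq, Fintype.sum_sum_type]
  rfl

/-- The block-diagonal skew-symmetric matrix with coordinates `z`.  These matrices form the vertical
tangent space of the fibration of `O_{k+m}` over the Grassmannian. -/
def diagSkew (k m : ℕ) :
    EuclideanSpace ℝ (LtPair k ⊕ LtPair m) →ₗ[ℝ] Matrix (Fin (k + m)) (Fin (k + m)) ℝ where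
  toFun z :=
    finBlocks (skewMat k (coordPullback Sum.inl z)) 0 0 (skewMat m (coordPullback Sum.inr z))
  map_add' z w := by
    simp only [finBlocks_add, map_add, add_zero]
  map_smul' r z := by
    simp only [RingHom.id_apply, finBlocks_smul, map_smul, smul_zero]

theorem diagSkew_apply (z : EuclideanSpace ℝ (LtPair k ⊕ LtPair m)) :
    diagSkew k m z =
      finBlocks (skewMat k (coordPullback Sum.inl z)) 0 0
        (skewMat m (coordPullback Sum.inr z)) := rfl

theorem norm_offSkew_add_diagSkew
    (w : EuclideanSpace ℝ ((Fin k × Fin m) ⊕ (LtPair k ⊕ LtPair m))) :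
    ‖offSkew k m (coordPullback Sum.inl w) + diagSkew k m (coordPullback Sum.inr w)‖ = ‖w‖ := by
  rw [← sq_eq_sq₀ (norm_nonneg _) (norm_nonneg _), ← norm_sq_coordPullback_inl_add_inr w,
    ← norm_sq_coordPullback_inl_add_inr (coordPullback Sum.inr w), ← two_mul_norm_offMat_sq,
    offSkew_apply, diagSkew_apply, finBlocks_add, frobenius_norm_sq_finBlocks, zero_add, zero_add,
    add_zero,
    add_zero, norm_skewMat, norm_skewMat, norm_neg, frobenius_norm_transpose]
  ring

theorem cayley_finBlocks_of_skew {Z : Matrix (Fin k) (Fin k) ℝ} {Z' : Matrix (Fin m) (Fin m) ℝ}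
    (hZ : Zᵀ = -Z) (hZ' : Z'ᵀ = -Z') :
    cayley (finBlocks Z 0 0 Z') = finBlocks (cayley Z) 0 0 (cayley Z') := by
  have hinv : (finBlocks (1 - (1 / 2 : ℝ) • Z) 0 0 (1 - (1 / 2 : ℝ) • Z'))⁻¹ =
      finBlocks (1 - (1 / 2 : ℝ) • Z)⁻¹ 0 0 (1 - (1 / 2 : ℝ) • Z')⁻¹ := by
    apply inv_eq_right_inv
    rw [finBlocks_mul, mul_nonsing_inv _ (isUnit_det_one_sub_half_smul_of_skew hZ),
      mul_nonsing_inv _ (isUnit_det_one_sub_half_smul_of_skew hZ')]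
    simp [finBlocks_one]
  rw [cayley_eq, cayley_eq, cayley_eq, ← finBlocks_one, finBlocks_smul, smul_zero, smul_zero,
    finBlocks_sub, finBlocks_add,
    sub_zero, sub_zero, add_zero, add_zero, hinv, finBlocks_mul]
  simp

/-- The chart of the orthogonal group at `1` adapted to the fibration over the Grassmannian. -/
def fibredChart (w : EuclideanSpace ℝ ((Fin k × Fin m) ⊕ (LtPair k ⊕ LtPair m))) :
    orthogonalGroup (Fin (k + m)) ℝ :=
  cayleyRot (coordPullback Sum.inl w) *
    blockOrthogonal (cayleyChart (coordPullback (Sum.inr ∘ Sum.inl) w),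
    cayleyChart (coordPullback (Sum.inr ∘ Sum.inr) w))

theorem coe_fibredChart (w : EuclideanSpace ℝ ((Fin k × Fin m) ⊕ (LtPair k ⊕ LtPair m))) :
    (fibredChart w : Matrix (Fin (k + m)) (Fin (k + m)) ℝ) =
      cayley (offSkew k m (coordPullback Sum.inl w)) *
        cayley (diagSkew k m (coordPullback Sum.inr w)) := by
  rw [diagSkew_apply, cayley_finBlocks_of_skew (transpose_skewMat _) (transpose_skewMat _)]
  rfl

theorem isAsymptoticIsometry_fibredChart :
    IsAsymptoticIsometry (fibredChart :
      EuclideanSpace ℝ ((Fin k × Fin m) ⊕ (LtPair k ⊕ LtPair m)) →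
        orthogonalGroup (Fin (k + m)) ℝ) := by
  let horizontal : EuclideanSpace ℝ ((Fin k × Fin m) ⊕ (LtPair k ⊕ LtPair m)) →ₗ[ℝ]
      Matrix (Fin (k + m)) (Fin (k + m)) ℝ := offSkew k m ∘ₗ coordPullback Sum.inl
  let vertical : EuclideanSpace ℝ ((Fin k × Fin m) ⊕ (LtPair k ⊕ LtPair m)) →ₗ[ℝ]
      Matrix (Fin (k + m)) (Fin (k + m)) ℝ := diagSkew k m ∘ₗ coordPullback Sum.inr
  have hcoe := isAsymptoticIsometry_cayley_mul_cayley horizontal vertical norm_offSkew_add_diagSkew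
  have hmul : (fun w => cayley (horizontal w) * cayley (vertical w)) =
      fun w => (fibredChart w : Matrix (Fin (k + m)) (Fin (k + m)) ℝ) :=
    funext fun w => (coe_fibredChart w).symm
  rw [hmul] at hcoe
  exact hcoe

end Charts

section Invariance

open Matrix Topology

attribute [local instance] Matrix.frobeniusNormedAddCommGroup Matrix.frobeniusNormedSpace
  Matrix.frobeniusNormedRing Matrix.frobeniusNormedAlgebra

theorem frobenius_norm_sq_eq_trace {ι κ : Type*} [Fintype ι] [Fintype κ] (X : Matrix ι κ ℝ) :
    ‖X‖ ^ 2 = (Xᵀ * X).trace := by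
  rw [frobenius_norm_sq, Finset.sum_comm]
  simp [trace, mul_apply, sq]

section Orthogonal

variable {ι κ : Type*} [Fintype ι] [DecidableEq ι] [Fintype κ]

theorem frobenius_norm_orthogonal_mul (V : orthogonalGroup ι ℝ) (X : Matrix ι κ ℝ) :
    ‖V.1 * X‖ = ‖X‖ := by
  rw [← sq_eq_sq₀ (norm_nonneg _) (norm_nonneg _), frobenius_norm_sq_eq_trace,
    frobenius_norm_sq_eq_trace, transpose_mul, Matrix.mul_assoc, ← Matrix.mul_assoc _ᵀ V.1,
    orthogonalGroup_transpose_mul_self, Matrix.one_mul]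

theorem frobenius_norm_mul_orthogonal (V : orthogonalGroup ι ℝ) (X : Matrix κ ι ℝ) :
    ‖X * V.1‖ = ‖X‖ := by
  rw [← frobenius_norm_transpose, transpose_mul, ← orthogonalGroup_coe_inv,
    frobenius_norm_orthogonal_mul, frobenius_norm_transpose]

theorem eventually_isUnit_add_one_and_norm_invCayley_le {r : ℝ} (hr : 0 < r) :
    ∀ᶠ M : Matrix ι ι ℝ in 𝓝 1, IsUnit (M + 1).det ∧ ‖invCayley M‖ ≤ r := by
  have hdet : ContinuousAt (fun M : Matrix ι ι ℝ => (M + 1).det) 1 :=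
    (continuous_id.add continuous_const).matrix_det.continuousAt
  have hnorm : Filter.Tendsto (fun M : Matrix ι ι ℝ => ‖invCayley M‖) (𝓝 1) (𝓝 0) := by
    have := (continuous_norm.tendsto (invCayley (1 : Matrix ι ι ℝ))).comp continuousAt_invCayley
    rwa [invCayley_one, norm_zero] at this
  filter_upwards [hdet.eventually_ne det_one_add_one_ne_zero, hnorm.eventually_le_const hr]
    with M hM hMr
  exact ⟨isUnit_iff_ne_zero.2 hM, hMr⟩

end Orthogonal

section OrthogonalVolume

variable {n : ℕ}

theorem orthogonal_dist_eq (U V : orthogonalGroup (Fin n) ℝ) : dist U V = ‖U.1 - V.1‖ :=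
  dist_eq_norm U.1 V.1

theorem measurePreserving_orthogonalVolume_of_dist_eq
    (e : orthogonalGroup (Fin n) ℝ ≃ orthogonalGroup (Fin n) ℝ)
    (he : ∀ U V, dist (e U) (e V) = dist U V) :
    MeasurePreserving e (orthogonalVolume n) (orthogonalVolume n) :=
  (IsometryEquiv.mk e (Isometry.of_dist_eq he)).measurePreserving_euclideanHausdorffMeasure _

instance orthogonalVolume_isMulLeftInvariant : (orthogonalVolume n).IsMulLeftInvariant :=
  ⟨fun V => (measurePreserving_orthogonalVolume_of_dist_eq (Equiv.mulLeft V) fun U W => by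
    rw [orthogonal_dist_eq, orthogonal_dist_eq]
    change ‖V.1 * U.1 - V.1 * W.1‖ = _
    rw [← Matrix.mul_sub, frobenius_norm_orthogonal_mul]).map_eq⟩

instance orthogonalVolume_isMulRightInvariant : (orthogonalVolume n).IsMulRightInvariant :=
  ⟨fun V => (measurePreserving_orthogonalVolume_of_dist_eq (Equiv.mulRight V) fun U W => by
    rw [orthogonal_dist_eq, orthogonal_dist_eq]
    change ‖U.1 * V.1 - W.1 * V.1‖ = _
    rw [← Matrix.sub_mul, frobenius_norm_mul_orthogonal]).map_eq⟩

instance orthogonalVolume_isInvInvariant : (orthogonalVolume n).IsInvInvariant :=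
  ⟨(measurePreserving_orthogonalVolume_of_dist_eq (Equiv.inv _) fun U W => by
    rw [orthogonal_dist_eq, orthogonal_dist_eq]
    change ‖U.1ᵀ - W.1ᵀ‖ = _
    rw [← transpose_sub, frobenius_norm_transpose]).map_eq⟩

theorem finrank_euclideanSpace_ltPair :
    Module.finrank ℝ (EuclideanSpace ℝ (LtPair n)) = n * (n - 1) / 2 := by
  rw [finrank_euclideanSpace, card_ltPair]

theorem cayleyChart_image_closedBall_mem_nhds {r : ℝ} (hr : 0 < r) :
    cayleyChart '' Metric.closedBall (0 : EuclideanSpace ℝ (LtPair n)) r ∈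
      𝓝 (1 : orthogonalGroup (Fin n) ℝ) := by
  have hcoe : Filter.Tendsto (fun U : orthogonalGroup (Fin n) ℝ => U.1) (𝓝 1) (𝓝 1) :=
    continuous_subtype_val.tendsto _
  filter_upwards [hcoe.eventually (eventually_isUnit_add_one_and_norm_invCayley_le hr)]
    with U ⟨hU, hUr⟩
  obtain ⟨z, hz⟩ := exists_skewMat_eq ((transpose_invCayley U.1).trans
    (invCayley_transpose_of_orthogonal (orthogonalGroup_mul_transpose_self U)))
  refine ⟨z, ?_, Subtype.ext ?_⟩
  · rwa [mem_closedBall_zero_iff, ← norm_skewMat, hz]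
  · change cayley (skewMat n z) = U.1
    rw [hz, cayley_invCayley hU]

instance orthogonalVolume_isFiniteMeasure : IsFiniteMeasure (orthogonalVolume n) := by
  obtain ⟨r, hr, -, -, himage⟩ := (isAsymptoticIsometry_cayleyChart (n := n)).exists_measure_image
    finrank_euclideanSpace_ltPair one_pos
  set N := cayleyChart '' Metric.closedBall (0 : EuclideanSpace ℝ (LtPair n)) r
  have hN : orthogonalVolume n N < ⊤ :=
    (himage _ subset_rfl).2.trans_lt (ENNReal.mul_lt_top (by simp)
      Metric.isBounded_closedBall.measure_lt_top)
  refine ⟨isCompact_univ.measure_lt_top_of_nhdsWithin fun V _ => ?_⟩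
  rw [nhdsWithin_univ]
  refine ⟨(fun U => V⁻¹ * U) ⁻¹' N, ?_, by rwa [measure_preimage_mul]⟩
  refine (continuous_const_mul V⁻¹).continuousAt.preimage_mem_nhds ?_
  rw [inv_mul_cancel]
  exact cayleyChart_image_closedBall_mem_nhds hr

end OrthogonalVolume

section GrassVolume

variable {n k : ℕ}

theorem isometry_projMatrix :
    Isometry (projMatrix : Grass n k → Matrix (Fin n) (Fin n) ℝ) := fun _ _ => rfl

theorem dist_rotGrass (U : orthogonalGroup (Fin n) ℝ) (g h : Grass n k) :
    dist (rotGrass U g) (rotGrass U h) = dist g h := by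
  rw [← isometry_projMatrix.dist_eq, ← isometry_projMatrix.dist_eq g, dist_eq_norm, dist_eq_norm,
    projMatrix_rotGrass, projMatrix_rotGrass, ← Matrix.sub_mul, ← Matrix.mul_sub,
    ← orthogonalGroup_coe_inv, frobenius_norm_mul_orthogonal, frobenius_norm_orthogonal_mul]

theorem rotGrass_rotGrass (U V : orthogonalGroup (Fin n) ℝ) (g : Grass n k) :
    rotGrass U (rotGrass V g) = rotGrass (U * V) g := by
  apply projMatrix_injective
  rw [projMatrix_rotGrass, projMatrix_rotGrass, projMatrix_rotGrass, Submonoid.coe_mul,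
    transpose_mul]
  simp only [Matrix.mul_assoc]

theorem rotGrass_one (g : Grass n k) : rotGrass (1 : orthogonalGroup (Fin n) ℝ) g = g := by
  apply projMatrix_injective
  rw [projMatrix_rotGrass, Submonoid.coe_one, transpose_one, Matrix.one_mul, Matrix.mul_one]

theorem measurePreserving_rotGrass (U : orthogonalGroup (Fin n) ℝ) :
    MeasurePreserving (rotGrass U : Grass n k → Grass n k) (grassVolume n k)
      (grassVolume n k) := by
  let e : Grass n k ≃ Grass n k :=
    { toFun := rotGrass U
      invFun := rotGrass U⁻¹
      left_inv := fun g => by rw [rotGrass_rotGrass, inv_mul_cancel, rotGrass_one]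
      right_inv := fun g => by rw [rotGrass_rotGrass, mul_inv_cancel, rotGrass_one] }
  exact (IsometryEquiv.mk e
    (Isometry.of_dist_eq (dist_rotGrass U))).measurePreserving_euclideanHausdorffMeasure _

end GrassVolume

section ProjChart

variable {k m : ℕ}

theorem projMatrix_mul_self (g : Grass (k + m) k) : projMatrix g * projMatrix g = projMatrix g := by
  obtain ⟨W, rfl⟩ := planeOf_surjective g
  calc projMatrix (planeOf W) * projMatrix (planeOf W)
      = W.1 * (finBlocks 1 0 0 0 * (W.1ᵀ * W.1) * finBlocks 1 0 0 0) * W.1ᵀ := by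
        rw [projMatrix_planeOf]
        simp only [Matrix.mul_assoc]
    _ = projMatrix (planeOf W) := by
        rw [orthogonalGroup_transpose_mul_self, Matrix.mul_one, finBlocks_mul, projMatrix_planeOf]
        simp

theorem transpose_projMatrix (g : Grass (k + m) k) : (projMatrix g)ᵀ = projMatrix g := by
  obtain ⟨W, rfl⟩ := planeOf_surjective g
  rw [projMatrix_planeOf, transpose_mul, transpose_mul, transpose_transpose, finBlocks_transpose]
  simp [Matrix.mul_assoc]

/-- The orthogonal reflection with the first `k` coordinates as fixed space. -/
def stdRefl (k m : ℕ) : Matrix (Fin (k + m)) (Fin (k + m)) ℝ :=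
  finBlocks (1 : Matrix (Fin k) (Fin k) ℝ) 0 0 (-1 : Matrix (Fin m) (Fin m) ℝ)

theorem stdRefl_mul_self : stdRefl k m * stdRefl k m = 1 := by
  simp [stdRefl, finBlocks_mul, finBlocks_one]

theorem transpose_stdRefl : (stdRefl k m)ᵀ = stdRefl k m := by simp [stdRefl, finBlocks_transpose]

theorem exists_offSkew_eq {Z : Matrix (Fin (k + m)) (Fin (k + m)) ℝ} (hZ : Zᵀ = -Z)
    (hR : stdRefl k m * Z * stdRefl k m = -Z) : ∃ y, offSkew k m y = Z := by
  rw [stdRefl, ← finBlocks_blocks Z, finBlocks_mul, finBlocks_mul, finBlocks_neg] at hR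
  rw [← finBlocks_blocks Z, finBlocks_transpose, finBlocks_neg] at hZ
  have hul : ulBlock Z = 0 := by
    ext i j
    exact self_eq_neg.1 (by simpa using congrFun₂ (congrArg ulBlock hR) i j)
  have hlr : lrBlock Z = 0 := by
    ext i j
    exact self_eq_neg.1 (by simpa using congrFun₂ (congrArg lrBlock hR) i j)
  have hur : urBlock Z = -(llBlock Z)ᵀ := by
    simpa using congrArg (fun M => (llBlock M)ᵀ) hZ
  refine ⟨WithLp.toLp 2 fun p => √2 * llBlock Z p.2 p.1, ?_⟩
  have hll : offMat k m (WithLp.toLp 2 fun p => √2 * llBlock Z p.2 p.1) = llBlock Z := by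
    ext i j
    simp [offMat_apply]
  rw [offSkew_apply, hll]
  conv_rhs => rw [← finBlocks_blocks Z, hul, hlr, hur]

/-- The product of the reflections in `g` and in the plane of the first `k` coordinates.  It tends
to `1` as `g` tends to that plane, and its inverse Cayley transform supplies coordinates for `g`. -/
def reflProd (g : Grass (k + m) k) : Matrix (Fin (k + m)) (Fin (k + m)) ℝ :=
  ((2 : ℝ) • projMatrix g - 1) * stdRefl k m

theorem continuous_reflProd :
    Continuous (reflProd : Grass (k + m) k → Matrix (Fin (k + m)) (Fin (k + m)) ℝ) :=
  ((continuous_projMatrix.const_smul (2 : ℝ)).sub continuous_const).matrix_mul continuous_const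

theorem reflProd_planeOf_one :
    reflProd (planeOf (1 : orthogonalGroup (Fin (k + m)) ℝ)) = 1 := by
  have hrefl : (2 : ℝ) • projMatrix (planeOf (1 : orthogonalGroup (Fin (k + m)) ℝ)) - 1 =
      stdRefl k m := by
    rw [projMatrix_planeOf, Submonoid.coe_one, Matrix.one_mul, transpose_one, Matrix.mul_one,
      finBlocks_smul, ← finBlocks_one, finBlocks_sub, stdRefl]
    simp only [smul_zero, sub_zero, two_smul, add_sub_cancel_right, zero_sub]
  rw [reflProd, hrefl, stdRefl_mul_self]

/-- The projection onto the plane whose reflection is `cayley (offSkew k m y) * stdRefl k m`: a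
chart of the projection matrices near that of the plane of the first `k` coordinates. -/
def projChart (k m : ℕ) (y : EuclideanSpace ℝ (Fin k × Fin m)) :
    Matrix (Fin (k + m)) (Fin (k + m)) ℝ :=
  (1 / 2 : ℝ) • (1 + cayley (offSkew k m y) * stdRefl k m)

theorem exists_projChart_eq (g : Grass (k + m) k) (hg : IsUnit (reflProd g + 1).det) :
    ∃ y, offSkew k m y = invCayley (reflProd g) ∧ projChart k m y = projMatrix g := by
  set R := (2 : ℝ) • projMatrix g - 1 with hR
  have hprod : reflProd g = R * stdRefl k m := rfl
  have hRR : R * R = 1 := by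
    rw [hR, Matrix.mul_sub, Matrix.sub_mul, Matrix.smul_mul, Matrix.mul_smul,
      projMatrix_mul_self, Matrix.mul_one, Matrix.one_mul, two_smul, two_smul]
    abel
  have htranspose : (reflProd g)ᵀ = stdRefl k m * R := by
    rw [hprod, transpose_mul, transpose_stdRefl, hR, transpose_sub, transpose_smul,
      transpose_projMatrix, transpose_one]
  have horth : reflProd g * (reflProd g)ᵀ = 1 := by
    rw [htranspose, hprod, Matrix.mul_assoc, ← Matrix.mul_assoc (stdRefl k m), stdRefl_mul_self,
      Matrix.one_mul, hRR]
  have hconj : stdRefl k m * reflProd g * stdRefl k m = (reflProd g)ᵀ := by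
    rw [htranspose, hprod, Matrix.mul_assoc, Matrix.mul_assoc, stdRefl_mul_self, Matrix.mul_one]
  have hneg := invCayley_transpose_of_orthogonal horth
  obtain ⟨y, hy⟩ := exists_offSkew_eq ((transpose_invCayley _).trans hneg)
    ((invCayley_conj_of_mul_self stdRefl_mul_self _).symm.trans (by rw [hconj, hneg]))
  refine ⟨y, hy, ?_⟩
  rw [projChart, hy, cayley_invCayley hg, hprod, Matrix.mul_assoc, stdRefl_mul_self,
    Matrix.mul_one, hR, add_sub_cancel, smul_smul, one_div_mul_cancel two_ne_zero, one_smul]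

theorem eventually_projMatrix_mem_image_projChart {r : ℝ} (hr : 0 < r) :
    ∀ᶠ g in 𝓝 (planeOf (1 : orthogonalGroup (Fin (k + m)) ℝ)),
      projMatrix g ∈ projChart k m '' Metric.closedBall 0 r := by
  have hlim : Filter.Tendsto (reflProd : Grass (k + m) k → _)
      (𝓝 (planeOf (1 : orthogonalGroup (Fin (k + m)) ℝ))) (𝓝 1) := by
    rw [← reflProd_planeOf_one (k := k) (m := m)]
    exact continuous_reflProd.tendsto _
  filter_upwards [hlim.eventually (eventually_isUnit_add_one_and_norm_invCayley_le hr)]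
    with g ⟨hg, hgr⟩
  obtain ⟨y, hy, hyg⟩ := exists_projChart_eq g hg
  exact ⟨y, by rwa [mem_closedBall_zero_iff, ← norm_offSkew, hy], hyg⟩

theorem exists_lipschitzOnWith_projChart :
    ∃ r > 0, LipschitzOnWith ‖stdRefl k m‖₊ (projChart k m) (Metric.closedBall 0 r) := by
  obtain ⟨r, hr, hlip⟩ := isAsymptoticIsometry_cayley (offSkew k m) norm_offSkew 1 one_pos
  refine ⟨r, hr, LipschitzOnWith.of_dist_le_mul fun x hx y hy => ?_⟩
  have hcayley := (hlip x hx y hy).2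
  rw [dist_eq_norm (cayley (offSkew k m x))] at hcayley
  calc dist (projChart k m x) (projChart k m y)
      = 1 / 2 * ‖(cayley (offSkew k m x) - cayley (offSkew k m y)) * stdRefl k m‖ := by
        rw [dist_eq_norm, projChart, projChart, ← smul_sub, add_sub_add_left_eq_sub,
          ← Matrix.sub_mul, norm_smul, Real.norm_of_nonneg one_half_pos.le]
    _ ≤ 1 / 2 * ((1 + 1) * dist x y * ‖stdRefl k m‖) := by
        gcongr
        exact (norm_mul_le _ _).trans (mul_le_mul_of_nonneg_right hcayley (norm_nonneg _))
    _ = ‖stdRefl k m‖₊ * dist x y := by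
        rw [coe_nnnorm]
        ring

theorem finrank_euclideanSpace_grass :
    Module.finrank ℝ (EuclideanSpace ℝ (Fin k × Fin m)) = k * (k + m - k) := by
  rw [finrank_euclideanSpace]
  simp

theorem exists_nhds_grassVolume_lt_top :
    ∃ N ∈ 𝓝 (planeOf (1 : orthogonalGroup (Fin (k + m)) ℝ)), grassVolume (k + m) k N < ⊤ := by
  obtain ⟨r, hr, hlip⟩ := exists_lipschitzOnWith_projChart (k := k) (m := m)
  refine ⟨projMatrix ⁻¹' (projChart k m '' Metric.closedBall 0 r),
    eventually_projMatrix_mem_image_projChart hr, ?_⟩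
  rw [← Real.toNNReal_coe (r := ‖stdRefl k m‖₊)] at hlip
  refine (euclideanHausdorffMeasure_preimage_image_le isometry_projMatrix (NNReal.coe_nonneg _)
    hlip).trans_lt ?_
  rw [← finrank_euclideanSpace_grass, InnerProductSpace.euclideanHausdorffMeasure_eq_volume]
  exact ENNReal.mul_lt_top (by simp) Metric.isBounded_closedBall.measure_lt_top

end ProjChart

end Invariance

section GrassFinite

open Matrix Topology

theorem continuous_rotGrass_left {n k : ℕ} (W : orthogonalGroup (Fin n) ℝ) :
    Continuous (rotGrass W : Grass n k → Grass n k) :=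
  continuous_rotGrass.comp (Continuous.prodMk_right W)

instance grassVolume_isFiniteMeasure (k m : ℕ) : IsFiniteMeasure (grassVolume (k + m) k) := by
  obtain ⟨N, hN, hfin⟩ := exists_nhds_grassVolume_lt_top (k := k) (m := m)
  obtain ⟨O, hON, hO, hmem⟩ := mem_nhds_iff.1 hN
  refine ⟨isCompact_univ.measure_lt_top_of_nhdsWithin fun g _ => ?_⟩
  rw [nhdsWithin_univ]
  obtain ⟨W, rfl⟩ := planeOf_surjective g
  refine ⟨rotGrass W⁻¹ ⁻¹' O, (hO.preimage (continuous_rotGrass_left W⁻¹)).mem_nhds ?_, ?_⟩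
  · rwa [Set.mem_preimage, rotGrass_planeOf, inv_mul_cancel]
  · rw [(measurePreserving_rotGrass W⁻¹).measure_preimage hO.measurableSet.nullMeasurableSet]
    exact (measure_mono hON).trans_lt hfin

end GrassFinite

section Fibration

open Matrix Topology

variable {k m : ℕ}

theorem measurable_rotGrass_planeOf {f : Grass (k + m) k → ENNReal} (hf : Measurable f) :
    Measurable fun p : Grass (k + m) k × orthogonalGroup (Fin (k + m)) ℝ =>
      f (rotGrass p.2 p.1) :=
  hf.comp (continuous_rotGrass.comp continuous_swap).measurable

/- Both sides are the integral of `f (W g)` over all pairs `(W, g)`. -/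
theorem grassVolume_univ_mul_lintegral_planeOf {f : Grass (k + m) k → ENNReal}
    (hf : Measurable f) :
    grassVolume (k + m) k Set.univ * ∫⁻ W, f (planeOf W) ∂orthogonalVolume (k + m) =
      orthogonalVolume (k + m) Set.univ * ∫⁻ g, f g ∂grassVolume (k + m) k := by
  have hswap := lintegral_lintegral_swap (μ := grassVolume (k + m) k)
    (ν := orthogonalVolume (k + m)) (f := fun g W => f (rotGrass W g))
    (measurable_rotGrass_planeOf hf).aemeasurable
  have orbit_average (g : Grass (k + m) k) : ∫⁻ W, f (rotGrass W g) ∂orthogonalVolume (k + m) =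
      ∫⁻ W, f (planeOf W) ∂orthogonalVolume (k + m) := by
    obtain ⟨V, rfl⟩ := planeOf_surjective g
    simp_rw [rotGrass_planeOf]
    exact lintegral_mul_right_eq_self (μ := orthogonalVolume (k + m)) (fun W => f (planeOf W)) V
  have rotation_invariance (W : orthogonalGroup (Fin (k + m)) ℝ) :
      ∫⁻ g, f (rotGrass W g) ∂grassVolume (k + m) k = ∫⁻ g, f g ∂grassVolume (k + m) k :=
    (measurePreserving_rotGrass W).lintegral_comp hf
  simp_rw [orbit_average, rotation_invariance, lintegral_const] at hswap
  rw [mul_comm, hswap, mul_comm]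

theorem grassVolume_univ_mul_measure_planeOf_preimage {S : Set (Grass (k + m) k)}
    (hS : MeasurableSet S) :
    grassVolume (k + m) k Set.univ * orthogonalVolume (k + m) (planeOf ⁻¹' S) =
      orthogonalVolume (k + m) Set.univ * grassVolume (k + m) k S := by
  rw [← lintegral_indicator_one hS,
    ← lintegral_indicator_one (continuous_planeOf.measurable hS),
    ← grassVolume_univ_mul_lintegral_planeOf (measurable_one.indicator hS)]
  rfl

/-- The product of the volumes of `O_k` and `O_m`, the volume of the fibres of `planeOf`. -/
abbrev fibreVolume (k m : ℕ) :
    Measure (orthogonalGroup (Fin k) ℝ × orthogonalGroup (Fin m) ℝ) :=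
  (orthogonalVolume k).prod (orthogonalVolume m)

theorem lintegral_lintegral_mul_blockOrthogonal {F : orthogonalGroup (Fin (k + m)) ℝ → ENNReal}
    (hF : Measurable F) :
    ∫⁻ U, ∫⁻ h, F (U * blockOrthogonal h) ∂fibreVolume k m ∂orthogonalVolume (k + m) =
      fibreVolume k m Set.univ * ∫⁻ U, F U ∂orthogonalVolume (k + m) := by
  rw [lintegral_lintegral_swap]
  · simp_rw [fun h =>
      lintegral_mul_right_eq_self (μ := orthogonalVolume (k + m)) F (blockOrthogonal h)]
    rw [lintegral_const, mul_comm]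
  · exact (hF.comp (continuous_fst.mul
      ((continuous_blockOrthogonal (k := k) (m := m)).comp continuous_snd)).measurable).aemeasurable

theorem blockOrthogonal_injective : Function.Injective
    (blockOrthogonal : orthogonalGroup (Fin k) ℝ × orthogonalGroup (Fin m) ℝ → _) := by
  intro h h' heq
  have hblk : finBlocks h.1.1 0 0 h.2.1 = finBlocks h'.1.1 0 0 h'.2.1 := congrArg Subtype.val heq
  have hul := congrArg ulBlock hblk
  have hlr := congrArg lrBlock hblk
  rw [ulBlock_finBlocks, ulBlock_finBlocks] at hul
  rw [lrBlock_finBlocks, lrBlock_finBlocks] at hlr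
  exact Prod.ext (Subtype.ext hul) (Subtype.ext hlr)

theorem continuous_grassChart :
    Continuous (grassChart : EuclideanSpace ℝ (Fin k × Fin m) → Grass (k + m) k) :=
  continuous_planeOf.comp continuous_cayleyRot

/-- The set of all `cayleyRot y * blockOrthogonal h` with `y ∈ Y` and `h ∈ T`: in the local
trivialization of `planeOf : O_{k+m} → G(k+m, k)` given by `cayleyRot`, the product of `Y` and
`T`. -/
def fibredBox (Y : Set (EuclideanSpace ℝ (Fin k × Fin m)))
    (T : Set (orthogonalGroup (Fin k) ℝ × orthogonalGroup (Fin m) ℝ)) :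
    Set (orthogonalGroup (Fin (k + m)) ℝ) :=
  (fun p => cayleyRot p.1 * blockOrthogonal p.2) '' Y ×ˢ T

theorem isCompact_fibredBox {Y : Set (EuclideanSpace ℝ (Fin k × Fin m))} (hY : IsCompact Y)
    {T : Set (orthogonalGroup (Fin k) ℝ × orthogonalGroup (Fin m) ℝ)} (hT : IsCompact T) :
    IsCompact (fibredBox Y T) :=
  (hY.prod hT).image ((continuous_cayleyRot.comp continuous_fst).mul
    (continuous_blockOrthogonal.comp continuous_snd))

theorem planeOf_mem_of_mul_blockOrthogonal_mem_fibredBox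
    {Y : Set (EuclideanSpace ℝ (Fin k × Fin m))}
    {T : Set (orthogonalGroup (Fin k) ℝ × orthogonalGroup (Fin m) ℝ)}
    {U : orthogonalGroup (Fin (k + m)) ℝ}
    {h : orthogonalGroup (Fin k) ℝ × orthogonalGroup (Fin m) ℝ}
    (hU : U * blockOrthogonal h ∈ fibredBox Y T) : planeOf U ∈ grassChart '' Y := by
  obtain ⟨⟨y, t⟩, ⟨hy, -⟩, heq⟩ := hU
  have hplane := congrArg (planeOf : _ → Grass (k + m) k) heq
  rw [planeOf_mul_blockOrthogonal, planeOf_mul_blockOrthogonal] at hplane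
  exact ⟨y, hy, hplane⟩

theorem cayleyRot_mul_blockOrthogonal_mem_fibredBox_iff
    {Y : Set (EuclideanSpace ℝ (Fin k × Fin m))}
    (hinj : Set.InjOn (grassChart : _ → Grass (k + m) k) Y)
    {T : Set (orthogonalGroup (Fin k) ℝ × orthogonalGroup (Fin m) ℝ)}
    {y : EuclideanSpace ℝ (Fin k × Fin m)} (hy : y ∈ Y)
    (h : orthogonalGroup (Fin k) ℝ × orthogonalGroup (Fin m) ℝ) :
    cayleyRot y * blockOrthogonal h ∈ fibredBox Y T ↔ h ∈ T := by
  refine ⟨?_, fun hh => ⟨(y, h), ⟨hy, hh⟩, rfl⟩⟩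
  rintro ⟨⟨y', t⟩, ⟨hy' : y' ∈ Y, ht⟩,
    heq : cayleyRot y' * blockOrthogonal t = cayleyRot y * blockOrthogonal h⟩
  have hplane := congrArg (planeOf : _ → Grass (k + m) k) heq
  rw [planeOf_mul_blockOrthogonal, planeOf_mul_blockOrthogonal] at hplane
  rw [hinj hy' hy hplane] at heq
  exact blockOrthogonal_injective (mul_left_cancel heq) ▸ ht

theorem lintegral_indicator_fibredBox {Y : Set (EuclideanSpace ℝ (Fin k × Fin m))}
    (hinj : Set.InjOn (grassChart : _ → Grass (k + m) k) Y)
    {T : Set (orthogonalGroup (Fin k) ℝ × orthogonalGroup (Fin m) ℝ)} (hT : MeasurableSet T)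
    (U : orthogonalGroup (Fin (k + m)) ℝ) :
    ∫⁻ h, (fibredBox Y T).indicator 1 (U * blockOrthogonal h) ∂fibreVolume k m =
      ((planeOf : _ → Grass (k + m) k) ⁻¹' (grassChart '' Y)).indicator
        (fun _ => fibreVolume k m T) U := by
  by_cases hU : U ∈ (planeOf : _ → Grass (k + m) k) ⁻¹' (grassChart '' Y)
  · rw [Set.indicator_of_mem hU]
    obtain ⟨y, hy, hyU⟩ := hU
    obtain ⟨b, rfl⟩ := exists_eq_mul_blockOrthogonal hyU
    have htranslate (h) : (fibredBox Y T).indicator (fun _ => (1 : ENNReal))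
        (cayleyRot y * blockOrthogonal b * blockOrthogonal h) =
          T.indicator (fun _ => 1) (b * h) := by
      rw [mul_assoc, ← blockOrthogonal_mul]
      exact Set.indicator_const_eq_indicator_const
        (cayleyRot_mul_blockOrthogonal_mem_fibredBox_iff hinj hy _)
    simp_rw [Pi.one_def, htranslate]
    rw [lintegral_mul_left_eq_self, lintegral_indicator_const hT, one_mul]
  · rw [Set.indicator_of_notMem hU, ← lintegral_zero (μ := fibreVolume k m)]
    congr 1
    funext h
    exact Set.indicator_of_notMem (mt planeOf_mem_of_mul_blockOrthogonal_mem_fibredBox hU) _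

theorem fibreVolume_univ_mul_measure_fibredBox {Y : Set (EuclideanSpace ℝ (Fin k × Fin m))}
    (hY : IsCompact Y) (hinj : Set.InjOn (grassChart : _ → Grass (k + m) k) Y)
    {T : Set (orthogonalGroup (Fin k) ℝ × orthogonalGroup (Fin m) ℝ)} (hT : IsCompact T) :
    fibreVolume k m Set.univ * orthogonalVolume (k + m) (fibredBox Y T) =
      fibreVolume k m T * orthogonalVolume (k + m) (planeOf ⁻¹' (grassChart '' Y)) := by
  have hbox : MeasurableSet (fibredBox Y T) := (isCompact_fibredBox hY hT).measurableSet
  have hpre : MeasurableSet ((planeOf : _ → Grass (k + m) k) ⁻¹' (grassChart '' Y)) :=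
    continuous_planeOf.measurable (hY.image continuous_grassChart).measurableSet
  rw [← lintegral_indicator_one hbox,
    ← lintegral_lintegral_mul_blockOrthogonal (measurable_one.indicator hbox),
    ← lintegral_indicator_const hpre]
  simp_rw [lintegral_indicator_fibredBox hinj hT.measurableSet]

theorem measure_univ_mul_measure_fibredBox {Y : Set (EuclideanSpace ℝ (Fin k × Fin m))}
    (hY : IsCompact Y) (hinj : Set.InjOn (grassChart : _ → Grass (k + m) k) Y)
    {T : Set (orthogonalGroup (Fin k) ℝ × orthogonalGroup (Fin m) ℝ)} (hT : IsCompact T) :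
    grassVolume (k + m) k Set.univ * fibreVolume k m Set.univ *
        orthogonalVolume (k + m) (fibredBox Y T) =
      orthogonalVolume (k + m) Set.univ * fibreVolume k m T *
        grassVolume (k + m) k (grassChart '' Y) := by
  rw [mul_assoc, fibreVolume_univ_mul_measure_fibredBox hY hinj hT, mul_left_comm,
    grassVolume_univ_mul_measure_planeOf_preimage
      (hY.image continuous_grassChart).measurableSet]
  ring

/-- The closed cube of side `2 * t` centred at the origin. Products of cubes are cubes, unlike
for balls, so the chart of the total space and those of base and fibre can be compared on them. -/
def centeredCube (ι : Type*) (t : ℝ) : Set (EuclideanSpace ℝ ι) :=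
  {w | ∀ i, w i ∈ Set.Icc (-t) t}

theorem centeredCube_eq_preimage_pi (ι : Type*) (t : ℝ) : centeredCube ι t =
    WithLp.ofLp ⁻¹' Set.univ.pi fun _ => Set.Icc (-t) t := by
  ext w
  exact (Set.mem_univ_pi (t := fun _ => Set.Icc (-t) t)).symm

theorem volume_centeredCube (ι : Type*) [Fintype ι] (t : ℝ) :
    volume (centeredCube ι t) = ENNReal.ofReal (2 * t) ^ Fintype.card ι := by
  rw [centeredCube_eq_preimage_pi, (PiLp.volume_preserving_ofLp ι).measure_preimage
    (MeasurableSet.univ_pi fun _ => measurableSet_Icc).nullMeasurableSet, volume_pi_pi]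
  simp [two_mul]

theorem isCompact_centeredCube (ι : Type*) (t : ℝ) : IsCompact (centeredCube ι t) := by
  rw [centeredCube_eq_preimage_pi]
  exact (PiLp.homeomorph 2 fun _ : ι => ℝ).isCompact_preimage.2
    (isCompact_univ_pi fun _ => isCompact_Icc)

theorem eventually_centeredCube_subset_closedBall (ι : Type*) [Fintype ι] {r : ℝ} (hr : 0 < r) :
    ∀ᶠ t in 𝓝[>] 0, centeredCube ι t ⊆ Metric.closedBall 0 r := by
  have hpre : WithLp.toLp 2 ⁻¹' Metric.closedBall 0 r ∈ 𝓝 (0 : ι → ℝ) :=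
    (PiLp.continuous_toLp 2 fun _ : ι => ℝ).continuousAt.preimage_mem_nhds
      (Metric.closedBall_mem_nhds 0 hr)
  obtain ⟨s, hs, hball⟩ := Metric.nhds_basis_closedBall.mem_iff.1 hpre
  filter_upwards [Ioc_mem_nhdsGT hs] with t ht w hw
  refine hball (a := w.ofLp) ?_
  rw [mem_closedBall_zero_iff, pi_norm_le_iff_of_nonneg hs.le]
  exact fun i => (abs_le.2 (hw i)).trans ht.2

theorem IsAsymptoticIsometry.eventually_measure_image_centeredCube {ι X : Type*} [Fintype ι]
    [MetricSpace X] [MeasurableSpace X] [BorelSpace X] {f : EuclideanSpace ℝ ι → X}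
    (hf : IsAsymptoticIsometry f) {d : ℕ} (hd : Module.finrank ℝ (EuclideanSpace ℝ ι) = d)
    {ε : ℝ} (hε : 0 < ε) :
    ∀ᶠ t in 𝓝[>] 0, Set.InjOn f (centeredCube ι t) ∧
      ENNReal.ofReal (1 - ε) * ENNReal.ofReal (2 * t) ^ Fintype.card ι ≤
        μHE[d] (f '' centeredCube ι t) ∧
      μHE[d] (f '' centeredCube ι t) ≤
        ENNReal.ofReal (1 + ε) * ENNReal.ofReal (2 * t) ^ Fintype.card ι := by
  obtain ⟨r, hr, hinj, -, hmeas⟩ := hf.exists_measure_image hd hε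
  filter_upwards [eventually_centeredCube_subset_closedBall ι hr] with t ht
  rw [← volume_centeredCube]
  exact ⟨hinj.mono ht, hmeas _ ht⟩

theorem fibredChart_image_centeredCube (t : ℝ) :
    fibredChart '' centeredCube ((Fin k × Fin m) ⊕ (LtPair k ⊕ LtPair m)) t =
      fibredBox (centeredCube (Fin k × Fin m) t)
        ((cayleyChart '' centeredCube (LtPair k) t) ×ˢ
          (cayleyChart '' centeredCube (LtPair m) t)) := by
  ext U
  constructor
  · rintro ⟨w, hw, rfl⟩
    exact ⟨(_, (_, _)), ⟨fun i => hw _, ⟨_, fun i => hw (Sum.inr (Sum.inl i)), rfl⟩,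
      ⟨_, fun i => hw (Sum.inr (Sum.inr i)), rfl⟩⟩, rfl⟩
  · rintro ⟨⟨y, _, _⟩, ⟨hy, ⟨z, hz, rfl⟩, ⟨z', hz', rfl⟩⟩, rfl⟩
    refine ⟨WithLp.toLp 2 (Sum.elim y.ofLp (Sum.elim z.ofLp z'.ofLp)), ?_, rfl⟩
    rintro (i | i | i)
    exacts [hy i, hz i, hz' i]

theorem finrank_euclideanSpace_fibredChart :
    Module.finrank ℝ (EuclideanSpace ℝ ((Fin k × Fin m) ⊕ (LtPair k ⊕ LtPair m))) =
      (k + m) * (k + m - 1) / 2 := by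
  simp only [finrank_euclideanSpace, Fintype.card_sum, Fintype.card_prod, Fintype.card_fin,
    card_ltPair, ← Nat.choose_two_right]
  induction m with
  | zero => simp
  | succ m ih =>
    rw [← Nat.add_assoc k m, Nat.choose_succ_succ' (k + m), Nat.choose_succ_succ' m, ← ih,
      Nat.choose_one_right, Nat.choose_one_right]
    ring

theorem measure_univ_mul_ofReal_le {ε : ℝ} (hε : 0 < ε) :
    grassVolume (k + m) k Set.univ * fibreVolume k m Set.univ * ENNReal.ofReal (1 - ε) ≤
      orthogonalVolume (k + m) Set.univ * ENNReal.ofReal (1 + ε) ^ 3 := by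
  obtain ⟨t, ⟨-, htotal_ge, -⟩, ⟨hinj, -, hbase_le⟩, ⟨-, -, hleft_le⟩, ⟨-, -, hright_le⟩,
      (ht : 0 < t)⟩ :=
    ((isAsymptoticIsometry_fibredChart (k := k) (m := m)).eventually_measure_image_centeredCube
      finrank_euclideanSpace_fibredChart hε |>.and <|
    (isAsymptoticIsometry_grassChart (k := k) (m := m)).eventually_measure_image_centeredCube
      finrank_euclideanSpace_grass hε |>.and <|
    (isAsymptoticIsometry_cayleyChart (n := k)).eventually_measure_image_centeredCube
      finrank_euclideanSpace_ltPair hε |>.and <|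
    (isAsymptoticIsometry_cayleyChart (n := m)).eventually_measure_image_centeredCube
      finrank_euclideanSpace_ltPair hε |>.and self_mem_nhdsWithin).exists
  have hbox := measure_univ_mul_measure_fibredBox (isCompact_centeredCube (Fin k × Fin m) t)
    hinj (((isCompact_centeredCube (LtPair k) t).image continuous_cayleyChart).prod
      ((isCompact_centeredCube (LtPair m) t).image continuous_cayleyChart))
  rw [Measure.prod_prod] at hbox
  rw [fibredChart_image_centeredCube, Fintype.card_sum, Fintype.card_sum, pow_add,
    pow_add] at htotal_ge
  refine (ENNReal.mul_le_mul_iff_left (c := ENNReal.ofReal (2 * t) ^ Fintype.card (Fin k × Fin m) *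
    (ENNReal.ofReal (2 * t) ^ Fintype.card (LtPair k) *
      ENNReal.ofReal (2 * t) ^ Fintype.card (LtPair m))) (by simp [not_le.2 ht])
    (by simp [ENNReal.mul_eq_top])).1 ?_
  rw [mul_assoc _ (ENNReal.ofReal (1 - ε))]
  refine (mul_le_mul_right htotal_ge _).trans (hbox.trans_le ?_)
  refine (mul_le_mul' (mul_le_mul_right (mul_le_mul' hleft_le hright_le) _) hbase_le).trans_eq ?_
  ring

theorem grassVolume_mul_fibreVolume_le :
    grassVolume (k + m) k Set.univ * fibreVolume k m Set.univ ≤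
      orthogonalVolume (k + m) Set.univ := by
  have hleft : Continuous fun ε : ℝ => grassVolume (k + m) k Set.univ *
      fibreVolume k m Set.univ * ENNReal.ofReal (1 - ε) :=
    (ENNReal.continuous_const_mul (ENNReal.mul_ne_top (measure_ne_top _ _)
      (measure_ne_top _ _))).comp
      (ENNReal.continuous_ofReal.comp (by fun_prop))
  have hright : Continuous fun ε : ℝ => orthogonalVolume (k + m) Set.univ *
      ENNReal.ofReal (1 + ε) ^ 3 :=
    (ENNReal.continuous_const_mul (measure_ne_top _ _)).comp
      ((ENNReal.continuous_pow 3).comp (ENNReal.continuous_ofReal.comp (by fun_prop)))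
  simpa using le_of_tendsto_of_tendsto ((hleft.tendsto 0).mono_left nhdsWithin_le_nhds)
    ((hright.tendsto 0).mono_left nhdsWithin_le_nhds)
    (Filter.eventually_of_mem (self_mem_nhdsWithin (s := Set.Ioi (0 : ℝ))) fun ε hε =>
      measure_univ_mul_ofReal_le hε)

theorem fibreVolume_mul_lintegral_le {f : Grass (k + m) k → ENNReal} (hf : Measurable f) :
    fibreVolume k m Set.univ * ∫⁻ g, f g ∂grassVolume (k + m) k ≤
      ∫⁻ W, f (planeOf W) ∂orthogonalVolume (k + m) := by
  by_cases hzero : grassVolume (k + m) k Set.univ = 0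
  · rw [Measure.measure_univ_eq_zero.1 hzero]
    simp
  · rw [← ENNReal.mul_le_mul_iff_right hzero (measure_ne_top _ _),
      grassVolume_univ_mul_lintegral_planeOf hf, ← mul_assoc]
    gcongr
    exact grassVolume_mul_fibreVolume_le

end Fibration

section LocalSolution

open Matrix Topology
open scoped Kronecker

attribute [local instance] Matrix.frobeniusNormedAddCommGroup Matrix.frobeniusNormedSpace
  Matrix.frobeniusNormedRing Matrix.frobeniusNormedAlgebra

section GapMat

variable {ι κ : Type*} [Fintype ι] [Fintype κ] [DecidableEq ι] [DecidableEq κ]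

/-- The matrix of the operator `X ↦ X - d X a⁻¹`: the first-order equation relating a small
rotation of `finBlocks a b 0 d` to the displacement of its fixed plane. -/
def gapMat (a : Matrix ι ι ℝ) (d : Matrix κ κ ℝ) : Matrix (ι × κ) (ι × κ) ℝ := 1 - (a⁻¹)ᵀ ⊗ₖ d

theorem gapMat_mulVec_vec (a : Matrix ι ι ℝ) (d : Matrix κ κ ℝ) (X : Matrix κ ι ℝ) :
    gapMat a d *ᵥ X.vec = (X - d * X * a⁻¹).vec := by
  rw [gapMat, sub_mulVec, one_mulVec, kronecker_mulVec_vec, transpose_transpose, vec_sub]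

theorem det_sylvesterOperator_ne_zero {a : Matrix ι ι ℝ} (ha : IsUnit a.det) {d : Matrix κ κ ℝ}
    (hgap : (gapMat a d).det ≠ 0) : (sylvesterOperator a d).det ≠ 0 := by
  have hsylv : sylvesterOperator a d = (aᵀ ⊗ₖ (1 : Matrix κ κ ℝ)) * gapMat a d := by
    rw [gapMat, Matrix.mul_sub, Matrix.mul_one, ← mul_kronecker_mul, ← transpose_mul,
      nonsing_inv_mul _ ha, transpose_one, Matrix.one_mul, sylvesterOperator]
  rw [hsylv, det_mul, det_kronecker, det_transpose, det_one, one_pow, mul_one]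
  exact mul_ne_zero (pow_ne_zero _ ha.ne_zero) hgap

theorem det_toEuclideanLin (M : Matrix ι ι ℝ) : LinearMap.det (toEuclideanLin M) = M.det := by
  rw [toEuclideanLin_eq_toLin_orthonormal, LinearMap.det_toLin]

end GapMat

variable {k m : ℕ}

theorem offMat_injective : Function.Injective (offMat k m) := by
  intro x y hxy
  ext p
  have hentry := congrFun (congrFun hxy p.2) p.1
  rw [offMat_apply, offMat_apply] at hentry
  exact mul_left_cancel₀ (by positivity) hentry

theorem vec_offMat (x : EuclideanSpace ℝ (Fin k × Fin m)) :
    (offMat k m x).vec = (√2)⁻¹ • x.ofLp := rfl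

theorem offMat_gapMat (a : Matrix (Fin k) (Fin k) ℝ) (d : Matrix (Fin m) (Fin m) ℝ)
    (x : EuclideanSpace ℝ (Fin k × Fin m)) :
    offMat k m (toEuclideanLin (gapMat a d) x) = offMat k m x - d * offMat k m x * a⁻¹ := by
  rw [← vec_inj, ← gapMat_mulVec_vec, vec_offMat, vec_offMat, mulVec_smul]
  rfl

theorem llBlock_offSkew_mul (a : Matrix (Fin k) (Fin k) ℝ) (b : Matrix (Fin k) (Fin m) ℝ)
    (d : Matrix (Fin m) (Fin m) ℝ) (x : EuclideanSpace ℝ (Fin k × Fin m)) :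
    llBlock (offSkew k m x * finBlocks a b 0 d) = offMat k m x * a := by
  simp [offSkew_apply, finBlocks_mul]

theorem llBlock_mul_offSkew (a : Matrix (Fin k) (Fin k) ℝ) (b : Matrix (Fin k) (Fin m) ℝ)
    (d : Matrix (Fin m) (Fin m) ℝ) (x : EuclideanSpace ℝ (Fin k × Fin m)) :
    llBlock (finBlocks a b 0 d * offSkew k m x) = d * offMat k m x := by
  simp [offSkew_apply, finBlocks_mul]

theorem exists_linearEquiv_offMat_mul {a : Matrix (Fin k) (Fin k) ℝ} (ha : IsUnit a.det) :
    ∃ T : EuclideanSpace ℝ (Fin k × Fin m) ≃ₗ[ℝ] Matrix (Fin m) (Fin k) ℝ,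
      ∀ x, T x = offMat k m x * a := by
  have hfinrank : Module.finrank ℝ (EuclideanSpace ℝ (Fin k × Fin m)) =
      Module.finrank ℝ (Matrix (Fin m) (Fin k) ℝ) := by
    simp [Module.finrank_matrix, mul_comm]
  exact ⟨LinearEquiv.ofInjectiveOfFinrankEq (mulRightLinearMap (Fin m) ℝ a ∘ₗ offMat k m)
    ((mul_left_injective_of_inv a a⁻¹ (mul_nonsing_inv a ha)).comp offMat_injective) hfinrank,
    fun _ => rfl⟩

/- To first order the displacement `x` of the fixed plane solves `x a - d x = y a`, where `y` is the
rotation; so rotating by `gapMat a d z` displaces the fixed plane by about `z`. -/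
theorem exists_llBlock_cayleyRot_conj_eq_zero {a : Matrix (Fin k) (Fin k) ℝ} (ha : IsUnit a.det)
    (b : Matrix (Fin k) (Fin m) ℝ) {d : Matrix (Fin m) (Fin m) ℝ} (hgap : (gapMat a d).det ≠ 0)
    {ε : ℝ} (hε : 0 < ε) :
    ∃ r > 0, ∀ z ∈ Metric.closedBall (0 : EuclideanSpace ℝ (Fin k × Fin m)) r,
      ∃ x : EuclideanSpace ℝ (Fin k × Fin m), ‖x - z‖ ≤ ε * ‖z‖ ∧
        llBlock ((cayleyRot x).1ᵀ *
          ((cayleyRot (toEuclideanLin (gapMat a d) z)).1 * finBlocks a b 0 d) *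
          (cayleyRot x).1) = 0 := by
  let L := (toEuclideanLin (gapMat a d)).equivOfDetNeZero (by rwa [det_toEuclideanLin])
  have hL (x) : L x = toEuclideanLin (gapMat a d) x := rfl
  obtain ⟨T, hT⟩ := exists_linearEquiv_offMat_mul (m := m) ha
  obtain ⟨r, hr, hsol⟩ := exists_solution_cayley (offSkew k m) (offSkew k m ∘ₗ L.toLinearMap)
    (llBlock (k := k) (m := m)) (finBlocks a b 0 d) (llBlock_finBlocks ..) (L.trans T)
    (fun x => by
      rw [map_sub, llBlock_offSkew_mul, llBlock_mul_offSkew, LinearEquiv.trans_apply, hT, hL,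
        offMat_gapMat, Matrix.sub_mul, Matrix.mul_assoc _ a⁻¹, nonsing_inv_mul _ ha,
        Matrix.mul_one])
    (fun y => by
      rw [LinearEquiv.trans_apply, hT, LinearMap.comp_apply, llBlock_offSkew_mul]; rfl) hε
  refine ⟨r, hr, fun z hz => ?_⟩
  obtain ⟨x, hxz, hzero⟩ := hsol z hz
  refine ⟨x, hxz, ?_⟩
  rw [transpose_cayleyRot, ← Matrix.mul_assoc]
  exact hzero

theorem continuous_llBlock : Continuous fun M : Matrix (Fin (k + m)) (Fin (k + m)) ℝ =>
    llBlock M :=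
  continuous_pi fun _ => continuous_pi fun _ => continuous_id.matrix_elem _ _

theorem continuous_det_sylvesterOperator :
    Continuous fun M : Matrix (Fin (k + m)) (Fin (k + m)) ℝ =>
    (sylvesterOperator (ulBlock M) (lrBlock M)).det := by
  refine Continuous.matrix_det (continuous_pi fun i => continuous_pi fun j => ?_)
  simp only [sylvesterOperator, Matrix.sub_apply]
  exact ((continuous_id.matrix_elem _ _).mul continuous_const).sub
    (continuous_const.mul (continuous_id.matrix_elem _ _))

theorem eventually_det_sylvesterOperator_cayleyRot_conj_ne_zero
    {B : Matrix (Fin (k + m)) (Fin (k + m)) ℝ}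
    (hB : (sylvesterOperator (ulBlock B) (lrBlock B)).det ≠ 0)
    (L : EuclideanSpace ℝ (Fin k × Fin m) →ₗ[ℝ] EuclideanSpace ℝ (Fin k × Fin m)) :
    ∀ᶠ p : EuclideanSpace ℝ (Fin k × Fin m) × EuclideanSpace ℝ (Fin k × Fin m) in 𝓝 0,
      (sylvesterOperator (ulBlock ((cayleyRot p.1).1ᵀ *
          ((cayleyRot (L p.2)).1 * B) * (cayleyRot p.1).1))
        (lrBlock ((cayleyRot p.1).1ᵀ *
          ((cayleyRot (L p.2)).1 * B) * (cayleyRot p.1).1))).det ≠ 0 := by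
  have hrot : Continuous fun x : EuclideanSpace ℝ (Fin k × Fin m) => (cayleyRot x).1 :=
    continuous_subtype_val.comp continuous_cayleyRot
  have hconj : Continuous
      fun p : EuclideanSpace ℝ (Fin k × Fin m) × EuclideanSpace ℝ (Fin k × Fin m) =>
        (cayleyRot p.1).1ᵀ * ((cayleyRot (L p.2)).1 * B) * (cayleyRot p.1).1 :=
    ((hrot.comp continuous_fst).matrix_transpose.matrix_mul
      ((hrot.comp (L.continuous_of_finiteDimensional.comp continuous_snd)).matrix_mul
        continuous_const)).matrix_mul (hrot.comp continuous_fst)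
  refine (continuous_det_sylvesterOperator.comp hconj).continuousAt.eventually_ne ?_
  simpa [cayleyRot_zero] using hB

theorem exists_isGoodFrame_near {a : Matrix (Fin k) (Fin k) ℝ} (ha : IsUnit a.det)
    (b : Matrix (Fin k) (Fin m) ℝ) {d : Matrix (Fin m) (Fin m) ℝ} (hgap : (gapMat a d).det ≠ 0)
    {ε : ℝ} (hε : 0 < ε) :
    ∃ ρ > 0, ∀ δ, 0 < δ → δ ≤ ρ → ∀ z ∈ Metric.closedBall 0 ((1 - ε) * δ),
      ∃ x ∈ Metric.closedBall (0 : EuclideanSpace ℝ (Fin k × Fin m)) δ,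
        IsGoodFrame ((cayleyRot (toEuclideanLin (gapMat a d) z)).1 * finBlocks a b 0 d)
          (cayleyRot x) := by
  obtain ⟨r, hr, hsol⟩ := exists_llBlock_cayleyRot_conj_eq_zero ha b hgap hε
  have hB : (sylvesterOperator (ulBlock (finBlocks a b 0 d))
      (lrBlock (finBlocks a b 0 d))).det ≠ 0 := by
    rw [ulBlock_finBlocks, lrBlock_finBlocks]
    exact det_sylvesterOperator_ne_zero ha hgap
  obtain ⟨s, hs, hdet⟩ := Metric.nhds_basis_closedBall.eventually_iff.1
    (eventually_det_sylvesterOperator_cayleyRot_conj_ne_zero hB (toEuclideanLin (gapMat a d)))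
  refine ⟨min r s, lt_min hr hs, fun δ hδ hδρ z hz => ?_⟩
  rw [mem_closedBall_zero_iff] at hz
  have hzδ : ‖z‖ ≤ δ := hz.trans (by nlinarith)
  obtain ⟨x, hxz, hzero⟩ :=
    hsol z (mem_closedBall_zero_iff.2 (hzδ.trans (hδρ.trans (min_le_left r s))))
  have hxδ : ‖x‖ ≤ δ :=
    calc ‖x‖ ≤ ‖x - z‖ + ‖z‖ := norm_le_norm_sub_add x z
      _ ≤ (1 + ε) * ‖z‖ := by linarith
      _ ≤ (1 + ε) * ((1 - ε) * δ) := by gcongr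
      _ ≤ δ := by nlinarith [sq_nonneg ε]
  refine ⟨x, mem_closedBall_zero_iff.2 hxδ, hzero, hdet (x := (x, z)) ?_⟩
  rw [mem_closedBall_zero_iff]
  exact (max_le hxδ hzδ).trans (hδρ.trans (min_le_right r s))

end LocalSolution

section Measurability

theorem measurableSet_image_pos {Z Y : Type*} [TopologicalSpace Z] [TopologicalSpace Y]
    [T2Space Y] [MeasurableSpace Y] [OpensMeasurableSpace Y] {f : Z → Y} (hf : Continuous f)
    {K : Set Z} (hK : IsCompact K) {g : Z → ℝ} (hg : Continuous g) :
    MeasurableSet (f '' {z | z ∈ K ∧ 0 < g z}) := by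
  have hunion : f '' {z | z ∈ K ∧ 0 < g z} =
      ⋃ n : ℕ, f '' (K ∩ {z | 1 / ((n : ℝ) + 1) ≤ g z}) := by
    rw [← Set.image_iUnion]
    congr 1
    ext z
    simp only [Set.mem_ofPred_eq, Set.mem_iUnion, Set.mem_inter_iff]
    constructor
    · rintro ⟨hz, hpos⟩
      obtain ⟨n, hn⟩ := exists_nat_one_div_lt hpos
      exact ⟨n, hz, hn.le⟩
    · rintro ⟨n, hz, hn⟩
      exact ⟨hz, Nat.one_div_pos_of_nat.trans_le hn⟩
  rw [hunion]
  exact MeasurableSet.iUnion fun n =>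
    ((hK.inter_right (isClosed_le continuous_const hg)).image hf).measurableSet

open Matrix

variable {k m : ℕ}

theorem measurableSet_image_isGoodFrame {Z Y : Type*} [TopologicalSpace Z] [TopologicalSpace Y]
    [T2Space Y] [MeasurableSpace Y] [OpensMeasurableSpace Y] {f : Z → Y} (hf : Continuous f)
    {K : Set Z} (hK : IsCompact K) {M : Z → Matrix (Fin (k + m)) (Fin (k + m)) ℝ}
    (hM : Continuous M) {W : Z → orthogonalGroup (Fin (k + m)) ℝ} (hW : Continuous W) :
    MeasurableSet (f '' {z | z ∈ K ∧ IsGoodFrame (M z) (W z)}) := by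
  have hcoe : Continuous fun z => (W z).1 := continuous_subtype_val.comp hW
  have hconj : Continuous fun z => (W z).1ᵀ * M z * (W z).1 :=
    (hcoe.matrix_transpose.matrix_mul hM).matrix_mul hcoe
  have himage := measurableSet_image_pos hf
    (hK.inter_right (isClosed_eq (continuous_llBlock.comp hconj) (continuous_const (y := 0))))
    (continuous_det_sylvesterOperator.comp hconj).abs
  convert himage using 3
  simp only [IsGoodFrame, Set.mem_inter_iff, Set.mem_ofPred_eq, Function.comp, abs_pos,
    and_assoc]

end Measurability

section LocalCount

open Matrix Topology Filter
open scoped Kronecker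

theorem IsAsymptoticIsometry.measure_image_closedBall_ne_zero {E X : Type*} [NormedAddCommGroup E]
    [InnerProductSpace ℝ E] [FiniteDimensional ℝ E] [MeasurableSpace E] [BorelSpace E]
    [MetricSpace X] [MeasurableSpace X] [BorelSpace X] {f : E → X} (hf : IsAsymptoticIsometry f)
    {d : ℕ} (hd : Module.finrank ℝ E = d) {δ : ℝ} (hδ : 0 < δ) :
    μHE[d] (f '' Metric.closedBall 0 δ) ≠ 0 := by
  obtain ⟨r, hr, -, -, hmeas⟩ := hf.exists_measure_image hd one_half_pos
  have hlower := (hmeas (Metric.closedBall 0 (min r δ))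
    (Metric.closedBall_subset_closedBall (min_le_left r δ))).1
  refine ((ENNReal.mul_pos ?_ ?_).trans_le (hlower.trans (measure_mono (Set.image_mono
    (Metric.closedBall_subset_closedBall (min_le_right r δ)))))).ne'
  · rw [Ne, ENNReal.ofReal_eq_zero]
    norm_num
  · exact (Metric.measure_closedBall_pos volume 0 (lt_min hr hδ)).ne'

theorem orthogonalVolume_univ_ne_zero (n : ℕ) : orthogonalVolume n Set.univ ≠ 0 := fun h =>
  isAsymptoticIsometry_cayleyChart.measure_image_closedBall_ne_zero finrank_euclideanSpace_ltPair
    one_pos (measure_mono_null (Set.subset_univ _) h)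

theorem fibreVolume_univ_ne_zero (k m : ℕ) : fibreVolume k m Set.univ ≠ 0 := by
  rw [← Set.univ_prod_univ, Measure.prod_prod]
  exact mul_ne_zero (orthogonalVolume_univ_ne_zero k) (orthogonalVolume_univ_ne_zero m)

theorem grassVolume_univ_ne_zero (k m : ℕ) : grassVolume (k + m) k Set.univ ≠ 0 := fun h =>
  isAsymptoticIsometry_grassChart.measure_image_closedBall_ne_zero finrank_euclideanSpace_grass
    one_pos (measure_mono_null (Set.subset_univ _) h)

theorem eventually_image_closedBall_subset_closedBall {E F : Type*} [SeminormedAddCommGroup E]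
    [SeminormedAddCommGroup F] {f : E → F} (hf : ContinuousAt f 0) (hf0 : f 0 = 0) (c : ℝ)
    {r : ℝ} (hr : 0 < r) :
    ∀ᶠ δ in 𝓝 (0 : ℝ), f '' Metric.closedBall 0 (c * δ) ⊆ Metric.closedBall 0 r := by
  have hpre : f ⁻¹' Metric.closedBall 0 r ∈ 𝓝 0 :=
    hf.preimage_mem_nhds (by rw [hf0]; exact Metric.closedBall_mem_nhds 0 hr)
  obtain ⟨s, hs, hball⟩ := Metric.nhds_basis_closedBall.mem_iff.1 hpre
  have hc : Tendsto (fun δ : ℝ => c * δ) (𝓝 0) (𝓝 0) := by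
    simpa using (tendsto_id (α := ℝ) (x := 𝓝 0)).const_mul c
  filter_upwards [hc.eventually_le_const hs] with δ hδ
  exact Set.image_subset_iff.2 ((Metric.closedBall_subset_closedBall hδ).trans hball)

variable {k m : ℕ}

/-- The rotations `U` for which `U A` has a good frame in the `δ`-ball of the chart. -/
def goodRotations (A : Matrix (Fin (k + m)) (Fin (k + m)) ℝ) (δ : ℝ) :
    Set (orthogonalGroup (Fin (k + m)) ℝ) :=
  {U | ∃ x ∈ Metric.closedBall (0 : EuclideanSpace ℝ (Fin k × Fin m)) δ,
    IsGoodFrame (U.1 * A) (cayleyRot x)}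

theorem measurableSet_goodRotations (A : Matrix (Fin (k + m)) (Fin (k + m)) ℝ) (δ : ℝ) :
    MeasurableSet (goodRotations A δ) := by
  have himage := measurableSet_image_isGoodFrame (k := k) (m := m)
    (Z := EuclideanSpace ℝ (Fin k × Fin m) × orthogonalGroup (Fin (k + m)) ℝ)
    continuous_snd ((isCompact_closedBall 0 δ).prod isCompact_univ)
    ((continuous_subtype_val.comp continuous_snd).matrix_mul (continuous_const (y := A)))
    (continuous_cayleyRot.comp continuous_fst)
  convert himage using 1
  ext U
  simp [goodRotations, and_assoc]

/-- The pairs `(g, h)` of a plane in the `R`-ball of the chart and an element of the fibre whose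
product has a good frame in the `δ`-ball: `goodRotations` in the local trivialization of
`planeOf`. -/
def goodLocalPairs (A : Matrix (Fin (k + m)) (Fin (k + m)) ℝ) (R δ : ℝ) :
    Set (Grass (k + m) k × (orthogonalGroup (Fin k) ℝ × orthogonalGroup (Fin m) ℝ)) :=
  {q | ∃ x ∈ Metric.closedBall (0 : EuclideanSpace ℝ (Fin k × Fin m)) δ,
    ∃ y ∈ Metric.closedBall 0 R, grassChart y = q.1 ∧
      IsGoodFrame ((cayleyRot y).1 * ((blockOrthogonal q.2).1 * A)) (cayleyRot x)}

theorem measurableSet_goodLocalPairs (A : Matrix (Fin (k + m)) (Fin (k + m)) ℝ) (R δ : ℝ) :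
    MeasurableSet (goodLocalPairs A R δ) := by
  let Z := EuclideanSpace ℝ (Fin k × Fin m) ×
    (EuclideanSpace ℝ (Fin k × Fin m) × (orthogonalGroup (Fin k) ℝ × orthogonalGroup (Fin m) ℝ))
  have hy : Continuous fun p : Z => p.2.1 := continuous_fst.comp continuous_snd
  have hh : Continuous fun p : Z => p.2.2 := continuous_snd.comp continuous_snd
  have himage := measurableSet_image_isGoodFrame (Z := Z)
    (((continuous_grassChart (m := m)).comp hy).prodMk hh)
    ((isCompact_closedBall 0 δ).prod ((isCompact_closedBall 0 R).prod isCompact_univ))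
    ((continuous_subtype_val.comp (continuous_cayleyRot.comp hy)).matrix_mul
      ((continuous_subtype_val.comp (continuous_blockOrthogonal.comp hh)).matrix_mul
        (continuous_const (y := A))))
    (continuous_cayleyRot.comp continuous_fst)
  convert himage using 1
  ext ⟨g, h⟩
  constructor
  · rintro ⟨x, hx, y, hy, hg, hgood⟩
    exact ⟨(x, y, h), ⟨⟨hx, hy, Set.mem_univ _⟩, hgood⟩, Prod.ext hg rfl⟩
  · rintro ⟨⟨x, y, h'⟩, ⟨⟨hx, hy, -⟩, hgood⟩, heq⟩
    obtain ⟨hg, rfl⟩ := Prod.ext_iff.1 heq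
    exact ⟨x, hx, y, hy, hg, hgood⟩

theorem blockOrthogonal_mul_eq_finBlocks {A : Matrix (Fin (k + m)) (Fin (k + m)) ℝ}
    (hA : llBlock A = 0)
    (h : orthogonalGroup (Fin k) ℝ × orthogonalGroup (Fin m) ℝ) :
    (blockOrthogonal h).1 * A =
      finBlocks (h.1.1 * ulBlock A) (h.1.1 * urBlock A) 0 (h.2.1 * lrBlock A) := by
  conv_lhs => rw [← finBlocks_blocks A, hA]
  change finBlocks _ _ _ _ * finBlocks _ _ _ _ = _
  simp [finBlocks_mul]

section Slice

variable {A : Matrix (Fin (k + m)) (Fin (k + m)) ℝ} (hA : llBlock A = 0)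
  (ha : IsUnit (ulBlock A).det) (h : orthogonalGroup (Fin k) ℝ × orthogonalGroup (Fin m) ℝ)
  (hgap : (gapMat (h.1.1 * ulBlock A) (h.2.1 * lrBlock A)).det ≠ 0) {R : ℝ} (hR : 0 < R) {ε : ℝ}

include hA ha hgap hR

theorem eventually_grassChart_image_subset_goodLocalPairs (hε : 0 < ε) :
    ∀ᶠ δ in 𝓝[>] 0, grassChart '' (toEuclideanLin (gapMat (h.1.1 * ulBlock A)
        (h.2.1 * lrBlock A)) '' Metric.closedBall 0 ((1 - ε) * δ)) ⊆
      (fun g => (g, h)) ⁻¹' goodLocalPairs A R δ := by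
  obtain ⟨ρ, hρ, hgood⟩ := exists_isGoodFrame_near
    (by rw [det_mul]; exact (UnitaryGroup.det_isUnit h.1).mul ha) (h.1.1 * urBlock A) hgap hε
  have hsmall := eventually_image_closedBall_subset_closedBall
    (LinearMap.continuous_of_finiteDimensional _).continuousAt (map_zero (toEuclideanLin
      (gapMat (h.1.1 * ulBlock A) (h.2.1 * lrBlock A)))) (1 - ε) hR
  filter_upwards [nhdsWithin_le_nhds hsmall, Ioc_mem_nhdsGT hρ] with δ hδR hδρ
  rintro _ ⟨_, ⟨z, hz, rfl⟩, rfl⟩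
  obtain ⟨x, hx, hframe⟩ := hgood δ hδρ.1 hδρ.2 z hz
  refine ⟨x, hx, _, hδR ⟨z, hz, rfl⟩, rfl, ?_⟩
  rwa [blockOrthogonal_mul_eq_finBlocks hA]

theorem eventually_ofReal_mul_le_grassVolume_goodLocalPairs (hε : 0 < ε) (hε1 : ε < 1) :
    ∀ᶠ δ in 𝓝[>] 0, ENNReal.ofReal ((1 - ε) ^ (k * m + 1) *
        |(gapMat (h.1.1 * ulBlock A) (h.2.1 * lrBlock A)).det|) *
        volume (Metric.closedBall (0 : EuclideanSpace ℝ (Fin k × Fin m)) δ) ≤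
      grassVolume (k + m) k ((fun g => (g, h)) ⁻¹' goodLocalPairs A R δ) := by
  obtain ⟨r, hr, -, -, hmeas⟩ := (isAsymptoticIsometry_grassChart (k := k)
    (m := m)).exists_measure_image finrank_euclideanSpace_grass hε
  have hsmall := eventually_image_closedBall_subset_closedBall
    (LinearMap.continuous_of_finiteDimensional _).continuousAt (map_zero (toEuclideanLin
      (gapMat (h.1.1 * ulBlock A) (h.2.1 * lrBlock A)))) (1 - ε) hr
  filter_upwards [eventually_grassChart_image_subset_goodLocalPairs hA ha h hgap hR hε,
    nhdsWithin_le_nhds hsmall, self_mem_nhdsWithin] with δ hsub hδr (hδ : 0 < δ)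
  have hlower := (hmeas _ hδr).1
  rw [Measure.addHaar_image_linearMap, det_toEuclideanLin,
    Measure.addHaar_closedBall_mul volume _ (by linarith) hδ.le, finrank_euclideanSpace,
    Fintype.card_prod, Fintype.card_fin, Fintype.card_fin] at hlower
  refine le_trans (le_of_eq ?_) (hlower.trans (measure_mono hsub))
  rw [ENNReal.ofReal_mul (by bound), pow_succ', ENNReal.ofReal_mul (by linarith)]
  ring

theorem ofReal_div_le_liminf_goodLocalPairs (hε : 0 < ε) (hε1 : ε < 1) :
    ENNReal.ofReal ((1 - ε) ^ (k * m + 1) *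
        |(gapMat (h.1.1 * ulBlock A) (h.2.1 * lrBlock A)).det| / (1 + ε)) ≤
      liminf (fun δ => grassVolume (k + m) k ((fun g => (g, h)) ⁻¹' goodLocalPairs A R δ) /
        grassVolume (k + m) k (grassChart '' Metric.closedBall 0 δ)) (𝓝[>] 0) := by
  obtain ⟨r, hr, -, -, hmeas⟩ := (isAsymptoticIsometry_grassChart (k := k)
    (m := m)).exists_measure_image finrank_euclideanSpace_grass hε
  refine le_liminf_of_le (by isBoundedDefault) ?_
  filter_upwards [eventually_ofReal_mul_le_grassVolume_goodLocalPairs hA ha h hgap hR hε hε1,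
    Ioc_mem_nhdsGT hr] with δ hlower hδ
  rw [ENNReal.ofReal_div_of_pos (by linarith), ← ENNReal.mul_div_mul_right _ _
    (Metric.measure_closedBall_pos volume (0 : EuclideanSpace ℝ (Fin k × Fin m)) hδ.1).ne'
    measure_closedBall_lt_top.ne]
  exact ENNReal.div_le_div hlower (hmeas _ (Metric.closedBall_subset_closedBall hδ.2)).2

end Slice

theorem ofReal_abs_det_gapMat_le_liminf_goodLocalPairs {A : Matrix (Fin (k + m)) (Fin (k + m)) ℝ}
    (hA : llBlock A = 0) (ha : IsUnit (ulBlock A).det) {R : ℝ} (hR : 0 < R)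
    (h : orthogonalGroup (Fin k) ℝ × orthogonalGroup (Fin m) ℝ) :
    ENNReal.ofReal |(gapMat (h.1.1 * ulBlock A) (h.2.1 * lrBlock A)).det| ≤
      liminf (fun δ => grassVolume (k + m) k ((fun g => (g, h)) ⁻¹' goodLocalPairs A R δ) /
        grassVolume (k + m) k (grassChart '' Metric.closedBall 0 δ)) (𝓝[>] 0) := by
  by_cases hgap : (gapMat (h.1.1 * ulBlock A) (h.2.1 * lrBlock A)).det = 0
  · simp [hgap]
  have hcont : ContinuousAt (fun ε : ℝ => ENNReal.ofReal ((1 - ε) ^ (k * m + 1) *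
      |(gapMat (h.1.1 * ulBlock A) (h.2.1 * lrBlock A)).det| / (1 + ε))) 0 :=
    ENNReal.continuous_ofReal.continuousAt.comp
      (ContinuousAt.div (by fun_prop) (by fun_prop) (by norm_num))
  have hlim := hcont.tendsto.mono_left (nhdsWithin_le_nhds (s := Set.Ioi 0))
  simp only [sub_zero, one_pow, one_mul, add_zero, div_one] at hlim
  refine le_of_tendsto hlim ?_
  filter_upwards [Ioo_mem_nhdsGT one_pos] with ε hε
  exact ofReal_div_le_liminf_goodLocalPairs hA ha h hgap hR hε.1 hε.2

theorem gapMat_orthogonal_mul {ι κ : Type*} [Fintype ι] [DecidableEq ι] [DecidableEq κ]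
    (u : orthogonalGroup ι ℝ) (a : Matrix ι ι ℝ) (d : Matrix κ κ ℝ) :
    gapMat (u.1 * a) d = 1 - (u.1 * (a⁻¹)ᵀ) ⊗ₖ d := by
  rw [gapMat, Matrix.mul_inv_rev, transpose_mul,
    inv_eq_left_inv (orthogonalGroup_transpose_mul_self u), transpose_transpose]

theorem fibreVolume_univ_le_lintegral_abs_det_gapMat {a : Matrix (Fin k) (Fin k) ℝ}
    (ha : IsUnit a.det) {d : Matrix (Fin m) (Fin m) ℝ} (hd : IsUnit d.det) :
    fibreVolume k m Set.univ ≤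
      ∫⁻ h, ENNReal.ofReal |(gapMat (h.1.1 * a) (h.2.1 * d)).det| ∂fibreVolume k m := by
  simp_rw [gapMat_orthogonal_mul]
  rw [← Set.univ_prod_univ, Measure.prod_prod]
  refine measure_univ_mul_measure_univ_le_lintegral_abs_det _ _ ?_ hd
  rw [det_transpose]
  exact isUnit_nonsing_inv_det a ha

theorem fibreVolume_goodLocalPairs_le (A : Matrix (Fin (k + m)) (Fin (k + m)) ℝ) {R δ : ℝ}
    (hinj : Set.InjOn (grassChart : _ → Grass (k + m) k) (Metric.closedBall 0 R))
    (U : orthogonalGroup (Fin (k + m)) ℝ) :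
    fibreVolume k m (Prod.mk (planeOf U) ⁻¹' goodLocalPairs A R δ) ≤
      fibreVolume k m ((fun h => U * blockOrthogonal h) ⁻¹' goodRotations A δ) := by
  by_cases hU : planeOf U ∈ (grassChart : _ → Grass (k + m) k) '' Metric.closedBall 0 R
  · obtain ⟨y, hy, hyU⟩ := hU
    obtain ⟨b, rfl⟩ := exists_eq_mul_blockOrthogonal hyU
    rw [← measure_preimage_mul (fibreVolume k m) b]
    refine measure_mono ?_
    rintro h ⟨x, hx, y', hy', hplane, hgood⟩
    obtain rfl := hinj hy' hy (hplane.trans hyU.symm)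
    refine ⟨x, hx, ?_⟩
    change IsGoodFrame ((cayleyRot y' * blockOrthogonal b * blockOrthogonal h).1 * A) (cayleyRot x)
    rwa [mul_assoc, ← blockOrthogonal_mul, Submonoid.coe_mul, Matrix.mul_assoc]
  · have hempty : Prod.mk (planeOf U : Grass (k + m) k) ⁻¹' goodLocalPairs A R δ = ∅ :=
      Set.eq_empty_iff_forall_notMem.2 fun h ⟨_, _, y, hy, hplane, _⟩ => hU ⟨y, hy, hplane⟩
    simp [hempty]

theorem orthogonalVolume_univ_mul_lintegral_goodLocalPairs_le
    (A : Matrix (Fin (k + m)) (Fin (k + m)) ℝ) {R δ : ℝ}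
    (hinj : Set.InjOn (grassChart : _ → Grass (k + m) k) (Metric.closedBall 0 R)) :
    orthogonalVolume (k + m) Set.univ *
        ∫⁻ h, grassVolume (k + m) k ((fun g => (g, h)) ⁻¹' goodLocalPairs A R δ) ∂fibreVolume k m ≤
      grassVolume (k + m) k Set.univ *
        (fibreVolume k m Set.univ * orthogonalVolume (k + m) (goodRotations A δ)) := by
  have hnear := measurableSet_goodLocalPairs A R δ
  have hrot := measurableSet_goodRotations A δ
  rw [← Measure.prod_apply_symm hnear, Measure.prod_apply hnear,
    ← grassVolume_univ_mul_lintegral_planeOf (measurable_measure_prodMk_left hnear),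
    ← lintegral_indicator_one hrot,
    ← lintegral_lintegral_mul_blockOrthogonal (measurable_one.indicator hrot)]
  gcongr with U
  refine (fibreVolume_goodLocalPairs_le A hinj U).trans_eq (lintegral_indicator_one ?_).symm
  exact (continuous_const.mul (continuous_blockOrthogonal (k := k) (m := m))).measurable hrot

theorem lintegral_goodLocalPairs_div_le (A : Matrix (Fin (k + m)) (Fin (k + m)) ℝ) {R : ℝ}
    (hinj : Set.InjOn (grassChart : _ → Grass (k + m) k) (Metric.closedBall 0 R)) (δ : ℝ) :
    ∫⁻ h, grassVolume (k + m) k ((fun g => (g, h)) ⁻¹' goodLocalPairs A R δ) /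
        grassVolume (k + m) k (grassChart '' Metric.closedBall 0 δ) ∂fibreVolume k m ≤
      fibreVolume k m Set.univ * (orthogonalVolume (k + m) (goodRotations A δ) /
        orthogonalVolume (k + m) ((planeOf : _ → Grass (k + m) k) ⁻¹'
          (grassChart '' Metric.closedBall 0 δ))) := by
  simp_rw [div_eq_mul_inv]
  rw [lintegral_mul_const _ (measurable_measure_prodMk_right (measurableSet_goodLocalPairs A R δ)),
    ← div_eq_mul_inv, ← div_eq_mul_inv, ← mul_div_assoc,
    ← ENNReal.mul_div_mul_left _ _ (orthogonalVolume_univ_ne_zero (k + m)) (measure_ne_top _ _),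
    ← grassVolume_univ_mul_measure_planeOf_preimage
      ((isCompact_closedBall 0 δ).image continuous_grassChart).measurableSet,
    ← ENNReal.mul_div_mul_left (_ * orthogonalVolume (k + m) (goodRotations A δ)) _
      (grassVolume_univ_ne_zero k m) (measure_ne_top _ _)]
  exact ENNReal.div_le_div_right (orthogonalVolume_univ_mul_lintegral_goodLocalPairs_le A hinj) _

theorem one_le_liminf_goodRotations_of_llBlock {A : Matrix (Fin (k + m)) (Fin (k + m)) ℝ}
    (hA : IsUnit A.det) (hll : llBlock A = 0) :
    1 ≤ liminf (fun δ => orthogonalVolume (k + m) (goodRotations A δ) /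
      orthogonalVolume (k + m) ((planeOf : _ → Grass (k + m) k) ⁻¹'
        (grassChart '' Metric.closedBall 0 δ))) (𝓝[>] 0) := by
  obtain ⟨ha, hd⟩ : IsUnit (ulBlock A).det ∧ IsUnit (lrBlock A).det := by
    rw [← finBlocks_blocks A, hll, det_finBlocks_zero] at hA
    exact IsUnit.mul_iff.1 hA
  obtain ⟨R, hR, hinj, -, -⟩ := (isAsymptoticIsometry_grassChart (k := k)
    (m := m)).exists_measure_image finrank_euclideanSpace_grass one_pos
  rw [← ENNReal.mul_le_mul_iff_right (fibreVolume_univ_ne_zero k m) (measure_ne_top _ _), mul_one,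
    ← ENNReal.liminf_const_mul_of_ne_top (measure_ne_top _ _)]
  calc fibreVolume k m Set.univ
      ≤ ∫⁻ h, ENNReal.ofReal |(gapMat (h.1.1 * ulBlock A) (h.2.1 * lrBlock A)).det|
          ∂fibreVolume k m := fibreVolume_univ_le_lintegral_abs_det_gapMat ha hd
    _ ≤ ∫⁻ h, liminf (fun δ => grassVolume (k + m) k ((fun g => (g, h)) ⁻¹' goodLocalPairs A R δ) /
          grassVolume (k + m) k (grassChart '' Metric.closedBall 0 δ)) (𝓝[>] 0)
          ∂fibreVolume k m :=
        lintegral_mono fun h => ofReal_abs_det_gapMat_le_liminf_goodLocalPairs hll ha hR h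
    _ ≤ liminf (fun δ => ∫⁻ h, grassVolume (k + m) k ((fun g => (g, h)) ⁻¹' goodLocalPairs A R δ) /
          grassVolume (k + m) k (grassChart '' Metric.closedBall 0 δ) ∂fibreVolume k m)
          (𝓝[>] 0) :=
        lintegral_liminf_le fun δ =>
          (measurable_measure_prodMk_right (measurableSet_goodLocalPairs A R δ)).div_const _
    _ ≤ _ := liminf_le_liminf (Eventually.of_forall (lintegral_goodLocalPairs_div_le A hinj))

theorem isUnit_det_orthogonal_mul {ι : Type*} [Fintype ι] [DecidableEq ι] {A : Matrix ι ι ℝ}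
    (hA : IsUnit A.det) (U : orthogonalGroup ι ℝ) : IsUnit (U.1 * A).det := by
  rw [det_mul]
  exact (UnitaryGroup.det_isUnit U).mul hA

theorem exists_orthogonal_llBlock_eq_zero {A : Matrix (Fin (k + m)) (Fin (k + m)) ℝ}
    (hA : IsUnit A.det) : ∃ U : orthogonalGroup (Fin (k + m)) ℝ,
      llBlock (k := k) (m := m) (U.1 * A) = 0 := by
  let image : Grass (k + m) k := ⟨(planeOf 1).space.map (toEuclideanLin A), by
    rw [← (Submodule.equivMapOfInjective _
      (toEuclideanLin_injective_of_isUnit_det hA) _).finrank_eq, Grass.finrank_eq]⟩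
  obtain ⟨W, hW⟩ := planeOf_surjective image
  have hrot : rotGrass W⁻¹ image = planeOf 1 := by
    rw [← hW, rotGrass_planeOf, inv_mul_cancel]
  have hfixed : (planeOf 1 : Grass (k + m) k) ∈ fixedPlanes k (W⁻¹.1 * A) := by
    refine Eq.trans ?_ (congrArg Grass.space hrot)
    rw [toLpLin_mul_same, Submodule.map_comp]
    rfl
  refine ⟨W⁻¹, ?_⟩
  simpa using (planeOf_mem_fixedPlanes_iff (isUnit_det_orthogonal_mul hA W⁻¹) 1).1 hfixed

theorem preimage_mul_right_goodRotations (A : Matrix (Fin (k + m)) (Fin (k + m)) ℝ)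
    (V : orthogonalGroup (Fin (k + m)) ℝ) (δ : ℝ) :
    (fun U => U * V) ⁻¹' goodRotations (k := k) (m := m) A δ = goodRotations (V.1 * A) δ := by
  ext U
  simp only [goodRotations, Set.mem_preimage, Set.mem_ofPred_eq, Submonoid.coe_mul,
    Matrix.mul_assoc]

theorem one_le_liminf_goodRotations {A : Matrix (Fin (k + m)) (Fin (k + m)) ℝ} (hA : IsUnit A.det) :
    1 ≤ liminf (fun δ => orthogonalVolume (k + m) (goodRotations A δ) /
      orthogonalVolume (k + m) ((planeOf : _ → Grass (k + m) k) ⁻¹'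
        (grassChart '' Metric.closedBall 0 δ))) (𝓝[>] 0) := by
  obtain ⟨V, hV⟩ := exists_orthogonal_llBlock_eq_zero (k := k) (m := m) hA
  have hlim := one_le_liminf_goodRotations_of_llBlock (isUnit_det_orthogonal_mul hA V) hV
  simpa only [← preimage_mul_right_goodRotations, measure_preimage_mul_right] using hlim

end LocalCount

section FixedSup

open Matrix Topology Filter

variable {k m : ℕ} {φ : Grass (k + m) k → ℝ}

/-- The supremum of `φ` over the `k`-planes fixed by `M`, which is `0` if there are none;
`supFixed` is the case `φ = log⁺ |det M|_g|`. -/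
def fixedSup {n k : ℕ} (φ : Grass n k → ℝ) (M : Matrix (Fin n) (Fin n) ℝ) : ℝ :=
  ⨆ g : fixedPlanes k M, φ g

theorem le_fixedSup (hφ : Continuous φ) {M : Matrix (Fin (k + m)) (Fin (k + m)) ℝ}
    {g : Grass (k + m) k} (hg : g ∈ fixedPlanes k M) : φ g ≤ fixedSup φ M :=
  le_ciSup (f := fun g : fixedPlanes k M => φ g)
    ((isCompact_range hφ).bddAbove.mono (Set.range_comp_subset_range _ φ)) ⟨g, hg⟩

theorem fixedSup_nonneg {n k : ℕ} {φ : Grass n k → ℝ} (h0 : ∀ g, 0 ≤ φ g)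
    (M : Matrix (Fin n) (Fin n) ℝ) : 0 ≤ fixedSup φ M :=
  Real.iSup_nonneg fun g => h0 g

theorem lt_fixedSup_iff (hφ : Continuous φ) {M : Matrix (Fin (k + m)) (Fin (k + m)) ℝ} {c : ℝ}
    (hc : 0 ≤ c) : c < fixedSup φ M ↔ ∃ g ∈ fixedPlanes k M, c < φ g := by
  constructor
  · intro h
    by_contra! hle
    exact h.not_ge (Real.iSup_le (fun g => hle g.1 g.2) hc)
  · rintro ⟨g, hg, h⟩
    exact h.trans_le (le_fixedSup hφ hg)

theorem supFixed_orthogonal_mul {n k : ℕ} (A : Matrix (Fin n) (Fin n) ℝ)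
    (U : orthogonalGroup (Fin n) ℝ) :
    supFixed k (U.1 * A) =
      fixedSup (fun g : Grass n k => Real.posLog (absDetOn A g)) (U.1 * A) := by
  simp only [supFixed, fixedSup, absDetOn_orthogonal_mul]

theorem measurable_fixedSup (hφ : Continuous φ) (h0 : ∀ g, 0 ≤ φ g)
    {A : Matrix (Fin (k + m)) (Fin (k + m)) ℝ} (hA : IsUnit A.det) :
    Measurable fun U : orthogonalGroup (Fin (k + m)) ℝ => fixedSup φ (U.1 * A) := by
  refine measurable_of_Ioi fun c => ?_
  rcases lt_or_ge c 0 with hc | hc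
  · convert MeasurableSet.univ
    ext U
    simpa using hc.trans_le (fixedSup_nonneg h0 _)
  let Z := orthogonalGroup (Fin (k + m)) ℝ × orthogonalGroup (Fin (k + m)) ℝ
  have hfst : Continuous fun p : Z => p.1.1 := continuous_subtype_val.comp continuous_fst
  have hsnd : Continuous fun p : Z => p.2.1 := continuous_subtype_val.comp continuous_snd
  have hclosed :
      IsClosed {p : Z | llBlock (k := k) (m := m) (p.2.1ᵀ * (p.1.1 * A) * p.2.1) = 0} :=
    isClosed_eq (continuous_llBlock.comp ((hsnd.matrix_transpose.matrix_mul
      (hfst.matrix_mul continuous_const)).matrix_mul hsnd)) continuous_const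
  have himage := measurableSet_image_pos (f := fun p : Z => p.1) continuous_fst hclosed.isCompact
    ((hφ.comp (continuous_planeOf.comp continuous_snd)).sub (continuous_const (y := c)))
  convert himage using 1
  ext U
  rw [Set.mem_preimage, Set.mem_Ioi, lt_fixedSup_iff hφ hc]
  constructor
  · rintro ⟨g, hg, hlt⟩
    obtain ⟨W, rfl⟩ := planeOf_surjective g
    exact ⟨(U, W), ⟨(planeOf_mem_fixedPlanes_iff (isUnit_det_orthogonal_mul hA U) W).1 hg,
      sub_pos.2 hlt⟩, rfl⟩
  · rintro ⟨⟨U', W⟩, ⟨hW, hlt⟩, rfl⟩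
    exact ⟨planeOf W, (planeOf_mem_fixedPlanes_iff (isUnit_det_orthogonal_mul hA U') W).2 hW,
      sub_pos.1 hlt⟩

theorem integrable_fixedSup (hφ : Continuous φ) (h0 : ∀ g, 0 ≤ φ g)
    {A : Matrix (Fin (k + m)) (Fin (k + m)) ℝ} (hA : IsUnit A.det) :
    Integrable (fun U : orthogonalGroup (Fin (k + m)) ℝ => fixedSup φ (U.1 * A))
      (orthogonalVolume (k + m)) := by
  obtain ⟨C, hC⟩ := (isCompact_range hφ).bddAbove
  have hle : ∀ g, φ g ≤ C := fun g => hC ⟨g, rfl⟩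
  refine .of_bound (measurable_fixedSup hφ h0 hA).aestronglyMeasurable C (.of_forall fun U => ?_)
  rw [Real.norm_of_nonneg (fixedSup_nonneg h0 _)]
  exact Real.iSup_le (fun g => hle g) ((h0 (planeOf 1)).trans (hle _))

theorem eventually_sub_le_planeOf_mul_cayleyRot (hφ : Continuous φ) {ε : ℝ} (hε : 0 < ε) :
    ∀ᶠ x : EuclideanSpace ℝ (Fin k × Fin m) in 𝓝 0, ∀ V : orthogonalGroup (Fin (k + m)) ℝ,
      φ (planeOf V) - ε ≤ φ (planeOf (V * cayleyRot x)) := by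
  obtain ⟨θ, hθ, hφθ⟩ := Metric.uniformContinuous_iff.1
    (CompactSpace.uniformContinuous_of_continuous hφ) ε hε
  filter_upwards [(continuous_grassChart (k := k) (m := m)).continuousAt (x := 0)
    (Metric.ball_mem_nhds _ hθ)] with x hx V
  have hzero : (planeOf V : Grass (k + m) k) = rotGrass V (grassChart 0) := by
    rw [grassChart, rotGrass_planeOf, cayleyRot_zero, mul_one]
  have hdist : dist (planeOf V : Grass (k + m) k) (planeOf (V * cayleyRot x)) < θ := by
    rw [hzero, ← rotGrass_planeOf, dist_rotGrass, dist_comm]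
    exact hx
  linarith [(abs_lt.1 (hφθ hdist)).2]

/-- The pairs `(U, V)` for which `U A` has a good frame in the `δ`-ball of the chart at `V`. -/
def goodPairs (A : Matrix (Fin (k + m)) (Fin (k + m)) ℝ) (δ : ℝ) :
    Set (orthogonalGroup (Fin (k + m)) ℝ × orthogonalGroup (Fin (k + m)) ℝ) :=
  {p | ∃ x ∈ Metric.closedBall (0 : EuclideanSpace ℝ (Fin k × Fin m)) δ,
    IsGoodFrame (p.1.1 * A) (p.2 * cayleyRot x)}

theorem measurableSet_goodPairs (A : Matrix (Fin (k + m)) (Fin (k + m)) ℝ) (δ : ℝ) :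
    MeasurableSet (goodPairs A δ) := by
  let Z := EuclideanSpace ℝ (Fin k × Fin m) ×
    (orthogonalGroup (Fin (k + m)) ℝ × orthogonalGroup (Fin (k + m)) ℝ)
  have hU : Continuous fun p : Z => p.2.1.1 :=
    continuous_subtype_val.comp (continuous_fst.comp continuous_snd)
  have hV : Continuous fun p : Z => p.2.2 := continuous_snd.comp continuous_snd
  have himage := measurableSet_image_isGoodFrame (f := fun p : Z => p.2) continuous_snd
    ((isCompact_closedBall 0 δ).prod isCompact_univ) (hU.matrix_mul (continuous_const (y := A)))
    (hV.mul (continuous_cayleyRot.comp continuous_fst))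
  convert himage using 1
  ext p
  constructor
  · rintro ⟨x, hx, hgood⟩
    exact ⟨(x, p), ⟨⟨hx, Set.mem_univ _⟩, hgood⟩, rfl⟩
  · rintro ⟨⟨x, p'⟩, ⟨⟨hx, -⟩, hgood⟩, rfl⟩
    exact ⟨x, hx, hgood⟩

theorem measure_goodPairs_slice (A : Matrix (Fin (k + m)) (Fin (k + m)) ℝ) (δ : ℝ)
    (V : orthogonalGroup (Fin (k + m)) ℝ) :
    orthogonalVolume (k + m) ((fun U => (U, V)) ⁻¹' goodPairs (k := k) (m := m) A δ) =
      orthogonalVolume (k + m) (goodRotations (k := k) (m := m) (A * V.1) δ) := by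
  rw [← measure_preimage_mul (orthogonalVolume (k + m)) V⁻¹ (goodRotations (A * V.1) δ)]
  congr 1
  ext U
  simp only [goodPairs, goodRotations, Set.mem_preimage, Set.mem_ofPred_eq, isGoodFrame_mul_iff,
    Submonoid.coe_mul, orthogonalGroup_coe_inv, Matrix.mul_assoc]

theorem measurable_measure_goodRotations_mul (A : Matrix (Fin (k + m)) (Fin (k + m)) ℝ) (δ : ℝ) :
    Measurable fun V : orthogonalGroup (Fin (k + m)) ℝ =>
      orthogonalVolume (k + m) (goodRotations (k := k) (m := m) (A * V.1) δ) := by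
  simp only [← measure_goodPairs_slice]
  exact measurable_measure_prodMk_right (measurableSet_goodPairs A δ)

theorem measure_rotGrass_inv_mem (S : Set (Grass (k + m) k)) (g : Grass (k + m) k) :
    orthogonalVolume (k + m) {V | rotGrass V⁻¹ g ∈ S} =
      orthogonalVolume (k + m) (planeOf ⁻¹' S) := by
  obtain ⟨W, rfl⟩ := planeOf_surjective g
  have hset : {V : orthogonalGroup (Fin (k + m)) ℝ | rotGrass V⁻¹ (planeOf W) ∈ S} =
      ((fun V => V * W) ⁻¹' (planeOf ⁻¹' S))⁻¹ := by
    ext V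
    simp [rotGrass_planeOf]
  rw [hset, Measure.measure_inv, measure_preimage_mul_right]

section Counting

variable (hφ : Continuous φ) {A : Matrix (Fin (k + m)) (Fin (k + m)) ℝ} (hA : IsUnit A.det)
  {ε δ : ℝ} (hδ : ∀ x ∈ Metric.closedBall (0 : EuclideanSpace ℝ (Fin k × Fin m)) δ,
    ∀ V : orthogonalGroup (Fin (k + m)) ℝ, φ (planeOf V) - ε ≤ φ (planeOf (V * cayleyRot x)))

include hφ hA hδ

theorem indicator_goodPairs_le_sum (U V : orthogonalGroup (Fin (k + m)) ℝ) :
    (goodPairs A δ).indicator (fun p => ENNReal.ofReal (φ (planeOf p.2) - ε)) (U, V) ≤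
      ∑ g ∈ (goodPlanes_finite_and_ncard_le (U.1 * A)).1.toFinset,
        {V | rotGrass V⁻¹ g ∈ (grassChart : _ → Grass (k + m) k) '' Metric.closedBall 0 δ}.indicator
          (fun _ => ENNReal.ofReal (fixedSup φ (U.1 * A))) V := by
  refine Set.indicator_apply_le' ?_ fun _ => zero_le
  rintro ⟨x, hx, hgood⟩
  have hg : (planeOf (V * cayleyRot x) : Grass (k + m) k) ∈ goodPlanes (U.1 * A) := ⟨_, rfl, hgood⟩
  have hball : rotGrass V⁻¹ (planeOf (V * cayleyRot x)) ∈
      (grassChart : _ → Grass (k + m) k) '' Metric.closedBall 0 δ := by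
    rw [rotGrass_planeOf, inv_mul_cancel_left]
    exact ⟨x, hx, rfl⟩
  refine le_trans ?_ (Finset.single_le_sum (fun _ _ => zero_le)
    ((Set.Finite.mem_toFinset _).2 hg))
  rw [Set.indicator_of_mem (s := {V | rotGrass V⁻¹ _ ∈ _}) hball]
  exact ENNReal.ofReal_le_ofReal ((hδ x hx V).trans (le_fixedSup hφ
    (goodPlanes_subset_fixedPlanes (isUnit_det_orthogonal_mul hA U) hg)))

theorem lintegral_indicator_goodPairs_le (U : orthogonalGroup (Fin (k + m)) ℝ) :
    ∫⁻ V, (goodPairs A δ).indicator (fun p => ENNReal.ofReal (φ (planeOf p.2) - ε)) (U, V)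
        ∂orthogonalVolume (k + m) ≤
      (k + m).choose k * ENNReal.ofReal (fixedSup φ (U.1 * A)) *
        orthogonalVolume (k + m) ((planeOf : _ → Grass (k + m) k) ⁻¹'
          (grassChart '' Metric.closedBall 0 δ)) := by
  obtain ⟨hfin, hcard⟩ := goodPlanes_finite_and_ncard_le (k := k) (m := m) (U.1 * A)
  have hmeas : ∀ g : Grass (k + m) k,
      MeasurableSet {V | rotGrass V⁻¹ g ∈ grassChart '' Metric.closedBall 0 δ} := fun g =>
    (continuous_rotGrass.comp (continuous_inv.prodMk continuous_const)).measurable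
      ((isCompact_closedBall 0 δ).image continuous_grassChart).measurableSet
  refine (lintegral_mono (indicator_goodPairs_le_sum hφ hA hδ U)).trans ?_
  rw [lintegral_finsetSum _ fun g _ => measurable_const.indicator (hmeas g)]
  simp_rw [lintegral_indicator_const (hmeas _), measure_rotGrass_inv_mem]
  rw [Finset.sum_const, nsmul_eq_mul, ← mul_assoc, ← Set.ncard_eq_toFinset_card _ hfin]
  gcongr

theorem lintegral_mul_measure_goodRotations_le (h0 : ∀ g, 0 ≤ φ g) :
    ∫⁻ V, ENNReal.ofReal (φ (planeOf V) - ε) *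
        orthogonalVolume (k + m) (goodRotations (A * V.1) δ) ∂orthogonalVolume (k + m) ≤
      ((k + m).choose k *
          ∫⁻ U, ENNReal.ofReal (fixedSup φ (U.1 * A)) ∂orthogonalVolume (k + m)) *
        orthogonalVolume (k + m) ((planeOf : _ → Grass (k + m) k) ⁻¹'
          (grassChart '' Metric.closedBall 0 δ)) := by
  have hpairs := measurableSet_goodPairs (k := k) (m := m) A δ
  have hind : Measurable ((goodPairs A δ).indicator
      fun p => ENNReal.ofReal (φ (planeOf p.2) - ε)) :=
    (((hφ.comp (continuous_planeOf.comp continuous_snd)).sub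
      continuous_const).measurable.ennreal_ofReal).indicator hpairs
  have hsup := (measurable_fixedSup hφ h0 hA).ennreal_ofReal
  calc ∫⁻ V, ENNReal.ofReal (φ (planeOf V) - ε) *
        orthogonalVolume (k + m) (goodRotations (A * V.1) δ) ∂orthogonalVolume (k + m)
      = ∫⁻ V, ∫⁻ U, (goodPairs A δ).indicator
          (fun p => ENNReal.ofReal (φ (planeOf p.2) - ε)) (U, V)
          ∂orthogonalVolume (k + m) ∂orthogonalVolume (k + m) := by
        refine lintegral_congr fun V => ?_
        rw [← measure_goodPairs_slice,
          ← lintegral_indicator_const (measurable_prodMk_right hpairs)]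
        rfl
    _ = ∫⁻ U, ∫⁻ V, (goodPairs A δ).indicator
          (fun p => ENNReal.ofReal (φ (planeOf p.2) - ε)) (U, V)
          ∂orthogonalVolume (k + m) ∂orthogonalVolume (k + m) :=
        (lintegral_lintegral_swap (f := fun U V => (goodPairs A δ).indicator
          (fun p => ENNReal.ofReal (φ (planeOf p.2) - ε)) (U, V)) hind.aemeasurable).symm
    _ ≤ ∫⁻ U, (k + m).choose k * ENNReal.ofReal (fixedSup φ (U.1 * A)) *
          orthogonalVolume (k + m) ((planeOf : _ → Grass (k + m) k) ⁻¹'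
            (grassChart '' Metric.closedBall 0 δ)) ∂orthogonalVolume (k + m) :=
        lintegral_mono fun U => lintegral_indicator_goodPairs_le hφ hA hδ U
    _ = _ := by
        rw [lintegral_mul_const _ (hsup.const_mul _), lintegral_const_mul _ hsup]

theorem lintegral_mul_goodRotations_div_le (h0 : ∀ g, 0 ≤ φ g) :
    ∫⁻ V, ENNReal.ofReal (φ (planeOf V) - ε) *
        (orthogonalVolume (k + m) (goodRotations (A * V.1) δ) /
          orthogonalVolume (k + m) ((planeOf : _ → Grass (k + m) k) ⁻¹'
            (grassChart '' Metric.closedBall 0 δ))) ∂orthogonalVolume (k + m) ≤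
      (k + m).choose k *
        ∫⁻ U, ENNReal.ofReal (fixedSup φ (U.1 * A)) ∂orthogonalVolume (k + m) := by
  have hcont : Measurable fun V => ENNReal.ofReal (φ (planeOf V) - ε) :=
    ((hφ.comp continuous_planeOf).sub continuous_const).measurable.ennreal_ofReal
  simp_rw [div_eq_mul_inv, ← mul_assoc]
  rw [lintegral_mul_const _ (hcont.fun_mul (measurable_measure_goodRotations_mul A δ)),
    ← div_eq_mul_inv]
  exact ENNReal.div_le_of_le_mul (lintegral_mul_measure_goodRotations_le hφ hA hδ h0)

end Counting

theorem le_liminf_mul_goodRotations {A : Matrix (Fin (k + m)) (Fin (k + m)) ℝ} (hA : IsUnit A.det)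
    {c : ENNReal} (hc : c ≠ ⊤) (V : orthogonalGroup (Fin (k + m)) ℝ) :
    c ≤ liminf (fun δ => c * (orthogonalVolume (k + m) (goodRotations (A * V.1) δ) /
      orthogonalVolume (k + m) ((planeOf : _ → Grass (k + m) k) ⁻¹'
        (grassChart '' Metric.closedBall 0 δ)))) (𝓝[>] 0) := by
  have hAV : IsUnit (A * V.1).det := by
    rw [det_mul]
    exact hA.mul (UnitaryGroup.det_isUnit V)
  rw [ENNReal.liminf_const_mul_of_ne_top hc]
  exact le_mul_of_one_le_right zero_le (one_le_liminf_goodRotations hAV)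

section Inequality

variable (hφ : Continuous φ) (h0 : ∀ g, 0 ≤ φ g) {A : Matrix (Fin (k + m)) (Fin (k + m)) ℝ}
  (hA : IsUnit A.det)

include hφ h0 hA

theorem lintegral_sub_le_choose_mul_lintegral_fixedSup {ε : ℝ} (hε : 0 < ε) :
    ∫⁻ V, ENNReal.ofReal (φ (planeOf V) - ε) ∂orthogonalVolume (k + m) ≤
      (k + m).choose k *
        ∫⁻ U, ENNReal.ofReal (fixedSup φ (U.1 * A)) ∂orthogonalVolume (k + m) := by
  obtain ⟨η, hη, hball⟩ := Metric.nhds_basis_closedBall.mem_iff.1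
    (eventually_sub_le_planeOf_mul_cayleyRot hφ hε)
  have hcont : Measurable fun V => ENNReal.ofReal (φ (planeOf V) - ε) :=
    ((hφ.comp continuous_planeOf).sub continuous_const).measurable.ennreal_ofReal
  let p : ℝ → ENNReal := fun δ => orthogonalVolume (k + m)
    ((planeOf : _ → Grass (k + m) k) ⁻¹' (grassChart '' Metric.closedBall 0 δ))
  calc ∫⁻ V, ENNReal.ofReal (φ (planeOf V) - ε) ∂orthogonalVolume (k + m)
      ≤ ∫⁻ V, liminf (fun δ => ENNReal.ofReal (φ (planeOf V) - ε) *
          (orthogonalVolume (k + m) (goodRotations (A * V.1) δ) / p δ)) (𝓝[>] 0)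
          ∂orthogonalVolume (k + m) :=
        lintegral_mono fun V => le_liminf_mul_goodRotations hA ENNReal.ofReal_ne_top V
    _ ≤ liminf (fun δ => ∫⁻ V, ENNReal.ofReal (φ (planeOf V) - ε) *
          (orthogonalVolume (k + m) (goodRotations (A * V.1) δ) / p δ)
          ∂orthogonalVolume (k + m)) (𝓝[>] 0) :=
        lintegral_liminf_le fun δ =>
          hcont.mul ((measurable_measure_goodRotations_mul A δ).div_const _)
    _ ≤ _ := liminf_le_of_frequently_le' (Eventually.frequently <|
        (eventually_le_nhds hη).filter_mono nhdsWithin_le_nhds |>.mono fun δ hδ =>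
          lintegral_mul_goodRotations_div_le hφ hA
            (fun x hx => hball (Metric.closedBall_subset_closedBall hδ hx)) h0)

theorem lintegral_planeOf_le_choose_mul_lintegral_fixedSup :
    ∫⁻ V, ENNReal.ofReal (φ (planeOf V)) ∂orthogonalVolume (k + m) ≤
      (k + m).choose k *
        ∫⁻ U, ENNReal.ofReal (fixedSup φ (U.1 * A)) ∂orthogonalVolume (k + m) := by
  have hlim : ∀ V : orthogonalGroup (Fin (k + m)) ℝ, Tendsto
      (fun ε => ENNReal.ofReal (φ (planeOf V) - ε)) (𝓝[>] 0)
      (𝓝 (ENNReal.ofReal (φ (planeOf V)))) := fun V => by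
    have hcont : Continuous fun ε => ENNReal.ofReal (φ (planeOf V) - ε) :=
      ENNReal.continuous_ofReal.comp (continuous_const.sub continuous_id)
    simpa using (hcont.tendsto 0).mono_left nhdsWithin_le_nhds
  calc ∫⁻ V, ENNReal.ofReal (φ (planeOf V)) ∂orthogonalVolume (k + m)
      = ∫⁻ V, liminf (fun ε => ENNReal.ofReal (φ (planeOf V) - ε)) (𝓝[>] 0)
          ∂orthogonalVolume (k + m) := lintegral_congr fun V => (hlim V).liminf_eq.symm
    _ ≤ liminf (fun ε => ∫⁻ V, ENNReal.ofReal (φ (planeOf V) - ε) ∂orthogonalVolume (k + m))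
          (𝓝[>] 0) :=
        lintegral_liminf_le fun ε =>
          ((hφ.comp continuous_planeOf).sub continuous_const).measurable.ennreal_ofReal
    _ ≤ _ := liminf_le_of_frequently_le' <| Eventually.frequently <|
        eventually_mem_nhdsWithin.mono fun _ hε =>
          lintegral_sub_le_choose_mul_lintegral_fixedSup hφ h0 hA hε

theorem cConst_mul_integral_le_integral_fixedSup :
    cConst (k + m) k * ∫ g, φ g ∂grassVolume (k + m) k ≤
      ∫ U : orthogonalGroup (Fin (k + m)) ℝ, fixedSup φ (U.1 * A) ∂orthogonalVolume (k + m) := by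
  have hle := (fibreVolume_mul_lintegral_le hφ.measurable.ennreal_ofReal).trans
    (lintegral_planeOf_le_choose_mul_lintegral_fixedSup hφ h0 hA)
  rw [← Set.univ_prod_univ, Measure.prod_prod,
    ← ofReal_integral_eq_lintegral_ofReal
      (hφ.integrable_of_hasCompactSupport (.of_compactSpace _)) (.of_forall h0),
    ← ofReal_integral_eq_lintegral_ofReal (integrable_fixedSup hφ h0 hA)
      (.of_forall fun _ => fixedSup_nonneg h0 _)] at hle
  have hreal := ENNReal.toReal_mono (by finiteness) hle
  rw [ENNReal.toReal_mul, ENNReal.toReal_mul, ENNReal.toReal_mul, ENNReal.toReal_natCast,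
    ENNReal.toReal_ofReal (integral_nonneg h0),
    ENNReal.toReal_ofReal (integral_nonneg fun _ => fixedSup_nonneg h0 _)] at hreal
  rw [cConst, Nat.add_sub_cancel_left, div_mul_eq_mul_div, div_le_iff₀ (by
    exact_mod_cast Nat.choose_pos (Nat.le_add_right k m)), mul_comm (∫ U, _ ∂_)]
  exact hreal

end Inequality

end FixedSup

theorem theorem2_general {n k : ℕ} (hk : k ≤ n) (A : GL (Fin n) ℝ) {φ : Grass n k → ℝ}
    (hφ : Continuous φ) (h0 : ∀ g, 0 ≤ φ g) :
    Integrable (fun U : Matrix.orthogonalGroup (Fin n) ℝ => fixedSup φ (U.1 * A.1))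
        (orthogonalVolume n) ∧
      Integrable φ (grassVolume n k) ∧
      cConst n k * ∫ g, φ g ∂grassVolume n k ≤
        ∫ U : Matrix.orthogonalGroup (Fin n) ℝ, fixedSup φ (U.1 * A.1) ∂orthogonalVolume n := by
  obtain ⟨m, rfl⟩ := Nat.exists_eq_add_of_le hk
  have hA : IsUnit A.1.det := (Matrix.isUnit_iff_isUnit_det _).1 A.isUnit
  exact ⟨integrable_fixedSup hφ h0 hA, hφ.integrable_of_hasCompactSupport (.of_compactSpace _),
    cConst_mul_integral_le_integral_fixedSup hφ h0 hA⟩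

end

theorem theorem2 (n k : ℕ) (hk : k ≤ n) (A : GL (Fin n) ℝ) :
    Integrable (fun U : Matrix.orthogonalGroup (Fin n) ℝ =>
        supFixed k ((U : Matrix (Fin n) (Fin n) ℝ) * (A : Matrix (Fin n) (Fin n) ℝ))) (orthogonalVolume n) ∧
      Integrable (fun g : Grass n k => Real.posLog (absDetOn (A : Matrix (Fin n) (Fin n) ℝ) g))
        (grassVolume n k) ∧
      cConst n k *
          ∫ g : Grass n k, Real.posLog (absDetOn (A : Matrix (Fin n) (Fin n) ℝ) g)
            ∂(grassVolume n k) ≤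
        ∫ U : Matrix.orthogonalGroup (Fin n) ℝ,
          supFixed k ((U : Matrix (Fin n) (Fin n) ℝ) * (A : Matrix (Fin n) (Fin n) ℝ)) ∂(orthogonalVolume n) := by
  have hφ : Continuous fun g : Grass n k => Real.posLog (absDetOn A.1 g) := by
    obtain ⟨m, rfl⟩ := Nat.exists_eq_add_of_le hk
    exact Real.continuous_posLog.comp (continuous_absDetOn A.1)
  simp_rw [supFixed_orthogonal_mul]
  exact theorem2_general hk A hφ fun _ => Real.posLog_nonneg
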